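/- Let \(K\) be a field and let \(\omega\) be a feasible exponent of matrix multiplication over \(K\), that is, two \(s\times s\) matrices over \(K\) can be multiplied in \(O(s^{\omega})\) operations in \(K\). Computations are straight-line programs over \(K\) whose inputs are the coefficients of the given polynomials; the programs depend only on the size parameters of the input, and their cost is the number of operations \(+,-,\times,/\) in \(K\) (and loadings of constants of \(K\)), divisions by zero being excluded. Write \(K[x,y]_{<(r,s)}\) for the set of polynomials of degree less than \(r\) in \(x\) and less than \(s\) in \(y\). For \(f\in K[x]\) of degree \(n\), \(a\in K[x]\) of degree less than \(n\) and \(\mu\ge 1\), let \[\mathcal N_\mu=\{p\in K[x,y] : \deg_y p<\mu,\ p(x,a)\equiv 0 \bmod f\},\] a free \(K[x]\)-module of rank \(\mu\). A minimal basis of \(\mathcal N_\mu\) is a matrix \(R\in K[x]^{\mu\times\mu}\) whose columns are the vectors of coefficients (with respect to \(1,y,\dots,y^{\mu-1}\)) of the elements of a basis of \(\mathcal N_\mu\), and which is column reduced: no column is zero and \(\deg\det R=d_1+\dots+d_\mu\), where \(d_j\) is the maximal degree of the entries of the \(j\)-th column. Its degree is the maximal degree of its entries. There are constants \(C,e\),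 depending only on \(K\) and \(\omega\), such that the following holds. Let \(n,m,d,\mu\) be integers with \(m,d\ge 1\) and \(d^{1/3}\le\mu\le n\). Given \(f\in K[x]\) of degree \(n\), \(a\in K[x]\) of degree less than \(n\), \(G\in K[x,y]_{<(m,d)}\), and polynomials \(A_j,B_j\in K[x,y]_{<(\delta,\mu)}\) for \(0\le j<\mu\), with \[A_j(x,a)\equiv a^{j\mu}\bmod f,\qquad B_j(x,a)\equiv a^{j\mu^2}\bmod f,\] where \(\delta\) is the degree of a minimal basis of \(\mathcal N_\mu\), one can compute the remainder of \(G(x,a)\) modulo \(f\) in at most \[C\,(1+\log n)^{e}\,\mu^{\omega}(\delta+m\mu)\] operations in \(K\), that is, in \(\tilde O(\mu^{\omega}(\delta+m\mu))\) operations, where \(\tilde O\) hides factors polylogarithmic in \(n\). -/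

import Mathlib

open scoped Polynomial Polynomial.Bivariate

namespace BivComp

/-! ### Straight-line programs over a field and their number of operations -/

/-- An operand of an instruction: one of the input values, or the result of the `k`-th instruction
of the program (counted from `0`). -/
inductive Operand (ι : Type*)
  | input (i : ι)
  | result (k : ℕ)

/-- One arithmetic operation in `K` (or the loading of a constant of `K`). -/
inductive Instr (K ι : Type*)
  | const (c : K)
  | add (u v : Operand ι)
  | sub (u v : Operand ι)
  | mul (u v : Operand ι)
  | div (u v : Operand ι)

/-- A straight-line program over `K` with inputs indexed by `ι` and outputs indexed by `ο`. -/
structure SLP (K ι ο : Type*) where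
  /-- the instructions, in order of execution -/
  code : List (Instr K ι)
  /-- where the outputs are found at the end -/
  out : ο → Operand ι

variable {K ι ο : Type*}

/-- The value of an operand, for inputs `x` and the list `h` of the results obtained so far
(undefined if the operand refers to a result that is not available). -/
def Operand.value (x : ι → K) (h : List K) : Operand ι → Option K
  | .input i => some (x i)
  | .result k => h[k]?

open Classical in
/-- The result of an instruction; it is undefined when an operand is undefined and for a division
by zero. -/
noncomputable def Instr.value [Field K] (x : ι → K) (h : List K) : Instr K ι → Option K
  | .const c => some c
  | .add u v => (u.value x h).bind fun b => (v.value x h).bind fun c => some (b + c)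
  | .sub u v => (u.value x h).bind fun b => (v.value x h).bind fun c => some (b - c)
  | .mul u v => (u.value x h).bind fun b => (v.value x h).bind fun c => some (b * c)
  | .div u v => (u.value x h).bind fun b => (v.value x h).bind fun c =>
      if c = 0 then none else some (b / c)

/-- Execute a list of instructions, starting from the list `h` of earlier results and appending
each new result to it. -/
noncomputable def runFrom [Field K] (x : ι → K) : List K → List (Instr K ι) → Option (List K)
  | h, [] => some h
  | h, c :: cs => (c.value x h).bind fun r => runFrom x (h ++ [r]) cs

/-- The number of operations of a straight-line program. -/
def SLP.cost (P : SLP K ι ο) : ℕ := P.code.length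

/-- On the inputs `x`, the program `P` runs without undefined operation and its outputs are `y`. -/
def SLP.Outputs [Field K] (P : SLP K ι ο) (x : ι → K) (y : ο → K) : Prop :=
  ∃ h : List K, runFrom x [] P.code = some h ∧ ∀ o, (P.out o).value x h = some (y o)

/-- `ω` is a (feasible) exponent of matrix multiplication over `K`: two `s × s` matrices over `K`
can be multiplied in `O(s ^ ω)` operations in `K`. -/
def IsMatMulExponent (K : Type*) [Field K] (ω : ℝ) : Prop :=
  ∃ C : ℝ, ∀ s : ℕ, ∃ P : SLP K ((Fin s × Fin s) ⊕ (Fin s × Fin s)) (Fin s × Fin s),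
    (P.cost : ℝ) ≤ C * (s : ℝ) ^ ω ∧
    ∀ M N : Matrix (Fin s) (Fin s) K,
      P.Outputs (Sum.elim (fun ij => M ij.1 ij.2) (fun ij => N ij.1 ij.2))
        (fun ij => (M * N) ij.1 ij.2)

/-! ### Bivariate polynomials and the module of relations

`K[X][Y]` is the ring of polynomials in `Y` over `K[X]`; `p.eval a` is `p(x, a)` for `a : K[X]`. -/

/-- `p` has degree less than `m` in `x` and less than `d` in `y`. -/
def BidegLT [Field K] (m d : ℕ) (p : K[X][Y]) : Prop :=
  p.degree < d ∧ ∀ j, (p.coeff j).degree < m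

/-- The `K[X]`-module `N_μ` of the polynomials `p` of `y`-degree less than `μ` such that
`p(x, a) = 0 mod f`. -/
noncomputable def relModule [Field K] (f a : K[X]) (μ : ℕ) : Submodule K[X] K[X][Y] where
  carrier := {p | p.degree < μ ∧ f ∣ p.eval a}
  zero_mem' := by simp
  add_mem' := by
    rintro p q ⟨hp, hp'⟩ ⟨hq, hq'⟩
    refine ⟨(Polynomial.degree_add_le p q).trans_lt (max_lt hp hq), ?_⟩
    simpa using dvd_add hp' hq'
  smul_mem' := by
    rintro c p ⟨hp, hp'⟩
    refine ⟨(Polynomial.degree_smul_le c p).trans_lt hp, ?_⟩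
    simpa using Dvd.dvd.mul_left hp' c

/-- The polynomial in `K[X][Y]` whose coefficients are in the `j`-th column of `R`. -/
noncomputable def colPoly [Field K] {μ : ℕ} (R : Matrix (Fin μ) (Fin μ) K[X]) (j : Fin μ) :
    K[X][Y] :=
  ∑ i : Fin μ, Polynomial.monomial (i : ℕ) (R i j)

/-- The maximal degree of the entries of the `j`-th column (used for nonzero columns). -/
def colDegree [Field K] {μ : ℕ} (R : Matrix (Fin μ) (Fin μ) K[X]) (j : Fin μ) : ℕ :=
  Finset.univ.sup fun i => (R i j).natDegree

/-- The degree of a polynomial matrix: the maximal degree of its entries. -/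
def matDegree [Field K] {μ : ℕ} (R : Matrix (Fin μ) (Fin μ) K[X]) : ℕ :=
  Finset.univ.sup fun j => colDegree R j

/-- Column reduced matrices: no column is zero and the degree of the determinant is the sum of the
column degrees. -/
def IsColumnReduced [Field K] {μ : ℕ} (R : Matrix (Fin μ) (Fin μ) K[X]) : Prop :=
  (∀ j, ∃ i, R i j ≠ 0) ∧ R.det.degree = ((∑ j, colDegree R j : ℕ) : WithBot ℕ)

/-- `R` is (the matrix of) a minimal basis of `N_μ`: its columns are the coefficient vectors of a
basis of `N_μ`, and it is column reduced. -/
def IsMinimalBasis [Field K] (f a : K[X]) {μ : ℕ} (R : Matrix (Fin μ) (Fin μ) K[X]) : Prop :=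
  LinearIndependent K[X] (colPoly R) ∧
  Submodule.span K[X] (Set.range (colPoly R)) = relModule f a μ ∧
  IsColumnReduced R

/-! ### The input of bivariate modular composition, as a list of coefficients -/

/-- Index set of the coefficients that are given: those of `f` (degree `n`), of `a` (degree less
than `n`), of `G` (bidegree less than `(m, d)`), and of the polynomials `A j` and `B j`, `j < μ`
(bidegree less than `(δ, μ)`). -/
inductive InputIdx (n m d μ δ : ℕ)
  | f (i : Fin (n + 1))
  | a (i : Fin n)
  | G (i : Fin m) (k : Fin d)
  | A (j : Fin μ) (i : Fin δ) (k : Fin μ)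
  | B (j : Fin μ) (i : Fin δ) (k : Fin μ)

/-- The coefficient with a given index; `(p.coeff k).coeff i` is the coefficient of `x^i y^k`. -/
noncomputable def inputCoeff [Field K] {n m d μ δ : ℕ} (f a : K[X]) (G : K[X][Y])
    (A B : Fin μ → K[X][Y]) : InputIdx n m d μ δ → K
  | .f i => f.coeff i
  | .a i => a.coeff i
  | .G i k => (G.coeff k).coeff i
  | .A j i k => ((A j).coeff k).coeff i
  | .B j i k => ((B j).coeff k).coeff i

end BivComp

/-! The algorithm is of baby-step/giant-step type. Since `d ≤ μ ^ 3`, the polynomial `G` is cut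
along `y` into `μ ^ 2` slices of `y`-degree less than `μ`, and `G(x, a)` is the double sum over `j,
i < μ` of `a ^ (j * μ ^ 2) * a ^ (i * μ)` times a slice at `a` (`eval_eq_sum_slice`). Replacing the
two powers by `B j` and `A i` gives a polynomial `H` of bidegree less than `(2 * δ + m, 3 * μ)` with
`H(x, a) = G(x, a)` modulo `f` (`dvd_eval_outerSum_sub`).

The sums over `i` form a matrix product. Each `A i` is cut along `x` into pieces of length `m`, so
that both factors have bidegree less than `(m, μ)`; there are about `δ / (m * μ)` products of `μ ×
μ` matrices, whose entries become univariate of degree less than `2 * m * μ` by Kronecker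
substitution. This gives the term `μ ^ ω * (δ + m * μ)` (`Reach.innerSum`). The sums over `j` take
`μ` bivariate products (`Reach.outerSum`), and `H(x, a)` is found by Horner's rule with `3 * μ`
steps modulo `f` (`Reach.hornerMod`).

Horner's rule costs about `μ * n`. This is affordable because the determinant of a minimal basis is
`f` up to a unit: the column degrees sum to `n`, hence `δ ≤ n ≤ μ * δ`
(`IsMinimalBasis.matDegree_bounds`), and `μ * n ≤ μ ^ 2 * δ`. A matrix multiplication program with
`W` operations has `μ ^ 2 ≤ W` because it must compute `μ ^ 2` different outputs
(`sq_le_cost_of_matMul`). If `m > n`, then `G` is first cut along `x` into pieces of length `n`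
(`Reach.composition_of_lt`).

All this rests on quasi-linear multiplication in `K[X]` over an arbitrary field (`exists_fastMul`),
by Fourier transforms of length a power of a prime `q`, `q = 3` or `5`, invertible in `K`, with
respect to a root of unity adjoined synthetically. The algorithms are bilinear with linear
postprocessing, so a product of polynomial matrices reduces to products of matrices over `K`, one
for each multiplication of the bilinear algorithm (`Reach.polyMatMul`).

Programs are handled through functions on the set of admissible inputs: `Reach S c T` composes
easily, and it is translated from and to straight-line programs by `Reach.of_slp` and
`Reach.exists_slp`. -/

namespace BivComp

universe u

/-! ### Straight-line computations with families of functions -/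

section Reach

variable {X : Type*} {K : Type*} [Field K]

/-- `g` is obtained by one arithmetic operation from functions in `A`. -/
def IsStep (A : Set (X → K)) (g : X → K) : Prop :=
  (∃ c : K, g = fun _ => c) ∨ ∃ u ∈ A, ∃ v ∈ A,
    g = u + v ∨ g = u - v ∨ g = u * v ∨ ((∀ x, v x ≠ 0) ∧ g = u / v)

/-- `l` lists, in reverse order, the results of a computation from `S` and the constant `0`. -/
inductive IsComputation (S : Set (X → K)) : List (X → K) → Prop
  | nil : IsComputation S []
  | cons {l : List (X → K)} {g : X → K} : IsComputation S l →
      IsStep (insert 0 S ∪ {h | h ∈ l}) g → IsComputation S (g :: l)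

/-- The functions in `T` can be computed from those in `S` with at most `c` operations, when the
constant `0` is available for free. -/
def Reach (S : Set (X → K)) (c : ℕ) (T : Set (X → K)) : Prop :=
  ∃ l, IsComputation S l ∧ l.length ≤ c ∧ T ⊆ insert 0 S ∪ {h | h ∈ l}

theorem IsStep.mono {A B : Set (X → K)} (h : A ⊆ B) {g : X → K} (hg : IsStep A g) :
    IsStep B g := by
  rcases hg with hg | ⟨u, hu, v, hv, hg⟩
  · exact Or.inl hg
  · exact Or.inr ⟨u, h hu, v, h hv, hg⟩

theorem IsComputation.append {S T : Set (X → K)} {l l' : List (X → K)} (h : IsComputation S l)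
    (h' : IsComputation T l') (hT : T ⊆ insert 0 S ∪ {h | h ∈ l}) :
    IsComputation S (l' ++ l) := by
  induction h' with
  | nil => exact h
  | cons _ hs ih =>
    refine ih.cons (hs.mono ?_)
    rintro g ((rfl | hg) | hg)
    · simp
    · rcases hT hg with hg | hg
      · exact Or.inl hg
      · exact Or.inr (List.mem_append_right _ hg)
    · exact Or.inr (List.mem_append_left _ hg)

namespace Reach

theorem of_subset {S T : Set (X → K)} (h : T ⊆ insert 0 S) : Reach S 0 T :=
  ⟨[], .nil, le_rfl, h.trans Set.subset_union_left⟩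

theorem trans {S T U : Set (X → K)} {c c' : ℕ} (h : Reach S c T) (h' : Reach (S ∪ T) c' U) :
    Reach S (c + c') U := by
  obtain ⟨l, hl, hc, hT⟩ := h
  obtain ⟨l', hl', hc', hU⟩ := h'
  have hST : S ∪ T ⊆ insert 0 S ∪ {h | h ∈ l} :=
    Set.union_subset ((Set.subset_insert _ _).trans Set.subset_union_left) hT
  refine ⟨l' ++ l, hl.append hl' hST, by simp; omega, ?_⟩
  intro g hg
  rcases hU hg with (rfl | hg) | hg
  · simp
  · rcases hST hg with hg | hg
    · exact Or.inl hg
    · exact Or.inr (List.mem_append_right _ hg)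
  · exact Or.inr (List.mem_append_left _ hg)

theorem mono {S S' T T' : Set (X → K)} {c c' : ℕ} (h : Reach S c T) (hS : S ⊆ S') (hc : c ≤ c')
    (hT : T' ⊆ insert 0 (S ∪ T)) : Reach S' c' T' := by
  obtain ⟨l, hl, hlc, hlT⟩ := h
  refine ⟨l, ?_, hlc.trans hc, ?_⟩
  · simpa using IsComputation.nil.append hl
      (hS.trans ((Set.subset_insert _ _).trans Set.subset_union_left))
  · intro g hg
    rcases hT hg with rfl | hg | hg
    · simp
    · exact Or.inl (Or.inr (hS hg))
    · rcases hlT hg with (rfl | hg) | hg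
      · simp
      · exact Or.inl (Or.inr (hS hg))
      · exact Or.inr hg

theorem mono_left {S S' T : Set (X → K)} {c : ℕ} (h : Reach S c T) (hS : S ⊆ S') :
    Reach S' c T :=
  h.mono hS le_rfl (Set.subset_union_right.trans (Set.subset_insert _ _))

theorem mono_cost {S T : Set (X → K)} {c c' : ℕ} (h : Reach S c T) (hc : c ≤ c') :
    Reach S c' T :=
  h.mono subset_rfl hc (Set.subset_union_right.trans (Set.subset_insert _ _))

theorem mono_right {S T T' : Set (X → K)} {c : ℕ} (h : Reach S c T)
    (hT : T' ⊆ insert 0 (S ∪ T)) : Reach S c T' :=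
  h.mono subset_rfl le_rfl hT

theorem mono_right' {S T T' : Set (X → K)} {c : ℕ} (h : Reach S c T) (hT : T' ⊆ T) :
    Reach S c T' :=
  h.mono_right (hT.trans (Set.subset_union_right.trans (Set.subset_insert _ _)))

/-- Composition, when the second computation uses only results of the first one. -/
theorem comp {S T U : Set (X → K)} {c c' : ℕ} (h : Reach S c T) (h' : Reach T c' U) :
    Reach S (c + c') U :=
  h.trans (h'.mono_left Set.subset_union_right)

theorem union {S T T' : Set (X → K)} {c c' : ℕ} (h : Reach S c T) (h' : Reach S c' T') :
    Reach S (c + c') (T ∪ T') := by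
  refine (h.trans (h'.mono_left Set.subset_union_left |>.mono_right (T' := T ∪ T') ?_))
  intro g hg
  rcases hg with hg | hg
  · exact Or.inr (Or.inl (Or.inr hg))
  · exact Or.inr (Or.inr hg)

theorem biUnion {ι : Type*} {S : Set (X → K)} {T : ι → Set (X → K)} {c : ℕ} (s : Finset ι)
    (h : ∀ i ∈ s, Reach S c (T i)) : Reach S (s.card * c) (⋃ i ∈ s, T i) := by
  classical
  induction s using Finset.induction_on with
  | empty => exact (of_subset (by simp)).mono_cost (by simp)
  | insert a s ha ih =>
    have := (h a (by simp)).union (ih fun i hi => h i (by simp [hi]))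
    rw [Finset.set_biUnion_insert]
    refine this.mono_cost ?_
    rw [Finset.card_insert_of_notMem ha]
    exact le_of_eq (by ring)

theorem iUnion {ι : Type*} [Fintype ι] {S : Set (X → K)} {T : ι → Set (X → K)} {c : ℕ}
    (h : ∀ i, Reach S c (T i)) : Reach S (Fintype.card ι * c) (⋃ i, T i) := by
  simpa using biUnion Finset.univ fun i _ => h i

theorem range {ι : Type*} [Fintype ι] {S : Set (X → K)} {v : ι → X → K} {c : ℕ}
    (h : ∀ i, Reach S c {v i}) : Reach S (Fintype.card ι * c) (Set.range v) := by
  rw [← Set.iUnion_singleton_eq_range]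
  exact iUnion h

theorem of_isStep {S : Set (X → K)} {g : X → K} (h : IsStep (insert 0 S) g) : Reach S 1 {g} :=
  ⟨[g], .cons .nil (h.mono Set.subset_union_left), by simp, by simp⟩

theorem const {S : Set (X → K)} (c : K) : Reach S 1 {fun _ => c} :=
  of_isStep (Or.inl ⟨c, rfl⟩)

theorem add {S : Set (X → K)} {u v : X → K} (hu : u ∈ insert 0 S) (hv : v ∈ insert 0 S) :
    Reach S 1 {u + v} :=
  of_isStep (Or.inr ⟨u, hu, v, hv, Or.inl rfl⟩)

theorem sub {S : Set (X → K)} {u v : X → K} (hu : u ∈ insert 0 S) (hv : v ∈ insert 0 S) :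
    Reach S 1 {u - v} :=
  of_isStep (Or.inr ⟨u, hu, v, hv, Or.inr (Or.inl rfl)⟩)

theorem mul {S : Set (X → K)} {u v : X → K} (hu : u ∈ insert 0 S) (hv : v ∈ insert 0 S) :
    Reach S 1 {u * v} :=
  of_isStep (Or.inr ⟨u, hu, v, hv, Or.inr (Or.inr (Or.inl rfl))⟩)

theorem div {S : Set (X → K)} {u v : X → K} (hu : u ∈ insert 0 S) (hv : v ∈ insert 0 S)
    (h0 : ∀ x, v x ≠ 0) : Reach S 1 {u / v} :=
  of_isStep (Or.inr ⟨u, hu, v, hv, Or.inr (Or.inr (Or.inr ⟨h0, rfl⟩))⟩)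

theorem sum_range {S : Set (X → K)} {v : ℕ → X → K} (k : ℕ)
    (h : ∀ r < k, v r ∈ insert 0 S) : Reach S k {∑ r ∈ Finset.range k, v r} := by
  induction k with
  | zero => exact of_subset (by simp)
  | succ k ih =>
    rw [Finset.sum_range_succ]
    refine (ih fun r hr => h r (by omega)).trans (Reach.add (by simp) ?_)
    exact (Set.insert_subset_insert Set.subset_union_left) (h k (by omega))

end Reach

/-! ### Comparison with straight-line programs -/

theorem runFrom_append {ι : Type*} (x : ι → K) (cs ds : List (Instr K ι)) (h : List K) :
    runFrom x h (cs ++ ds) = (runFrom x h cs).bind fun h' => runFrom x h' ds := by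
  induction cs generalizing h with
  | nil => rfl
  | cons c cs ih =>
    simp only [List.cons_append, runFrom]
    cases c.value x h with
    | none => rfl
    | some r => simpa using ih _

/-- The history starts with the loaded constant `0`, so result `0` serves the free zero function and
the results of the computation are shifted by one. -/
theorem exists_operand {ι : Type*} {u : X → ι → K} {l : List (X → K)} {g : X → K}
    (hg : g ∈ insert 0 (Set.range fun i x => u x i) ∪ {h | h ∈ l}) :
    ∃ o : Operand ι, ∀ x, o.value (u x) (0 :: l.reverse.map (· x)) = some (g x) := by
  rcases hg with (rfl | ⟨i, rfl⟩) | hg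
  · exact ⟨.result 0, fun x => rfl⟩
  · exact ⟨.input i, fun x => rfl⟩
  · obtain ⟨k, hk, rfl⟩ := List.mem_iff_getElem.1 (List.mem_reverse.2 hg)
    refine ⟨.result (k + 1), fun x => ?_⟩
    simp only [Operand.value, List.getElem?_cons_succ, List.getElem?_map]
    rw [List.getElem?_eq_getElem hk]
    rfl

theorem IsComputation.exists_code {ι : Type*} {u : X → ι → K} {l : List (X → K)}
    (h : IsComputation (Set.range fun i x => u x i) l) :
    ∃ code : List (Instr K ι), code.length = l.length ∧
      ∀ x, runFrom (u x) [0] code = some (0 :: l.reverse.map (· x)) := by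
  induction h with
  | nil => exact ⟨[], rfl, fun x => rfl⟩
  | @cons l g _ hs ih =>
    obtain ⟨code, hlen, hrun⟩ := ih
    suffices ∃ c : Instr K ι, ∀ x, c.value (u x) (0 :: l.reverse.map (· x)) = some (g x) by
      obtain ⟨c, hc⟩ := this
      refine ⟨code ++ [c], by simp [hlen], fun x => ?_⟩
      rw [runFrom_append, hrun x]
      simp [-List.map_reverse, runFrom, hc x]
    rcases hs with ⟨c, rfl⟩ | ⟨a, ha, b, hb, hg⟩
    · exact ⟨.const c, fun x => rfl⟩
    · obtain ⟨oa, hoa⟩ := exists_operand ha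
      obtain ⟨ob, hob⟩ := exists_operand hb
      rcases hg with rfl | rfl | rfl | ⟨h0, rfl⟩
      · exact ⟨.add oa ob, fun x => by simp [-List.map_reverse, Instr.value, hoa x, hob x]⟩
      · exact ⟨.sub oa ob, fun x => by simp [-List.map_reverse, Instr.value, hoa x, hob x]⟩
      · exact ⟨.mul oa ob, fun x => by simp [-List.map_reverse, Instr.value, hoa x, hob x]⟩
      · exact ⟨.div oa ob, fun x => by simp [-List.map_reverse, Instr.value, hoa x, hob x, h0 x]⟩

theorem Reach.exists_slp {ι ο : Type*} {u : X → ι → K} {v : X → ο → K} {c : ℕ}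
    (h : Reach (Set.range fun i x => u x i) c (Set.range fun o x => v x o)) :
    ∃ P : SLP K ι ο, P.cost ≤ c + 1 ∧ ∀ x, P.Outputs (u x) (v x) := by
  obtain ⟨l, hl, hc, hT⟩ := h
  obtain ⟨code, hlen, hrun⟩ := hl.exists_code
  choose out hout using fun o => exists_operand (hT ⟨o, rfl⟩)
  -- The extra operation loads the constant `0` that `Reach` has for free.
  refine ⟨⟨.const 0 :: code, out⟩, by simp [SLP.cost]; omega, fun x => ⟨_, ?_, fun o => hout o x⟩⟩
  simp [runFrom, Instr.value, hrun x]

/-- Whether a result is available depends only on the length of the history, which is the same for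
all inputs; one input suffices to see that the index is in range. -/
theorem exists_function_of_operand [Nonempty X] {ι : Type*} {u : X → ι → K}
    {l : List (X → K)} (o : Operand ι)
    (h : ∀ x, (o.value (u x) (l.reverse.map (· x))).isSome) :
    ∃ g ∈ insert 0 (Set.range fun i x => u x i) ∪ {h | h ∈ l},
      ∀ x, o.value (u x) (l.reverse.map (· x)) = some (g x) := by
  cases o with
  | input i => exact ⟨fun x => u x i, Or.inl (Or.inr ⟨i, rfl⟩), fun x => rfl⟩
  | result k =>
    have hk : k < l.reverse.length := by
      by_contra hk
      have := h (Classical.arbitrary X)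
      simp only [Operand.value, List.getElem?_map] at this
      rw [List.getElem?_eq_none (by omega)] at this
      simp at this
    refine ⟨l.reverse[k], Or.inr (List.mem_reverse.1 (List.getElem_mem hk)), fun x => ?_⟩
    simp only [Operand.value, List.getElem?_map]
    rw [List.getElem?_eq_getElem hk]
    rfl

theorem exists_isStep_of_instr [Nonempty X] {ι : Type*} {u : X → ι → K}
    {l : List (X → K)} (c : Instr K ι)
    (h : ∀ x, (c.value (u x) (l.reverse.map (· x))).isSome) :
    ∃ g, IsStep (insert 0 (Set.range fun i x => u x i) ∪ {h | h ∈ l}) g ∧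
      ∀ x, c.value (u x) (l.reverse.map (· x)) = some (g x) := by
  have key : ∀ (oa ob : Operand ι) (k : K → K → Option K),
      (∀ x, ((oa.value (u x) (l.reverse.map (· x))).bind fun b =>
        (ob.value (u x) (l.reverse.map (· x))).bind fun c => k b c).isSome) →
      ∃ a ∈ insert 0 (Set.range fun i x => u x i) ∪ {h | h ∈ l},
      ∃ b ∈ insert 0 (Set.range fun i x => u x i) ∪ {h | h ∈ l},
        (∀ x, oa.value (u x) (l.reverse.map (· x)) = some (a x)) ∧
        (∀ x, ob.value (u x) (l.reverse.map (· x)) = some (b x)) ∧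
        ∀ x, (k (a x) (b x)).isSome := by
    intro oa ob k hk
    obtain ⟨a, ha, ha'⟩ := exists_function_of_operand (u := u) (l := l) oa fun x => by
      have := hk x
      cases h : oa.value (u x) (l.reverse.map (· x)) <;> simp_all [-List.map_reverse]
    obtain ⟨b, hb, hb'⟩ := exists_function_of_operand (u := u) (l := l) ob fun x => by
      have := hk x
      rw [ha' x] at this
      cases h : ob.value (u x) (l.reverse.map (· x)) <;> simp_all [-List.map_reverse]
    refine ⟨a, ha, b, hb, ha', hb', fun x => ?_⟩
    simpa [-List.map_reverse, ha' x, hb' x] using hk x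
  cases c with
  | const c => exact ⟨_, Or.inl ⟨c, rfl⟩, fun x => rfl⟩
  | add oa ob =>
    obtain ⟨a, ha, b, hb, ha', hb', -⟩ := key oa ob _ h
    exact ⟨a + b, Or.inr ⟨a, ha, b, hb, by simp⟩, fun x => by simp [-List.map_reverse, Instr.value, ha' x, hb' x]⟩
  | sub oa ob =>
    obtain ⟨a, ha, b, hb, ha', hb', -⟩ := key oa ob _ h
    exact ⟨a - b, Or.inr ⟨a, ha, b, hb, by simp⟩, fun x => by simp [-List.map_reverse, Instr.value, ha' x, hb' x]⟩
  | mul oa ob =>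
    obtain ⟨a, ha, b, hb, ha', hb', -⟩ := key oa ob _ h
    exact ⟨a * b, Or.inr ⟨a, ha, b, hb, by simp⟩, fun x => by simp [-List.map_reverse, Instr.value, ha' x, hb' x]⟩
  | div oa ob =>
    obtain ⟨a, ha, b, hb, ha', hb', h0⟩ := key oa ob _ h
    -- A division that is defined on all inputs has a divisor without zeros, as `IsStep` demands.
    have h0' : ∀ x, b x ≠ 0 := fun x hx => by
      have := h0 x
      simp [hx] at this
    exact ⟨a / b, Or.inr ⟨a, ha, b, hb, by simp [h0']⟩,
      fun x => by simp [-List.map_reverse, Instr.value, ha' x, hb' x, h0' x]⟩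

theorem exists_isComputation_of_runFrom [Nonempty X] {ι : Type*} {u : X → ι → K}
    (code : List (Instr K ι)) (l : List (X → K))
    (hl : IsComputation (Set.range fun i x => u x i) l)
    (h : ∀ x, (runFrom (u x) (l.reverse.map (· x)) code).isSome) :
    ∃ l', IsComputation (Set.range fun i x => u x i) l' ∧ l'.length = l.length + code.length ∧
      ∀ x, runFrom (u x) (l.reverse.map (· x)) code = some (l'.reverse.map (· x)) := by
  induction code generalizing l with
  | nil => exact ⟨l, hl, by simp, fun x => rfl⟩
  | cons c cs ih =>
    obtain ⟨g, hg, hgv⟩ := exists_isStep_of_instr (u := u) (l := l) c fun x => by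
      have := h x
      simp only [runFrom] at this
      cases h : c.value (u x) (l.reverse.map (· x)) <;> simp_all [-List.map_reverse]
    have hstep : ∀ x, runFrom (u x) (l.reverse.map (· x)) (c :: cs) =
        runFrom (u x) ((g :: l).reverse.map (· x)) cs := fun x => by
      simp only [runFrom, hgv x, List.reverse_cons, List.map_append]
      rfl
    obtain ⟨l', hl', hlen, hrun⟩ := ih (g :: l) (hl.cons hg) fun x => by
      rw [← hstep x]; exact h x
    exact ⟨l', hl', by simp at hlen ⊢; omega, fun x => by rw [hstep x, hrun x]⟩

theorem Reach.of_slp {ι ο : Type*} {u : X → ι → K} {v : X → ο → K} (P : SLP K ι ο)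
    (h : ∀ x, P.Outputs (u x) (v x)) :
    Reach (Set.range fun i x => u x i) P.cost (Set.range fun o x => v x o) := by
  rcases isEmpty_or_nonempty X with hX | hX
  · refine (Reach.of_subset fun g _ => Or.inl (Subsingleton.elim _ _)).mono_cost (by simp)
  obtain ⟨l, hl, hlen, hrun⟩ := exists_isComputation_of_runFrom (u := u) P.code [] .nil fun x => by
    obtain ⟨r, hr, -⟩ := h x
    simp [hr]
  refine ⟨l, hl, by simp [SLP.cost, hlen], ?_⟩
  rintro _ ⟨o, rfl⟩
  have hval : ∀ x, (P.out o).value (u x) (l.reverse.map (· x)) = some (v x o) := fun x => by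
    obtain ⟨r, hr, hr'⟩ := h x
    have := hrun x
    simp only [List.reverse_nil, List.map_nil, hr, Option.some.injEq] at this
    rw [← this]
    exact hr' o
  obtain ⟨g, hg, hg'⟩ := exists_function_of_operand (u := u) (l := l) (P.out o) fun x => by
    simp [-List.map_reverse, hval x]
  have : g = fun x => v x o := by
    funext x
    simpa [-List.map_reverse, hval x, eq_comm] using hg' x
  change (fun x => v x o) ∈ _
  rwa [← this]

end Reach

/-! ### Computations with coefficients of polynomials -/

section Coefs

open Polynomial

variable {Ω : Type*} {K : Type*} [Field K] {R : Type*} [CommRing R]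

/-- The polynomial `∑ i < N, c i * X ^ i`. -/
noncomputable def polyOf (N : ℕ) (c : ℕ → R) : R[X] :=
  ∑ i ∈ Finset.range N, monomial i (c i)

theorem coeff_polyOf (N : ℕ) (c : ℕ → R) (i : ℕ) :
    (polyOf N c).coeff i = if i < N then c i else 0 := by
  simp [polyOf, coeff_monomial]

theorem degree_polyOf_lt (N : ℕ) (c : ℕ → R) : (polyOf N c).degree < N := by
  rw [degree_lt_iff_coeff_zero]
  intro i hi
  rw [coeff_polyOf, if_neg (by omega)]

theorem polyOf_coeff {N : ℕ} {p : R[X]} (hp : p.degree < N) : polyOf N p.coeff = p := by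
  ext i
  rw [coeff_polyOf]
  split_ifs with h
  · rfl
  · exact ((degree_lt_iff_coeff_zero _ _).1 hp i (by omega)).symm

theorem sum_range_mul {M : Type*} [AddCommMonoid M] (a b : ℕ) (f : ℕ → M) :
    ∑ s ∈ Finset.range (a * b), f s =
      ∑ r ∈ Finset.range a, ∑ s ∈ Finset.range b, f (b * r + s) := by
  induction a with
  | zero => simp
  | succ a ih =>
    rw [add_mul, one_mul, Finset.sum_range_add, ih, Finset.sum_range_succ]
    simp [mul_comm]

theorem polyOf_mul_eq_sum (a b : ℕ) (c : ℕ → R) :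
    polyOf (a * b) c = ∑ r ∈ Finset.range a, X ^ (b * r) * polyOf b fun s => c (b * r + s) := by
  simp only [polyOf, sum_range_mul a b, Finset.mul_sum]
  refine Finset.sum_congr rfl fun r _ => Finset.sum_congr rfl fun s _ => ?_
  rw [X_pow_mul_monomial, add_comm]

/-- The coefficient functions of a family of polynomials. -/
def coefs (p : Ω → K[X]) : Set (Ω → K) := Set.range fun i x => (p x).coeff i

theorem mem_coefs (p : Ω → K[X]) (i : ℕ) : (fun x => (p x).coeff i) ∈ coefs p := ⟨i, rfl⟩

theorem coefs_subset {p : Ω → K[X]} {S : Set (Ω → K)} :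
    coefs p ⊆ S ↔ ∀ i, (fun x => (p x).coeff i) ∈ S := Set.range_subset_iff

theorem coefs_polyOf_subset {S : Set (Ω → K)} {N : ℕ} {c : Ω → ℕ → K}
    (h : ∀ i < N, (fun x => c x i) ∈ insert 0 S) :
    coefs (fun x => polyOf N (c x)) ⊆ insert 0 S := by
  rw [coefs_subset]
  intro i
  simp only [coeff_polyOf]
  by_cases hi : i < N
  · simpa [hi] using h i hi
  · simp only [hi, if_false]
    exact Or.inl rfl

theorem coefs_zero_subset {S : Set (Ω → K)} : coefs (fun _ : Ω => (0 : K[X])) ⊆ insert 0 S := by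
  rw [coefs_subset]
  exact fun i => Or.inl (by ext; simp)

namespace Reach

/-- Only the coefficients with index in `F` are charged. All the linear operations below are priced
in this way. -/
theorem coefs_of_finset {S : Set (Ω → K)} {p : Ω → K[X]} {c : ℕ} (F : Finset ℕ)
    (h : ∀ i ∈ F, Reach S c {fun x => (p x).coeff i})
    (h' : ∀ i ∉ F, (fun x => (p x).coeff i) ∈ insert 0 S) : Reach S (F.card * c) (coefs p) := by
  refine (biUnion F h).mono_right (coefs_subset.2 fun i => ?_)
  by_cases hi : i ∈ F
  · exact Or.inr (Or.inr (Set.mem_biUnion hi rfl))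
  · exact Set.insert_subset_insert Set.subset_union_left (h' i hi)

theorem coefs_of_degree_lt {S : Set (Ω → K)} {p : Ω → K[X]} {c N : ℕ}
    (hN : ∀ x, (p x).degree < N) (h : ∀ i < N, Reach S c {fun x => (p x).coeff i}) :
    Reach S (N * c) (coefs p) := by
  have := coefs_of_finset (p := p) (S := S) (Finset.range N) (fun i hi => h i (by simpa using hi))
    fun i hi => Or.inl (by
      ext x
      exact (degree_lt_iff_coeff_zero _ _).1 (hN x) i (by simpa using hi))
  simpa using this

/-- Only the positions `e, …, e + N - 1` need an addition, so the cost does not depend on the degree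
of `p`. -/
theorem polyAddShift {S : Set (Ω → K)} {p q : Ω → K[X]} {N : ℕ} (e : ℕ)
    (hp : coefs p ⊆ insert 0 S) (hq : coefs q ⊆ insert 0 S) (hN : ∀ x, (q x).degree < N) :
    Reach S N (coefs fun x => p x + X ^ e * q x) := by
  have := coefs_of_finset (p := fun x => p x + X ^ e * q x) (S := S) (c := 1)
    ((Finset.range N).map (addLeftEmbedding e)) (fun i hi => ?_) (fun i hi => ?_)
  · simpa using this
  · obtain ⟨j, hj, rfl⟩ := Finset.mem_map.1 hi
    have := add (S := S) (hp (mem_coefs p (e + j))) (hq (mem_coefs q j))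
    convert this using 2
    ext x
    simp [coeff_X_pow_mul']
  · convert hp (mem_coefs p i) using 2 with x
    rw [coeff_add, coeff_X_pow_mul']
    split_ifs with h
    · rw [(degree_lt_iff_coeff_zero _ _).1 (hN x), add_zero]
      by_contra hlt
      exact hi (Finset.mem_map.2 ⟨i - e, by simp; omega, by simp; omega⟩)
    · simp

theorem polyAdd {S : Set (Ω → K)} {p q : Ω → K[X]} {N : ℕ}
    (hp : coefs p ⊆ insert 0 S) (hq : coefs q ⊆ insert 0 S) (hN : ∀ x, (q x).degree < N) :
    Reach S N (coefs fun x => p x + q x) := by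
  simpa using polyAddShift 0 hp hq hN

theorem polySub {S : Set (Ω → K)} {p q : Ω → K[X]} {N : ℕ}
    (hp : coefs p ⊆ insert 0 S) (hq : coefs q ⊆ insert 0 S) (hN : ∀ x, (q x).degree < N) :
    Reach S N (coefs fun x => p x - q x) := by
  have := coefs_of_finset (p := fun x => p x - q x) (S := S) (c := 1)
    (Finset.range N) (fun i hi => ?_) (fun i hi => ?_)
  · simpa using this
  · have := sub (S := S) (hp (mem_coefs p i)) (hq (mem_coefs q i))
    convert this using 2
    ext x
    simp
  · convert hp (mem_coefs p i) using 2 with x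
    rw [coeff_sub, (degree_lt_iff_coeff_zero _ _).1 (hN x) i (by simpa using hi), sub_zero]

theorem polySmul {S : Set (Ω → K)} {k : Ω → K} {p : Ω → K[X]} {N : ℕ}
    (hk : k ∈ insert 0 S) (hp : coefs p ⊆ insert 0 S) (hN : ∀ x, (p x).degree < N) :
    Reach S N (coefs fun x => C (k x) * p x) := by
  have := coefs_of_degree_lt (p := fun x => C (k x) * p x) (S := S) (c := 1) (N := N)
    (fun x => ?_) (fun i _ => ?_)
  · simpa using this
  · rw [degree_lt_iff_coeff_zero]
    intro i hi
    rw [coeff_C_mul, (degree_lt_iff_coeff_zero _ _).1 (hN x) i hi, mul_zero]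
  · have := mul (S := S) hk (hp (mem_coefs p i))
    convert this using 2
    ext x
    simp

theorem polySumShift {S : Set (Ω → K)} {P : ℕ → Ω → K[X]} {N : ℕ} (e : ℕ → ℕ) (T : ℕ)
    (hP : ∀ t < T, coefs (P t) ⊆ insert 0 S) (hN : ∀ t < T, ∀ x, (P t x).degree < N) :
    Reach S (T * N) (coefs fun x => ∑ t ∈ Finset.range T, X ^ e t * P t x) := by
  induction T with
  | zero => simpa using of_subset (S := S) coefs_zero_subset
  | succ T ih =>
    simp only [Finset.sum_range_succ]
    rw [add_mul, one_mul]
    refine (ih (fun t ht => hP t (by omega)) fun t ht => hN t (by omega)).trans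
      (polyAddShift (e T) ?_ ?_ (hN T (by omega)))
    · exact Set.subset_union_right.trans (Set.subset_insert _ _)
    · exact (hP T (by omega)).trans (Set.insert_subset_insert Set.subset_union_left)

theorem polySum {S : Set (Ω → K)} {P : ℕ → Ω → K[X]} {N : ℕ} (T : ℕ)
    (hP : ∀ t < T, coefs (P t) ⊆ insert 0 S) (hN : ∀ t < T, ∀ x, (P t x).degree < N) :
    Reach S (T * N) (coefs fun x => ∑ t ∈ Finset.range T, P t x) := by
  simpa using polySumShift (fun _ => 0) T hP hN

end Reach

/-! ### Bilinear algorithms for the multiplication of polynomials -/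

/-- Polynomials of degree less than `N` can be multiplied by a bilinear algorithm of rank at most
`r` whose pre- and postprocessing take at most `c` operations each. -/
def MulAlg (K : Type u) [Field K] (N r c : ℕ) : Prop :=
  ∃ (ρ : Type) (_ : Fintype ρ) (E E' : K[X] → ρ → K) (D : (ρ → K) →ₗ[K] K[X]),
    Fintype.card ρ ≤ r ∧
    (∀ p q : K[X], p.degree < N → q.degree < N → D (E p * E' q) = p * q) ∧
    (∀ (Ω : Type u) (p : Ω → K[X]),
      Reach (coefs p) c (Set.range fun i x => E (p x) i)) ∧
    (∀ (Ω : Type u) (p : Ω → K[X]),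
      Reach (coefs p) c (Set.range fun i x => E' (p x) i)) ∧
    (∀ (Ω : Type u) (w : Ω → ρ → K),
      Reach (Set.range fun i x => w x i) c (coefs fun x => D (w x)))

theorem MulAlg.mono {K : Type u} [Field K] {N N' r r' c c' : ℕ} (h : MulAlg K N r c)
    (hN : N' ≤ N) (hr : r ≤ r') (hc : c ≤ c') : MulAlg K N' r' c' := by
  obtain ⟨ρ, _, E, E', D, h1, h2, h3, h4, h5⟩ := h
  have hN' : (N' : WithBot ℕ) ≤ N := by exact_mod_cast hN
  exact ⟨ρ, _, E, E', D, h1.trans hr, fun p q hp hq => h2 p q (hp.trans_le hN') (hq.trans_le hN'),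
    fun Ω p => (h3 Ω p).mono_cost hc, fun Ω p => (h4 Ω p).mono_cost hc,
    fun Ω w => (h5 Ω w).mono_cost hc⟩

/-- The quadratic algorithm. -/
theorem MulAlg.schoolbook (K : Type u) [Field K] (N : ℕ) : MulAlg K N (N ^ 2) (N ^ 2) := by
  let D : (Fin N × Fin N → K) →ₗ[K] K[X] :=
    ∑ i : Fin N × Fin N, (monomial (i.1 + i.2 : ℕ)).comp (LinearMap.proj i)
  have hD : ∀ w, D w = ∑ i : Fin N, ∑ j : Fin N, monomial (i + j : ℕ) (w (i, j)) := fun w => by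
    simp [D, Fintype.sum_prod_type]
  refine ⟨Fin N × Fin N, inferInstance, fun p i => p.coeff i.1, fun p i => p.coeff i.2, D,
    by simp [sq], fun p q hp hq => ?_, fun Ω p => ?_, fun Ω p => ?_, fun Ω w => ?_⟩
  · rw [hD]
    conv_rhs => rw [← polyOf_coeff hp, ← polyOf_coeff hq]
    simp [polyOf, Finset.sum_range, Finset.sum_mul_sum, monomial_mul_monomial]
  · refine (Reach.of_subset ?_).mono_cost (Nat.zero_le _)
    rintro _ ⟨i, rfl⟩
    exact Or.inr (mem_coefs p i.1)
  · refine (Reach.of_subset ?_).mono_cost (Nat.zero_le _)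
    rintro _ ⟨i, rfl⟩
    exact Or.inr (mem_coefs p i.2)
  -- The pairs of indices are enumerated by `finProdFinEquiv`; each contributes one shifted
  -- constant. The values for `t ≥ N * N` are never used.
  · have h := Reach.polySumShift (Ω := Ω) (S := Set.range fun i x => w x i) (N := 1)
      (P := fun t x => if h : t < N * N then C (w x (finProdFinEquiv.symm ⟨t, h⟩)) else 0)
      (fun t => if h : t < N * N then
        ((finProdFinEquiv.symm ⟨t, h⟩).1 + (finProdFinEquiv.symm ⟨t, h⟩).2 : ℕ) else 0)
      (N * N) ?_ ?_
    · convert h using 1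
      · ring
      congr! 2 with x
      rw [Finset.sum_range, hD, ← Fintype.sum_prod_type']
      refine (Fintype.sum_equiv finProdFinEquiv _ _ fun i => ?_)
      have : (finProdFinEquiv i : ℕ) < N * N := (finProdFinEquiv i).2
      rw [dif_pos this, dif_pos this]
      simp only [Fin.eta, Equiv.symm_apply_apply]
      rw [X_pow_mul_C, C_mul_X_pow_eq_monomial]
    · intro t ht
      simp only [ht, dif_pos]
      rw [coefs_subset]
      intro i
      simp only [coeff_C]
      split_ifs
      · exact Or.inr ⟨_, rfl⟩
      · exact Or.inl rfl
    · intro t ht x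
      simp only [ht, dif_pos]
      exact degree_C_le.trans_lt (by simp)

end Coefs

/-! ### Discrete Fourier transforms with respect to synthetic roots of unity -/

section Dft

open Polynomial

/-- Multiplication by `v` permutes the residues modulo `q`, and `θ ^ q = 1`, so the sum is a
rearrangement of the geometric sum. -/
theorem sum_pow_mul_eq_zero {Q : Type*} [CommRing Q] {q : ℕ} (hq : q.Prime) {θ : Q}
    (hθ : ∑ r ∈ Finset.range q, θ ^ r = 0) {v : ℕ} (hv : ¬ q ∣ v) :
    ∑ r ∈ Finset.range q, θ ^ (r * v) = 0 := by
  have h1 : θ ^ q = 1 := by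
    have := mul_geom_sum θ q
    rw [hθ, mul_zero] at this
    exact (sub_eq_zero.1 this.symm)
  have hinj : Set.InjOn (fun r => r * v % q) (Finset.range q : Finset ℕ) := by
    intro a ha b hb hab
    have hab' : a * v ≡ b * v [MOD q] := hab
    have := Nat.ModEq.cancel_right_of_coprime ((hq.coprime_iff_not_dvd).2 hv) hab'
    simp only [Finset.coe_range, Set.mem_Iio] at ha hb
    rwa [Nat.ModEq, Nat.mod_eq_of_lt ha, Nat.mod_eq_of_lt hb] at this
  have hmaps : Set.MapsTo (fun r => r * v % q) (Finset.range q : Finset ℕ)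
      (Finset.range q : Finset ℕ) := fun a _ => by simpa using Nat.mod_lt _ hq.pos
  rw [← hθ]
  refine Finset.sum_nbij (fun r => r * v % q) (fun a ha => hmaps ha) hinj
    (Finset.surjOn_of_injOn_of_card_le _ hmaps hinj le_rfl) fun a _ => ?_
  exact pow_eq_pow_mod _ h1

/-- Orthogonality of the characters used by the transform. In a ring with zero divisors `η ^ v ≠ 1`
would not suffice; the vanishing of the geometric sum of `η ^ q ^ i` is what makes `η` a principal
root of unity. -/
theorem sum_pow_mul_eq_zero_of_prime_pow {Q : Type*} [CommRing Q] {q : ℕ} (hq : q.Prime) (i : ℕ)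
    {η : Q} (hη : ∑ r ∈ Finset.range q, (η ^ q ^ i) ^ r = 0) {v : ℕ} (hv : ¬ q ^ (i + 1) ∣ v) :
    ∑ l ∈ Finset.range (q ^ (i + 1)), η ^ (l * v) = 0 := by
  have hpow : ∀ θ : Q, ∑ r ∈ Finset.range q, θ ^ r = 0 → θ ^ q = 1 := fun θ h => by
    have := mul_geom_sum θ q
    rw [h, mul_zero] at this
    exact (sub_eq_zero.1 this.symm)
  induction i generalizing η v with
  | zero =>
    simp only [zero_add, pow_one] at hv ⊢
    exact sum_pow_mul_eq_zero hq (by simpa using hη) hv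
  | succ i ih =>
    rw [pow_succ' q (i + 1), sum_range_mul]
    -- If `q ∣ v`, the sum consists of `q` copies of a shorter sum for `η ^ q`. Otherwise, for a
    -- fixed low part of the index, the sum over the top digit vanishes by the prime case.
    by_cases hqv : q ∣ v
    · obtain ⟨v, rfl⟩ := hqv
      have h1 := ih (η := η ^ q) (v := v) (by rwa [← pow_mul, ← pow_succ']) fun h =>
        hv (by rw [pow_succ']; exact mul_dvd_mul_left q h)
      refine Finset.sum_eq_zero fun r _ => ?_
      rw [← h1]
      refine Finset.sum_congr rfl fun l _ => ?_
      have h2 : η ^ (q ^ (i + 1) * q) = 1 := by rw [pow_mul]; exact hpow _ hη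
      calc η ^ ((q ^ (i + 1) * r + l) * (q * v))
          = (η ^ (q ^ (i + 1) * q)) ^ (r * v) * (η ^ q) ^ (l * v) := by
            rw [← pow_mul, ← pow_mul, ← pow_add]; ring_nf
        _ = _ := by rw [h2, one_pow, one_mul]
    · rw [Finset.sum_comm]
      refine Finset.sum_eq_zero fun l _ => ?_
      have := sum_pow_mul_eq_zero hq hη hqv
      calc ∑ r ∈ Finset.range q, η ^ ((q ^ (i + 1) * r + l) * v)
          = η ^ (l * v) * ∑ r ∈ Finset.range q, (η ^ q ^ (i + 1)) ^ (r * v) := by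
            rw [Finset.mul_sum]
            refine Finset.sum_congr rfl fun r _ => ?_
            rw [← pow_mul, ← pow_add]; ring_nf
        _ = 0 := by rw [this, mul_zero]

variable {Ω : Type*} {K : Type*} [Field K] {M : ℕ}

/-- The discrete Fourier transform of length `n` of a sequence of elements of `K[z]/(z ^ M - 1)`
with respect to the root of unity `z ^ w`. -/
def dft (w : ZMod M) (n : ℕ) (a : ℕ → ZMod M → K) (l : ℕ) (s : ZMod M) : K :=
  ∑ u ∈ Finset.range n, a u (s - w * l * u)

theorem dft_mod {w : ZMod M} {n : ℕ} (hw : w * n = 0) (a : ℕ → ZMod M → K) (l : ℕ) :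
    dft w n a (l % n) = dft w n a l := by
  have : w * (l : ZMod M) = w * ((l % n : ℕ) : ZMod M) := by
    conv_lhs => rw [← Nat.mod_add_div l n]
    push_cast
    rw [mul_add, ← mul_assoc w (n : ZMod M), hw, zero_mul, add_zero]
  funext s
  simp only [dft, this]

/-- The fast Fourier transform. -/
theorem Reach.dft [NeZero M] {q : ℕ} (hq : 0 < q) {S : Set (Ω → K)} (i : ℕ) {w : ZMod M}
    (hw : w * (q ^ i : ℕ) = 0) {a : Ω → ℕ → ZMod M → K}
    (ha : ∀ u < q ^ i, ∀ s, (fun x => a x u s) ∈ insert 0 S) :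
    Reach S (i * q ^ (i + 1) * M)
      (Set.range fun (y : ℕ × ZMod M) x => dft w (q ^ i) (a x) y.1 y.2) := by
  induction i generalizing w a with
  | zero =>
    refine (Reach.of_subset ?_).mono_cost (Nat.zero_le _)
    rintro _ ⟨⟨l, s⟩, rfl⟩
    simpa [BivComp.dft] using ha 0 (by simp) s
  | succ i ih =>
    -- Decimation with radix `q`: the subsequence of indices congruent to `r` is transformed with
    -- respect to `w * q`. Multiplications by powers of `z` are rotations of the index and cost
    -- nothing, so only the additions of `h2` are counted.
    have h1 := Reach.biUnion (Finset.range q) fun r hr =>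
      ih (w := w * q) (a := fun x u => a x (q * u + r))
        (by rw [mul_assoc, ← Nat.cast_mul, ← pow_succ']; exact hw) (fun u hu s => ha _ (by
          have hr := Finset.mem_range.1 hr
          calc q * u + r < q * (u + 1) := by rw [mul_add]; omega
            _ ≤ q * q ^ i := Nat.mul_le_mul_left _ hu
            _ = q ^ (i + 1) := (pow_succ' q i).symm) s)
    have h2 : Reach (S ∪ ⋃ r ∈ Finset.range q, Set.range fun (y : ℕ × ZMod M) x =>
        BivComp.dft (w * (q : ZMod M)) (q ^ i) (fun u => a x (q * u + r)) y.1 y.2)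
        (Fintype.card (Fin (q ^ (i + 1)) × ZMod M) * q)
        (Set.range fun (y : Fin (q ^ (i + 1)) × ZMod M) x =>
          BivComp.dft w (q ^ (i + 1)) (a x) y.1 y.2) := by
      refine Reach.range fun y => ?_
      obtain ⟨⟨l, hl⟩, s⟩ := y
      have := Reach.sum_range (S := S ∪ ⋃ r ∈ Finset.range q,
        Set.range fun (y : ℕ × ZMod M) x =>
          BivComp.dft (w * (q : ZMod M)) (q ^ i) (fun u => a x (q * u + r)) y.1 y.2)
        (v := fun r x => BivComp.dft (w * (q : ZMod M)) (q ^ i) (fun u => a x (q * u + r)) l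
          (s - w * (l : ZMod M) * r)) q
        fun r hr => Or.inr (Or.inr (Set.mem_biUnion (Finset.mem_range.2 hr) ⟨(_, _), rfl⟩))
      convert this using 2
      ext x
      simp only [Finset.sum_apply, BivComp.dft]
      rw [pow_succ, sum_range_mul, Finset.sum_comm]
      refine Finset.sum_congr rfl fun r _ => Finset.sum_congr rfl fun u _ => ?_
      congr 1
      push_cast
      ring
    refine ((h1.trans h2).mono_cost (le_of_eq ?_)).mono_right ?_
    · simp only [Finset.card_range, Fintype.card_prod, Fintype.card_fin, ZMod.card]
      ring
    -- The transform is periodic in `l`, so the finitely many computed values provide all of them.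
    · rintro _ ⟨⟨l, s⟩, rfl⟩
      refine Or.inr (Or.inr ⟨(⟨l % q ^ (i + 1), Nat.mod_lt _ (by positivity)⟩, s), ?_⟩)
      funext x
      exact congrFun (dft_mod hw (a x) l) s

variable {Q : Type*} [CommRing Q] [Algebra K Q]

/-- The value of an element of `K[z]/(z ^ M - 1)` at an `M`-th root of unity. -/
noncomputable def cycEval [NeZero M] (χ : AddChar (ZMod M) Q) (g : ZMod M → K) : Q :=
  ∑ s, g s • χ s

theorem cycEval_rotate [NeZero M] (χ : AddChar (ZMod M) Q) (g : ZMod M → K) (e : ZMod M) :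
    cycEval χ (fun s => g (s - e)) = χ e * cycEval χ g := by
  rw [cycEval, cycEval, Finset.mul_sum]
  refine Fintype.sum_equiv (Equiv.subRight e) _ _ fun s => ?_
  simp only [Equiv.subRight_apply]
  rw [mul_smul_comm, ← AddChar.map_add_eq_mul, add_sub_cancel]

theorem cycEval_dft [NeZero M] (χ : AddChar (ZMod M) Q) (w : ZMod M) (n : ℕ)
    (a : ℕ → ZMod M → K) (l : ℕ) :
    cycEval χ (dft w n a l) = ∑ u ∈ Finset.range n, χ (w * l * u) * cycEval χ (a u) := by
  simp only [← cycEval_rotate]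
  simp only [cycEval, dft, Finset.sum_smul]
  rw [Finset.sum_comm]

/-- Inversion of the Fourier transform of a product. -/
theorem sum_dft_mul_dft [NeZero M] (χ : AddChar (ZMod M) Q) {w : ZMod M} {n : ℕ}
    (hw : w * n = 0)
    (horth : ∀ v, ¬ n ∣ v → ∑ l ∈ Finset.range n, χ w ^ (l * v) = 0) {t : ℕ} (ht : 2 * t ≤ n)
    (α β : ℕ → Q) {u : ℕ} (hu : u < n) :
    ∑ l ∈ Finset.range n, χ (-w * u * l) *
        ((∑ v ∈ Finset.range t, χ (w * l * v) * α v) *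
          ∑ v ∈ Finset.range t, χ (w * l * v) * β v) =
      n * ∑ v ∈ Finset.range t, ∑ v' ∈ Finset.range t, if v + v' = u then α v * β v' else 0 := by
  simp only [Finset.sum_mul_sum]
  simp only [Finset.mul_sum]
  rw [Finset.sum_comm]
  refine Finset.sum_congr rfl fun v hv => ?_
  rw [Finset.sum_comm]
  refine Finset.sum_congr rfl fun v' hv' => ?_
  rw [Finset.mem_range] at hv hv'
  -- The exponent `-u` is represented by the natural number `n - u`, as `w * n = 0`.
  have h : ∀ l : ℕ, χ (-w * u * l) * (χ (w * l * v) * α v * (χ (w * l * v') * β v')) =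
      χ w ^ (l * (v + v' + (n - u))) * (α v * β v') := fun l => by
    have : χ (-w * u * l) * (χ (w * l * v) * χ (w * l * v')) =
        χ w ^ (l * (v + v' + (n - u))) := by
      rw [← AddChar.map_add_eq_mul, ← AddChar.map_add_eq_mul, ← AddChar.map_nsmul_eq_pow]
      congr 1
      rw [nsmul_eq_mul]
      push_cast [Nat.cast_sub hu.le]
      linear_combination (-(l : ZMod M)) * hw
    rw [← this]; ring
  simp only [h, ← Finset.sum_mul]
  split_ifs with huv
  · have hχ : χ w ^ n = 1 := by
      rw [← AddChar.map_nsmul_eq_pow, nsmul_eq_mul, mul_comm, hw, AddChar.map_zero_eq_one]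
    have : v + v' + (n - u) = n := by omega
    simp [this, mul_comm _ n, pow_mul, hχ]
  · rw [horth, zero_mul, mul_zero]
    -- Here `0 < v + v' + (n - u) < 2 * n`, so the only possible multiple of `n` is `n` itself,
    -- which would mean `v + v' = u`. The assumption `2 * t ≤ n` thus excludes wrap-around.
    rintro ⟨k, hk⟩
    rcases k with _ | _ | k
    · omega
    · omega
    · have : n * (k + 1 + 1) = n * k + n + n := by ring
      omega

end Dft

/-! ### The recursive step of fast multiplication -/

section FastMul

open Polynomial

variable {K : Type u} [Field K] {M : ℕ}

theorem sum_zmod [NeZero M] {A : Type*} [AddCommMonoid A] (f : ZMod M → A) :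
    ∑ s, f s = ∑ s ∈ Finset.range M, f s := by
  refine Finset.sum_nbij' ZMod.val (fun n => (n : ZMod M)) (fun s _ => ?_) (fun _ _ => ?_)
    (fun s _ => ?_) (fun s hs => ?_) (fun s _ => ?_)
  · exact Finset.mem_range.2 (ZMod.val_lt s)
  · exact Finset.mem_univ _
  · exact ZMod.natCast_zmod_val s
  · exact ZMod.val_cast_of_lt (Finset.mem_range.1 hs)
  · rw [ZMod.natCast_zmod_val]

/-- Reduction of a polynomial of degree less than `2 * M` modulo `z ^ M - 1`. -/
noncomputable def foldMap (K : Type u) [Field K] (M : ℕ) : K[X] →ₗ[K] (ZMod M → K) :=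
  LinearMap.pi fun s => lcoeff K s.val + lcoeff K (s.val + M)

theorem foldMap_apply (p : K[X]) (s : ZMod M) :
    foldMap K M p s = p.coeff s.val + p.coeff (s.val + M) := rfl

/-- Reduction modulo `1 + z ^ m + ⋯ + z ^ (m * k)`, where `M = m * (k + 1)`. -/
noncomputable def redMap (K : Type u) [Field K] (M m k : ℕ) : (ZMod M → K) →ₗ[K] K[X] :=
  ∑ s ∈ Finset.range (k * m), (monomial s).comp
    (LinearMap.proj (R := K) (φ := fun _ : ZMod M => K) (s : ZMod M) -
      LinearMap.proj ((k * m + s % m : ℕ) : ZMod M))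

theorem redMap_apply (m k : ℕ) (g : ZMod M → K) :
    redMap K M m k g = polyOf (k * m) fun s => g s - g ((k * m + s % m : ℕ) : ZMod M) := by
  simp [redMap, polyOf]

/-- Rotation, that is multiplication by a power of `z` modulo `z ^ M - 1`. -/
def rotMap (K : Type u) [Field K] (e : ZMod M) : (ZMod M → K) →ₗ[K] (ZMod M → K) :=
  LinearMap.funLeft K K fun s => s - e

section Eval

variable {Q : Type*} [CommRing Q] [Algebra K Q] [NeZero M] {ζ : Q} (hζ : ζ ^ M = 1)

theorem cycEval_eq_sum_range (g : ZMod M → K) :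
    cycEval (AddChar.zmodChar M hζ) g = ∑ s ∈ Finset.range M, g s • ζ ^ s := by
  rw [cycEval, sum_zmod]
  refine Finset.sum_congr rfl fun s hs => ?_
  rw [AddChar.zmodChar_apply, ZMod.val_cast_of_lt (Finset.mem_range.1 hs)]

theorem aeval_polyOf (N : ℕ) (c : ℕ → K) :
    aeval ζ (polyOf N c) = ∑ s ∈ Finset.range N, c s • ζ ^ s := by
  simp [polyOf, aeval_monomial, Algebra.smul_def]

theorem aeval_polyOf_zmod (g : ZMod M → K) :
    aeval ζ (polyOf M fun s => g s) = cycEval (AddChar.zmodChar M hζ) g := by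
  rw [cycEval_eq_sum_range, aeval_polyOf]

theorem cycEval_foldMap {p : K[X]} (hp : p.degree < (2 * M : ℕ)) :
    cycEval (AddChar.zmodChar M hζ) (foldMap K M p) = aeval ζ p := by
  rw [cycEval_eq_sum_range]
  conv_rhs => rw [← polyOf_coeff hp, aeval_polyOf, two_mul, Finset.sum_range_add,
    ← Finset.sum_add_distrib]
  refine Finset.sum_congr rfl fun s hs => ?_
  rw [foldMap_apply, ZMod.val_cast_of_lt (Finset.mem_range.1 hs), pow_add, hζ, one_mul, add_smul,
    add_comm s M]

/-- The relation for `ζ ^ m` expresses `ζ ^ (k * m)` as minus the sum of the lower powers `ζ ^ (m *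
r)`; hence the top block of `m` coefficients is subtracted from each of the `k` lower blocks. -/
theorem aeval_redMap {m k : ℕ} (hM : M = (k + 1) * m)
    (hm : ∑ r ∈ Finset.range (k + 1), (ζ ^ m) ^ r = 0) (g : ZMod M → K) :
    aeval ζ (redMap K M m k g) = cycEval (AddChar.zmodChar M hζ) g := by
  have htop : ζ ^ (k * m) = -∑ r ∈ Finset.range k, ζ ^ (m * r) := by
    rw [Finset.sum_range_succ] at hm
    rw [mul_comm k m, pow_mul]
    simp only [pow_mul]
    linear_combination hm
  rw [cycEval_eq_sum_range, redMap_apply, aeval_polyOf]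
  have hsum : ∑ s ∈ Finset.range M, g s • ζ ^ s =
      ∑ s ∈ Finset.range (k * m), g s • ζ ^ s +
        ∑ s ∈ Finset.range m, g ((k * m + s : ℕ) : ZMod M) • ζ ^ (k * m + s) := by
    conv_lhs => rw [show Finset.range M = Finset.range (k * m + m) by rw [hM]; ring_nf]
    rw [Finset.sum_range_add]
  rw [hsum]
  simp only [sub_smul, Finset.sum_sub_distrib]
  rw [sub_eq_add_neg]
  congr 1
  rw [sum_range_mul, Finset.sum_comm, ← Finset.sum_neg_distrib]
  refine Finset.sum_congr rfl fun s hs => ?_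
  rw [pow_add, htop, neg_mul, smul_neg, Finset.sum_mul, Finset.smul_sum]
  congr 1
  refine Finset.sum_congr rfl fun r _ => ?_
  rw [Nat.mul_add_mod, Nat.mod_eq_of_lt (Finset.mem_range.1 hs), pow_add]

end Eval

/-- The coefficients of `p`, cut into `t` pieces of length `m`. -/
def pieces (M m t : ℕ) (p : K[X]) (u : ℕ) (s : ZMod M) : K :=
  if u < t ∧ s.val < m then p.coeff (m * u + s.val) else 0

theorem cycEval_pieces [NeZero M] {Q : Type*} [CommRing Q] [Algebra K Q] {ζ : Q} (hζ : ζ ^ M = 1)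
    {m t : ℕ} (hm : m ≤ M) (p : K[X]) (u : ℕ) :
    cycEval (AddChar.zmodChar M hζ) (pieces M m t p u) =
      if u < t then aeval ζ (polyOf m fun s => p.coeff (m * u + s)) else 0 := by
  rw [cycEval_eq_sum_range, aeval_polyOf]
  split_ifs with hu
  · rw [← Finset.sum_subset (Finset.range_mono hm)]
    · refine Finset.sum_congr rfl fun s hs => ?_
      have hs := Finset.mem_range.1 hs
      rw [pieces, ZMod.val_cast_of_lt (hs.trans_le hm), if_pos ⟨hu, hs⟩]
    · intro s hs hs'
      rw [pieces, ZMod.val_cast_of_lt (Finset.mem_range.1 hs), if_neg (by simp_all), zero_smul]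
  · refine Finset.sum_eq_zero fun s _ => ?_
    simp [pieces, hu]

/-- Two polynomials of small degree are equal if they agree at a primitive root of unity. -/
theorem eq_of_aeval_cyclotomic_root {q j : ℕ} (hq : q.Prime) {p p' : K[X]}
    (hp : p.degree < ((q - 1) * q ^ j : ℕ)) (hp' : p'.degree < ((q - 1) * q ^ j : ℕ))
    (h : aeval (AdjoinRoot.root (cyclotomic (q ^ (j + 1)) K)) p =
      aeval (AdjoinRoot.root (cyclotomic (q ^ (j + 1)) K)) p') : p = p' := by
  rw [← sub_eq_zero, ← map_sub, AdjoinRoot.aeval_eq, AdjoinRoot.mk_eq_zero] at h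
  rw [← sub_eq_zero]
  refine eq_zero_of_dvd_of_degree_lt h ((degree_sub_le _ _).trans_lt ?_)
  rw [degree_cyclotomic, Nat.totient_prime_pow hq (by omega), Nat.add_sub_cancel, mul_comm]
  exact max_lt hp hp'

theorem aeval_cyclotomic_prime_pow {Q : Type*} [CommRing Q] [Algebra K Q] {q j : ℕ}
    (hq : q.Prime) (ζ : Q) :
    aeval ζ (cyclotomic (q ^ (j + 1)) K) = ∑ r ∈ Finset.range q, (ζ ^ q ^ j) ^ r := by
  have := Fact.mk hq
  rw [cyclotomic_prime_pow_eq_geom_sum hq]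
  simp

theorem sum_root_cyclotomic {q j : ℕ} (hq : q.Prime) :
    ∑ r ∈ Finset.range q, (AdjoinRoot.root (cyclotomic (q ^ (j + 1)) K) ^ q ^ j) ^ r = 0 := by
  rw [← aeval_cyclotomic_prime_pow (K := K) hq, AdjoinRoot.aeval_eq, AdjoinRoot.mk_self]

/-- The postprocessing of the recursive multiplication algorithm, for `n` values. -/
noncomputable def assembleMap {ρ : Type} (w : ZMod M) (m k n : ℕ) (D : (ρ → K) →ₗ[K] K[X]) :
    (Fin n × ρ → K) →ₗ[K] K[X] :=
  ∑ u ∈ Finset.range n, (LinearMap.mulLeft K (X ^ (m * u) * C (n : K)⁻¹)).comp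
    ((redMap K M m k).comp (∑ l : Fin n, (rotMap K (-w * (u : ZMod M) * ((l : ℕ) : ZMod M))).comp
      ((foldMap K M).comp (D.comp (LinearMap.funLeft K K fun i => (l, i))))))

theorem assembleMap_apply {ρ : Type} (w : ZMod M) (m k n : ℕ) (D : (ρ → K) →ₗ[K] K[X])
    (y : Fin n × ρ → K) :
    assembleMap w m k n D y = ∑ u ∈ Finset.range n, X ^ (m * u) * (C (n : K)⁻¹ *
      redMap K M m k (dft (-w) n (fun l => if h : l < n then
        foldMap K M (D fun i => y (⟨l, h⟩, i)) else 0) u)) := by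
  simp only [assembleMap, LinearMap.sum_apply, LinearMap.comp_apply, LinearMap.mulLeft_apply,
    mul_assoc]
  refine Finset.sum_congr rfl fun u _ => ?_
  congr 3
  funext s
  simp only [← mul_assoc]
  rw [dft, Finset.sum_range, Finset.sum_apply]
  refine Finset.sum_congr rfl fun l _ => ?_
  simp only [l.2, dif_pos, Fin.eta]
  rfl

/-- The preprocessing of the recursive multiplication algorithm. -/
noncomputable def spreadMap {ρ : Type} (w : ZMod M) (m t n : ℕ) (E : K[X] → ρ → K) (p : K[X])
    (y : Fin n × ρ) : K :=
  E (polyOf M fun s => dft w n (pieces M m t p) y.1 s) y.2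

theorem polyOf_mul_polyOf_eq_sum {m t n : ℕ} (hn : 2 * t ≤ n) {p p' : K[X]}
    (hp : p.degree < (m * t : ℕ)) (hp' : p'.degree < (m * t : ℕ)) :
    ∑ u ∈ Finset.range n, X ^ (m * u) * (∑ v ∈ Finset.range t, ∑ v' ∈ Finset.range t,
      if v + v' = u then polyOf m (fun s => p.coeff (m * v + s)) *
        polyOf m (fun s => p'.coeff (m * v' + s)) else 0) = p * p' := by
  conv_rhs => rw [← polyOf_coeff hp, ← polyOf_coeff hp', mul_comm m t, polyOf_mul_eq_sum,
    polyOf_mul_eq_sum, Finset.sum_mul_sum]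
  simp only [Finset.mul_sum]
  rw [Finset.sum_comm]
  refine Finset.sum_congr rfl fun v hv => ?_
  rw [Finset.sum_comm]
  refine Finset.sum_congr rfl fun v' hv' => ?_
  rw [Finset.sum_eq_single (v + v')]
  · rw [if_pos rfl]; ring
  · intro u _ hu
    rw [if_neg hu.symm, mul_zero]
  · intro h
    simp only [Finset.mem_range] at *
    omega

theorem degree_mul_lt {p p' : K[X]} {a b : ℕ} (hp : p.degree < a) (hp' : p'.degree < b) :
    (p * p').degree < (a + b : ℕ) := by
  by_cases h0 : p = 0
  · simp [h0]
  by_cases h0' : p' = 0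
  · simp [h0']
  rw [degree_mul, degree_eq_natDegree h0, degree_eq_natDegree h0'] at *
  have h1 : p.natDegree < a := by exact_mod_cast hp
  have h2 : p'.natDegree < b := by exact_mod_cast hp'
  exact_mod_cast add_lt_add h1 h2

/-- At `ζ`, the preprocessing becomes a Fourier transform of the values of the pieces, the recursive
products become pointwise products, and the postprocessing becomes the inverse transform. The
outcome is the `u`-th coefficient of the product of the two polynomials whose coefficients are the
pieces. -/
theorem aeval_redMap_dft {q i j : ℕ} (hq : q.Prime) (h3 : 3 ≤ q) (hqK : (q : K) ≠ 0)
    (hij : i ≤ j) {Q : Type*} [CommRing Q] [Algebra K Q] {ζ : Q}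
    (hsum : ∑ r ∈ Finset.range q, (ζ ^ q ^ j) ^ r = 0)
    {ρ : Type} {E E' : K[X] → ρ → K} {D : (ρ → K) →ₗ[K] K[X]}
    (hD : ∀ p p' : K[X], p.degree < (q ^ (j + 1) : ℕ) → p'.degree < (q ^ (j + 1) : ℕ) →
      D (E p * E' p') = p * p')
    (p p' : K[X]) {w : ZMod (q ^ (j + 1))} (hw_def : w = (q ^ (j - i) : ℕ)) {u : ℕ}
    (hu : u < q ^ (i + 1)) :
    aeval ζ (C ((q ^ (i + 1) : ℕ) : K)⁻¹ * redMap K (q ^ (j + 1)) (q ^ j) (q - 1)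
      (dft (-w) (q ^ (i + 1)) (fun l => if h : l < q ^ (i + 1) then
        foldMap K (q ^ (j + 1)) (D fun r => (spreadMap w (q ^ j) (q ^ i) (q ^ (i + 1)) E p *
          spreadMap w (q ^ j) (q ^ i) (q ^ (i + 1)) E' p') (⟨l, h⟩, r)) else 0) u)) =
    aeval ζ (∑ v ∈ Finset.range (q ^ i), ∑ v' ∈ Finset.range (q ^ i),
      if v + v' = u then polyOf (q ^ j) (fun s => p.coeff (q ^ j * v + s)) *
        polyOf (q ^ j) (fun s => p'.coeff (q ^ j * v' + s)) else 0) := by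
  have : NeZero (q ^ (j + 1)) := ⟨(pow_pos hq.pos _).ne'⟩
  have hζ : ζ ^ q ^ (j + 1) = 1 := by
    have := mul_geom_sum (ζ ^ q ^ j) q
    rw [hsum, mul_zero, ← pow_mul, ← pow_succ] at this
    exact (sub_eq_zero.1 this.symm)
  set χ := AddChar.zmodChar (q ^ (j + 1)) hζ with hχ_def
  have hw : w * (q ^ (i + 1) : ℕ) = 0 := by
    rw [hw_def, ← Nat.cast_mul, ← pow_add, show j - i + (i + 1) = j + 1 by omega]
    exact ZMod.natCast_self _
  -- From `ζ`, of order dividing `q ^ (j + 1)`, this power gives a root of unity for transforms of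
  -- length `q ^ (i + 1)`; this is where `i ≤ j` is needed.
  have hχw : χ w = ζ ^ q ^ (j - i) := by
    rw [hχ_def, AddChar.zmodChar_apply, hw_def, ZMod.val_cast_of_lt]
    exact Nat.pow_lt_pow_right hq.one_lt (by omega)
  have horth : ∀ v, ¬ q ^ (i + 1) ∣ v →
      ∑ l ∈ Finset.range (q ^ (i + 1)), χ w ^ (l * v) = 0 := fun v hv => by
    rw [hχw]
    refine sum_pow_mul_eq_zero_of_prime_pow hq i ?_ hv
    rwa [← pow_mul ζ, ← pow_add, show j - i + i = j by omega]
  have hti : 2 * q ^ i ≤ q ^ (i + 1) := by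
    rw [pow_succ']; exact Nat.mul_le_mul_right _ (by omega)
  have hn0 : ((q ^ (i + 1) : ℕ) : K) ≠ 0 := by
    push_cast; exact pow_ne_zero _ hqK
  have hdft : ∀ (p : K[X]) (l : ℕ), aeval ζ (polyOf (q ^ (j + 1)) fun s =>
      dft w (q ^ (i + 1)) (pieces (q ^ (j + 1)) (q ^ j) (q ^ i) p) l s) =
      ∑ v ∈ Finset.range (q ^ i), χ (w * l * v) *
        aeval ζ (polyOf (q ^ j) fun s => p.coeff (q ^ j * v + s)) := fun p l => by
    rw [aeval_polyOf_zmod hζ, cycEval_dft]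
    symm
    rw [← Finset.sum_subset (Finset.range_mono (by omega : q ^ i ≤ q ^ (i + 1)))]
    · refine Finset.sum_congr rfl fun v hv => ?_
      rw [cycEval_pieces hζ (Nat.pow_le_pow_right hq.pos (by omega)),
        if_pos (Finset.mem_range.1 hv)]
    · intro v _ hv
      rw [cycEval_pieces hζ (Nat.pow_le_pow_right hq.pos (by omega)),
        if_neg (by simpa using hv), mul_zero]
  have hq1 : q - 1 + 1 = q := by omega
  rw [map_mul, aeval_C, aeval_redMap hζ (by rw [hq1, pow_succ'])
    (by rw [hq1]; exact hsum), cycEval_dft]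
  have hprod : ∀ l ∈ Finset.range (q ^ (i + 1)), χ (-w * u * l) *
      cycEval χ (if h : l < q ^ (i + 1) then foldMap K (q ^ (j + 1)) (D fun r =>
        (spreadMap w (q ^ j) (q ^ i) (q ^ (i + 1)) E p *
          spreadMap w (q ^ j) (q ^ i) (q ^ (i + 1)) E' p') (⟨l, h⟩, r)) else 0) =
      χ (-w * u * l) * ((∑ v ∈ Finset.range (q ^ i), χ (w * l * v) *
        aeval ζ (polyOf (q ^ j) fun s => p.coeff (q ^ j * v + s))) *
      (∑ v ∈ Finset.range (q ^ i), χ (w * l * v) *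
        aeval ζ (polyOf (q ^ j) fun s => p'.coeff (q ^ j * v + s)))) := by
    intro l hl
    have hl := Finset.mem_range.1 hl
    rw [dif_pos hl]
    congr 1
    rw [← hdft, ← hdft, ← map_mul, ← hD _ _ (degree_polyOf_lt _ _) (degree_polyOf_lt _ _),
      ← cycEval_foldMap hζ]
    · rfl
    -- A recursive product has degree less than `2 * q ^ (j + 1)`, so `foldMap` loses none of its
    -- coefficients.
    · rw [hD _ _ (degree_polyOf_lt _ _) (degree_polyOf_lt _ _), two_mul]
      exact degree_mul_lt (degree_polyOf_lt _ _) (degree_polyOf_lt _ _)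
  rw [Finset.sum_congr rfl hprod, sum_dft_mul_dft χ hw horth hti _ _ hu,
    ← mul_assoc, show (algebraMap K Q ((q ^ (i + 1) : ℕ) : K)⁻¹) * ((q ^ (i + 1) : ℕ) : Q) = 1 by
      rw [← map_natCast (algebraMap K Q), ← map_mul, inv_mul_cancel₀ hn0, map_one], one_mul]
  simp only [map_sum]
  refine Finset.sum_congr rfl fun v _ => Finset.sum_congr rfl fun v' _ => ?_
  split_ifs <;> simp

/-- The coefficients with respect to the powers of `X ^ q ^ j` are known at the root of the
cyclotomic polynomial, of degree `(q - 1) * q ^ j`. They are sums of products of two pieces, hence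
of degree less than `2 * q ^ j`, and since `q ≥ 3` their residues determine them. -/
theorem assembleMap_spreadMap {q i j : ℕ} (hq : q.Prime) (h3 : 3 ≤ q) (hqK : (q : K) ≠ 0)
    (hij : i ≤ j) {ρ : Type} {E E' : K[X] → ρ → K} {D : (ρ → K) →ₗ[K] K[X]}
    (hD : ∀ p p' : K[X], p.degree < (q ^ (j + 1) : ℕ) → p'.degree < (q ^ (j + 1) : ℕ) →
      D (E p * E' p') = p * p')
    {p p' : K[X]} (hp : p.degree < (q ^ j * q ^ i : ℕ)) (hp' : p'.degree < (q ^ j * q ^ i : ℕ))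
    {w : ZMod (q ^ (j + 1))} (hw_def : w = (q ^ (j - i) : ℕ)) :
    assembleMap w (q ^ j) (q - 1) (q ^ (i + 1)) D
      (spreadMap w (q ^ j) (q ^ i) (q ^ (i + 1)) E p *
        spreadMap w (q ^ j) (q ^ i) (q ^ (i + 1)) E' p') = p * p' := by
  have hti : 2 * q ^ i ≤ q ^ (i + 1) := by
    rw [pow_succ']; exact Nat.mul_le_mul_right _ (by omega)
  have hn0 : ((q ^ (i + 1) : ℕ) : K) ≠ 0 := by
    push_cast; exact pow_ne_zero _ hqK
  rw [assembleMap_apply]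
  conv_rhs => rw [← polyOf_mul_polyOf_eq_sum hti hp hp']
  refine Finset.sum_congr rfl fun u hu => ?_
  congr 1
  refine eq_of_aeval_cyclotomic_root (j := j) hq ?_ ?_
    (aeval_redMap_dft hq h3 hqK hij (sum_root_cyclotomic hq) hD p p' hw_def
      (Finset.mem_range.1 hu))
  · refine (degree_C_mul_of_isUnit ((isUnit_iff_ne_zero.2 (inv_ne_zero hn0))) _).trans_lt ?_
    rw [redMap_apply]
    exact degree_polyOf_lt _ _
  · have hlt : ∀ v v' : ℕ, (polyOf (q ^ j) (fun s => p.coeff (q ^ j * v + s)) *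
        polyOf (q ^ j) (fun s => p'.coeff (q ^ j * v' + s))).degree < ((q - 1) * q ^ j : ℕ) := by
      intro v v'
      refine (degree_mul_lt (degree_polyOf_lt _ _) (degree_polyOf_lt _ _)).trans_le ?_
      have : 2 * q ^ j ≤ (q - 1) * q ^ j := Nat.mul_le_mul_right _ (by omega)
      rw [two_mul] at this
      exact_mod_cast this
    refine (degree_sum_le _ _).trans_lt ((Finset.sup_lt_iff (WithBot.bot_lt_coe _)).2
      fun v _ => (degree_sum_le _ _).trans_lt ((Finset.sup_lt_iff (WithBot.bot_lt_coe _)).2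
      fun v' _ => ?_))
    split_ifs
    · exact hlt v v'
    · rw [degree_zero]; exact WithBot.bot_lt_coe _

end FastMul

/-! ### Cost of the recursive step and quasi-linear polynomial multiplication -/

section FastMulCost

open Polynomial

variable {K : Type u} [Field K] {M : ℕ}

theorem degree_C_mul_lt {p : K[X]} {N : ℕ} (k : K) (hp : p.degree < N) :
    (C k * p).degree < N := by
  rw [degree_lt_iff_coeff_zero] at *
  intro i hi
  rw [coeff_C_mul, hp i hi, mul_zero]

theorem Reach.spreadMap {Ω : Type u} {ρ : Type} [Fintype ρ] {q i j c : ℕ} (hq : 0 < q)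
    {E : K[X] → ρ → K}
    (hE : ∀ (Ω : Type u) (p : Ω → K[X]), Reach (coefs p) c (Set.range fun i x => E (p x) i))
    {w : ZMod (q ^ (j + 1))} (hw : w * (q ^ (i + 1) : ℕ) = 0) (p : Ω → K[X]) :
    Reach (coefs p) (q ^ (i + 1) * (c + (i + 1) * q * q ^ (j + 1)))
      (Set.range fun y x =>
        BivComp.spreadMap w (q ^ j) (q ^ i) (q ^ (i + 1)) E (p x) y) := by
  have : NeZero (q ^ (j + 1)) := ⟨(pow_pos hq _).ne'⟩
  have h1 := Reach.dft (S := coefs p) hq (i + 1) hw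
    (a := fun x => pieces (q ^ (j + 1)) (q ^ j) (q ^ i) (p x)) fun u _ s => by
      by_cases h : u < q ^ i ∧ s.val < q ^ j
      · simp only [pieces, h, and_self, if_true]
        exact Or.inr (mem_coefs p _)
      · simp only [pieces, h, if_false]
        exact Or.inl rfl
  have h2 := Reach.iUnion fun l : Fin (q ^ (i + 1)) =>
    (Reach.of_subset (coefs_polyOf_subset (N := q ^ (j + 1))
      (c := fun x s => BivComp.dft w (q ^ (i + 1))
        (pieces (q ^ (j + 1)) (q ^ j) (q ^ i) (p x)) l s)
      (S := Set.range fun (y : ℕ × ZMod (q ^ (j + 1))) x => BivComp.dft w (q ^ (i + 1))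
        (pieces (q ^ (j + 1)) (q ^ j) (q ^ i) (p x)) y.1 y.2) fun s _ =>
      Or.inr ⟨((l : ℕ), (s : ZMod (q ^ (j + 1)))), rfl⟩)).comp
      (hE Ω fun x => polyOf (q ^ (j + 1)) fun s => BivComp.dft w (q ^ (i + 1))
        (pieces (q ^ (j + 1)) (q ^ j) (q ^ i) (p x)) l s)
  refine ((h1.comp h2).mono_cost (le_of_eq ?_)).mono_right' ?_
  · rw [Fintype.card_fin]; ring
  · rintro _ ⟨⟨l, r⟩, rfl⟩
    exact Set.mem_iUnion.2 ⟨l, r, rfl⟩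

theorem Reach.assembleMap {Ω : Type u} {ρ : Type} [Fintype ρ] {q i j c : ℕ} (hq : 0 < q)
    {D : (ρ → K) →ₗ[K] K[X]}
    (hD : ∀ (Ω : Type u) (y : Ω → ρ → K),
      Reach (Set.range fun i x => y x i) c (coefs fun x => D (y x)))
    {w : ZMod (q ^ (j + 1))} (hw : w * (q ^ (i + 1) : ℕ) = 0)
    (y : Ω → Fin (q ^ (i + 1)) × ρ → K) :
    Reach (Set.range fun i x => y x i) (q ^ (i + 1) * (c + ((i + 1) * q + 5) * q ^ (j + 1)))
      (coefs fun x => BivComp.assembleMap w (q ^ j) (q - 1) (q ^ (i + 1)) D (y x)) := by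
  have : NeZero (q ^ (j + 1)) := ⟨(pow_pos hq _).ne'⟩
  have h1 := Reach.iUnion fun l : Fin (q ^ (i + 1)) =>
    (hD Ω fun x r => y x (l, r)).mono_left (S' := Set.range fun i x => y x i)
      (by rintro _ ⟨r, rfl⟩; exact ⟨(l, r), rfl⟩)
  have h2 : Reach (⋃ l : Fin (q ^ (i + 1)), coefs fun x => D fun r => y x (l, r))
      (Fintype.card (Fin (q ^ (i + 1)) × ZMod (q ^ (j + 1))) * 1)
      (Set.range fun (a : Fin (q ^ (i + 1)) × ZMod (q ^ (j + 1))) x =>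
        foldMap K (q ^ (j + 1)) (D fun r => y x (a.1, r)) a.2) :=
    Reach.range fun a => Reach.add
      (Or.inr (Set.mem_iUnion.2 ⟨a.1, mem_coefs (fun x => D fun r => y x (a.1, r)) a.2.val⟩))
      (Or.inr (Set.mem_iUnion.2 ⟨a.1, mem_coefs (fun x => D fun r => y x (a.1, r)) _⟩))
  set φ : Ω → ℕ → ZMod (q ^ (j + 1)) → K := fun x l => if h : l < q ^ (i + 1) then
    foldMap K (q ^ (j + 1)) (D fun r => y x (⟨l, h⟩, r)) else 0 with hφ
  have h3 := Reach.dft (S := Set.range fun (a : Fin (q ^ (i + 1)) × ZMod (q ^ (j + 1))) x =>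
        foldMap K (q ^ (j + 1)) (D fun r => y x (a.1, r)) a.2) hq (i + 1) (w := -w)
    (by rw [neg_mul, hw, neg_zero])
    (a := φ) fun u hu s => by
      simp only [hφ, dif_pos hu]
      exact Or.inr ⟨(⟨u, hu⟩, s), rfl⟩
  set T := Set.range fun (a : ℕ × ZMod (q ^ (j + 1))) x =>
    BivComp.dft (-w) (q ^ (i + 1)) (φ x) a.1 a.2 with hT
  have h4 : Reach T (1 + q ^ (i + 1) * ((q - 1) * q ^ j * 1 + (q - 1) * q ^ j))
      (⋃ u ∈ Finset.range (q ^ (i + 1)), coefs fun x => C ((q ^ (i + 1) : ℕ) : K)⁻¹ *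
        redMap K (q ^ (j + 1)) (q ^ j) (q - 1) (BivComp.dft (-w) (q ^ (i + 1)) (φ x) u)) := by
    refine (Reach.const ((q ^ (i + 1) : ℕ) : K)⁻¹).trans ?_
    have := Reach.biUnion (S := T ∪ {fun _ => ((q ^ (i + 1) : ℕ) : K)⁻¹})
      (c := (q - 1) * q ^ j * 1 + (q - 1) * q ^ j)
      (T := fun u => coefs fun x => C ((q ^ (i + 1) : ℕ) : K)⁻¹ *
        redMap K (q ^ (j + 1)) (q ^ j) (q - 1) (BivComp.dft (-w) (q ^ (i + 1)) (φ x) u))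
      (Finset.range (q ^ (i + 1))) fun u _ => ?_
    · simpa only [Finset.card_range] using this
    have hred := Reach.coefs_of_degree_lt (S := T ∪ {fun _ => ((q ^ (i + 1) : ℕ) : K)⁻¹})
      (c := 1) (N := (q - 1) * q ^ j) (p := fun x => redMap K (q ^ (j + 1)) (q ^ j) (q - 1)
        (BivComp.dft (-w) (q ^ (i + 1)) (φ x) u))
      (fun x => by rw [redMap_apply]; exact degree_polyOf_lt _ _) fun s hs => by
        have := Reach.sub (S := T ∪ {fun _ => ((q ^ (i + 1) : ℕ) : K)⁻¹})
          (u := fun x => BivComp.dft (-w) (q ^ (i + 1)) (φ x) u (s : ZMod (q ^ (j + 1))))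
          (v := fun x => BivComp.dft (-w) (q ^ (i + 1)) (φ x) u
            (((q - 1) * q ^ j + s % q ^ j : ℕ) : ZMod (q ^ (j + 1))))
          (Or.inr (Or.inl ⟨(u, _), rfl⟩)) (Or.inr (Or.inl ⟨(u, _), rfl⟩))
        convert this using 2
        ext x
        simp [redMap_apply, coeff_polyOf, hs]
    refine hred.trans (Reach.polySmul (k := fun _ => ((q ^ (i + 1) : ℕ) : K)⁻¹) ?_ ?_ fun x => ?_)
    · exact Or.inr (Or.inl (Or.inr rfl))
    · exact Set.subset_union_right.trans (Set.subset_insert _ _)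
    · rw [redMap_apply]; exact degree_polyOf_lt _ _
  have h5 := Reach.polySumShift (S := ⋃ u ∈ Finset.range (q ^ (i + 1)),
      coefs fun x => C ((q ^ (i + 1) : ℕ) : K)⁻¹ *
        redMap K (q ^ (j + 1)) (q ^ j) (q - 1) (BivComp.dft (-w) (q ^ (i + 1)) (φ x) u))
    (N := (q - 1) * q ^ j) (P := fun u x => C ((q ^ (i + 1) : ℕ) : K)⁻¹ *
        redMap K (q ^ (j + 1)) (q ^ j) (q - 1) (BivComp.dft (-w) (q ^ (i + 1)) (φ x) u))
    (fun u => q ^ j * u) (q ^ (i + 1))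
    (fun u hu => (Set.subset_biUnion_of_mem (u := fun u => coefs fun x =>
      C ((q ^ (i + 1) : ℕ) : K)⁻¹ * redMap K (q ^ (j + 1)) (q ^ j) (q - 1)
        (BivComp.dft (-w) (q ^ (i + 1)) (φ x) u))
      (Finset.mem_coe.2 (Finset.mem_range.2 hu))).trans (Set.subset_insert _ _))
    fun u hu x => by
      refine degree_C_mul_lt _ ?_
      rw [redMap_apply]; exact degree_polyOf_lt _ _
  have h := (((h1.comp h2).comp h3).comp h4).comp h5
  have hfun : (fun x => BivComp.assembleMap w (q ^ j) (q - 1) (q ^ (i + 1)) D (y x)) =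
      fun x => ∑ u ∈ Finset.range (q ^ (i + 1)), X ^ (q ^ j * u) *
        (C ((q ^ (i + 1) : ℕ) : K)⁻¹ * redMap K (q ^ (j + 1)) (q ^ j) (q - 1)
          (BivComp.dft (-w) (q ^ (i + 1)) (φ x) u)) :=
    funext fun x => assembleMap_apply _ _ _ _ _ _
  rw [hfun]
  refine h.mono_cost ?_
  rw [Fintype.card_prod, Fintype.card_fin, ZMod.card]
  -- The spare unit absorbs the loading of the inverse of `q ^ (i + 1)`.
  have hN : (q - 1) * q ^ j + 1 ≤ q ^ (j + 1) := by
    have : 0 < q ^ j := pow_pos hq _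
    obtain ⟨q, rfl⟩ : ∃ q', q = q' + 1 := ⟨q - 1, by omega⟩
    rw [pow_succ' _ j, Nat.add_sub_cancel, add_mul]
    omega
  have hn : 0 < q ^ (i + 1) := pow_pos hq _
  have h1' : 1 + 3 * (q ^ (i + 1) * ((q - 1) * q ^ j)) ≤ 4 * (q ^ (i + 1) * q ^ (j + 1)) := by
    have := Nat.mul_le_mul_left (q ^ (i + 1)) hN
    rw [mul_add] at this
    omega
  calc _ = q ^ (i + 1) * c + q ^ (i + 1) * q ^ (j + 1)
        + q ^ (i + 1) * ((i + 1) * q * q ^ (j + 1))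
        + (1 + 3 * (q ^ (i + 1) * ((q - 1) * q ^ j))) := by ring
    _ ≤ q ^ (i + 1) * c + q ^ (i + 1) * q ^ (j + 1)
        + q ^ (i + 1) * ((i + 1) * q * q ^ (j + 1)) + 4 * (q ^ (i + 1) * q ^ (j + 1)) := by gcongr
    _ = _ := by ring

/-- The recursive step: multiplication of polynomials of degree less than `q ^ (i + j)` reduces to
`q ^ (i + 1)` multiplications of polynomials of degree less than `q ^ (j + 1)`. -/
theorem MulAlg.step {q i j r c : ℕ} (hq : q.Prime) (h3 : 3 ≤ q) (hqK : (q : K) ≠ 0)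
    (hij : i ≤ j) (h : MulAlg K (q ^ (j + 1)) r c) :
    MulAlg K (q ^ (j + i)) (q ^ (i + 1) * r)
      (q ^ (i + 1) * (c + ((i + 1) * q + 5) * q ^ (j + 1))) := by
  obtain ⟨ρ, _, E, E', D, hr, hD, hE, hE', hDc⟩ := h
  have hw : ((q ^ (j - i) : ℕ) : ZMod (q ^ (j + 1))) * (q ^ (i + 1) : ℕ) = 0 := by
    rw [← Nat.cast_mul, ← pow_add, show j - i + (i + 1) = j + 1 by omega]
    exact ZMod.natCast_self _
  have hle : q ^ (i + 1) * (c + (i + 1) * q * q ^ (j + 1)) ≤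
      q ^ (i + 1) * (c + ((i + 1) * q + 5) * q ^ (j + 1)) := by
    gcongr; omega
  refine ⟨Fin (q ^ (i + 1)) × ρ, inferInstance,
    spreadMap ((q ^ (j - i) : ℕ) : ZMod (q ^ (j + 1))) (q ^ j) (q ^ i) (q ^ (i + 1)) E,
    spreadMap ((q ^ (j - i) : ℕ) : ZMod (q ^ (j + 1))) (q ^ j) (q ^ i) (q ^ (i + 1)) E',
    assembleMap ((q ^ (j - i) : ℕ) : ZMod (q ^ (j + 1))) (q ^ j) (q - 1) (q ^ (i + 1)) D,
    ?_, fun p p' hp hp' => ?_, fun Ω p => ?_, fun Ω p => ?_, fun Ω y => ?_⟩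
  · rw [Fintype.card_prod, Fintype.card_fin]
    exact Nat.mul_le_mul_left _ hr
  · rw [pow_add] at hp hp'
    exact assembleMap_spreadMap hq h3 hqK hij hD hp hp' rfl
  · exact (Reach.spreadMap hq.pos hE hw p).mono_cost hle
  · exact (Reach.spreadMap hq.pos hE' hw p).mono_cost hle
  · exact Reach.assembleMap hq.pos hDc hw y

/-- Either `3` or `5` works: `2 * 3 - 5 = 1`, so both cannot vanish in `K`. -/
theorem exists_prime_ne_zero (K : Type*) [Field K] : ∃ q : ℕ, q.Prime ∧ 3 ≤ q ∧ (q : K) ≠ 0 := by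
  by_cases h : ((3 : ℕ) : K) = 0
  · refine ⟨5, by norm_num, by norm_num, fun h5 => ?_⟩
    have h3 : (3 : K) = 0 := by exact_mod_cast h
    have h5 : (5 : K) = 0 := by exact_mod_cast h5
    exact one_ne_zero (α := K) (by linear_combination 2 * h3 - h5)
  · exact ⟨3, by norm_num, le_rfl, h⟩

theorem add_two_mul_two_pow_le (a : ℕ) : (a + 2) * 2 ^ a ≤ 2 * 3 ^ a := by
  induction a with
  | zero => simp
  | succ a ih =>
    calc (a + 1 + 2) * 2 ^ (a + 1) = (2 * a + 6) * 2 ^ a := by ring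
      _ ≤ (3 * (a + 2)) * 2 ^ a := by gcongr; omega
      _ = 3 * ((a + 2) * 2 ^ a) := by ring
      _ ≤ 3 * (2 * 3 ^ a) := by gcongr
      _ = _ := by ring

/-- Each recursive step roughly halves the exponent `k` and multiplies the cost per coefficient by a
constant, about `2 * q ^ 2`. There are `O(log k)` levels, so the overhead is polynomial in `k`, that
is, polylogarithmic in the size. -/
theorem MulAlg.prime_pow {q : ℕ} (hq : q.Prime) (h3 : 3 ≤ q) (hqK : (q : K) ≠ 0) :
    ∃ C e : ℕ, ∀ k : ℕ, MulAlg K (q ^ k) (C * q ^ k * (k + 1) ^ e) (C * q ^ k * (k + 1) ^ e) := by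
  -- The exponent `j + 2` of the subproblem, shifted by one, is at most two thirds of `k + 1`; `e`
  -- is chosen so that `(2 / 3) ^ e` compensates the factor `2 * q ^ 2`. In it, `q ^ 2` comes from
  -- `q ^ (i + 1) * q ^ (j + 1)` and `2` from adding the transforms to the recursive cost.
  obtain ⟨e, he, he1⟩ : ∃ e, 2 * q ^ 2 * 2 ^ e ≤ 3 ^ e ∧ 1 ≤ e := by
    refine ⟨4 * q ^ 2, ?_, by have := pow_pos hq.pos 2; omega⟩
    have := add_two_mul_two_pow_le (4 * q ^ 2)
    have h2 : 4 * q ^ 2 * 2 ^ (4 * q ^ 2) ≤ (4 * q ^ 2 + 2) * 2 ^ (4 * q ^ 2) := by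
      gcongr; omega
    linarith
  refine ⟨q ^ 22 + 3 * q, e, fun k => ?_⟩
  induction k using Nat.strong_induction_on with
  | _ k ih =>
    -- From `k = 11` on, `j = k - k / 2` satisfies `3 * (j + 2) ≤ 2 * (k + 1)`, with equality at
    -- `11`. Below that the quadratic algorithm is covered by the term `q ^ 22` of the constant.
    rcases Nat.lt_or_ge k 11 with hk | hk
    · have hle : (q ^ k) ^ 2 ≤ (q ^ 22 + 3 * q) * q ^ k * (k + 1) ^ e :=
        calc (q ^ k) ^ 2 = q ^ k * q ^ k * 1 := by ring
          _ ≤ (q ^ 22 + 3 * q) * q ^ k * (k + 1) ^ e := by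
            gcongr
            · exact (Nat.pow_le_pow_right hq.pos (by omega)).trans (Nat.le_add_right _ _)
            · exact Nat.one_le_pow _ _ (by omega)
      exact (MulAlg.schoolbook K (q ^ k)).mono le_rfl hle hle
    · obtain ⟨i, j, hij, hk', hjk⟩ : ∃ i j, i ≤ j ∧ j + i = k ∧ 3 * (j + 2) ≤ 2 * (k + 1) :=
        ⟨k / 2, k - k / 2, by omega, by omega, by omega⟩
      set B := q ^ 22 + 3 * q with hB
      have h := MulAlg.step hq h3 hqK hij (ih (j + 1) (by omega))
      rw [hk'] at h
      have hpow : 2 * q ^ 2 * (j + 2) ^ e ≤ (k + 1) ^ e := by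
        refine Nat.le_of_mul_le_mul_left ?_ (pow_pos (by norm_num : 0 < 3) e)
        calc 3 ^ e * (2 * q ^ 2 * (j + 2) ^ e) = 2 * q ^ 2 * (3 * (j + 2)) ^ e := by
              rw [mul_pow]; ring
          _ ≤ 2 * q ^ 2 * (2 * (k + 1)) ^ e := by gcongr
          _ = 2 * q ^ 2 * 2 ^ e * (k + 1) ^ e := by rw [mul_pow]; ring
          _ ≤ 3 ^ e * (k + 1) ^ e := by gcongr
      have hlin : (i + 1) * q + 5 ≤ B * (j + 1 + 1) ^ e :=
        calc (i + 1) * q + 5 ≤ (j + 1) * q + 2 * q := by gcongr; omega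
          _ ≤ 3 * q * (j + 2) := by nlinarith
          _ ≤ B * (j + 2) ^ e := by
            gcongr
            · omega
            · exact Nat.le_self_pow (by omega) _
      have hcost : q ^ (i + 1) * (B * q ^ (j + 1) * (j + 1 + 1) ^ e +
          ((i + 1) * q + 5) * q ^ (j + 1)) ≤ B * q ^ k * (k + 1) ^ e :=
        calc _ ≤ q ^ (i + 1) * (B * q ^ (j + 1) * (j + 1 + 1) ^ e +
              (B * (j + 1 + 1) ^ e) * q ^ (j + 1)) := by gcongr
          _ = B * q ^ (j + i) * (2 * q ^ 2 * (j + 2) ^ e) := by ring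
          _ ≤ B * q ^ k * (k + 1) ^ e := by rw [hk']; gcongr
      refine h.mono le_rfl (le_trans ?_ hcost) hcost
      gcongr
      exact Nat.le_add_right _ _

/-- Polynomials of degree less than `N`, `1 ≤ N ≤ Z`, are multiplied by bilinear algorithms of
rank and cost at most `N * Λ`. -/
def FastMul (K : Type u) [Field K] (Z Λ : ℕ) : Prop :=
  ∀ N, 1 ≤ N → N ≤ Z → MulAlg K N (N * Λ) (N * Λ)

/-- Rounding `N` up to a power of `q` costs at most a factor `q`. -/
theorem exists_fastMul (K : Type u) [Field K] :
    ∃ C e : ℕ, ∀ Z, FastMul K Z (C * (Nat.log 2 Z + 1) ^ e) := by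
  obtain ⟨q, hq, h3, hqK⟩ := exists_prime_ne_zero K
  obtain ⟨C, e, h⟩ := MulAlg.prime_pow hq h3 hqK
  refine ⟨C * q * 2 ^ e, e, fun Z N hN hNZ => ?_⟩
  have hle : N ≤ q ^ Nat.clog q N := Nat.le_pow_clog hq.one_lt N
  have hge : q ^ Nat.clog q N ≤ q * N ∧ Nat.clog q N ≤ Nat.log 2 N + 1 := by
    rcases hN.eq_or_lt with rfl | hN
    · simpa using hq.one_lt.le
    · have hpos : 0 < Nat.clog q N := Nat.clog_pos hq.one_lt hN
      have hlt := Nat.pow_pred_clog_lt_self hq.one_lt hN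
      rw [Nat.pred_eq_sub_one] at hlt
      obtain ⟨k, hk⟩ : ∃ k, Nat.clog q N = k + 1 := ⟨Nat.clog q N - 1, by omega⟩
      rw [hk, Nat.add_sub_cancel] at hlt
      rw [hk]
      refine ⟨?_, Nat.succ_le_succ ?_⟩
      · rw [pow_succ']
        exact Nat.mul_le_mul_left _ hlt.le
      · exact (Nat.le_log_iff_pow_le (by norm_num) (by omega)).2
          ((Nat.pow_le_pow_left (by omega) k).trans hlt.le)
  have hcost : C * q ^ Nat.clog q N * (Nat.clog q N + 1) ^ e ≤
      N * (C * q * 2 ^ e * (Nat.log 2 Z + 1) ^ e) :=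
    calc _ ≤ C * (q * N) * (2 * (Nat.log 2 Z + 1)) ^ e := by
          gcongr
          · exact hge.1
          · have := Nat.log_mono_right (b := 2) hNZ
            omega
      _ = _ := by rw [mul_pow]; ring
  exact (h _).mono hle hcost hcost

end FastMulCost

/-! ### Products of polynomials and of polynomial matrices -/

section Products

open Polynomial

variable {Ω K : Type u} [Field K]

theorem Reach.mono_left_insert {S S' T : Set (Ω → K)} {c : ℕ} (h : Reach S c T)
    (hS : S ⊆ insert 0 S') : Reach S' c T := by
  simpa using (Reach.of_subset hS).comp h

theorem Reach.polyMul {Z Λ : ℕ} (hF : FastMul K Z Λ) {N : ℕ} (hN : 1 ≤ N) (hNZ : N ≤ Z)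
    {S : Set (Ω → K)} {p q : Ω → K[X]} (hp : coefs p ⊆ insert 0 S) (hq : coefs q ⊆ insert 0 S)
    (hpN : ∀ x, (p x).degree < N) (hqN : ∀ x, (q x).degree < N) :
    Reach S (4 * (N * Λ)) (coefs fun x => p x * q x) := by
  obtain ⟨ρ, _, E, E', D, hr, hD, hE, hE', hDc⟩ := hF N hN hNZ
  have h1 := ((hE Ω p).mono_left_insert hp).union ((hE' Ω q).mono_left_insert hq)
  have h2 : Reach ((Set.range fun i x => E (p x) i) ∪ Set.range fun i x => E' (q x) i)
      (Fintype.card ρ * 1) (Set.range fun i x => E (p x) i * E' (q x) i) :=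
    Reach.range fun i => Reach.mul (Or.inr (Or.inl ⟨i, rfl⟩)) (Or.inr (Or.inr ⟨i, rfl⟩))
  have h3 := (h1.comp h2).comp (hDc Ω fun x i => E (p x) i * E' (q x) i)
  have hfun : (fun x => p x * q x) = fun x => D fun i => E (p x) i * E' (q x) i :=
    funext fun x => (hD _ _ (hpN x) (hqN x)).symm
  rw [hfun]
  exact h3.mono_cost (by omega)

/-- Two `s × s` matrices over `K` can be multiplied with `W` operations. -/
def MatMul (K : Type u) [Field K] (s W : ℕ) : Prop :=
  ∀ (Ω : Type u) (M N : Ω → Matrix (Fin s) (Fin s) K),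
    Reach ((Set.range fun (y : Fin s × Fin s) x => M x y.1 y.2) ∪
      Set.range fun (y : Fin s × Fin s) x => N x y.1 y.2) W
      (Set.range fun (y : Fin s × Fin s) x => (M x * N x) y.1 y.2)

theorem MatMul.of_slp {s : ℕ} (P : SLP K ((Fin s × Fin s) ⊕ (Fin s × Fin s)) (Fin s × Fin s))
    (hP : ∀ M N : Matrix (Fin s) (Fin s) K,
      P.Outputs (Sum.elim (fun ij => M ij.1 ij.2) (fun ij => N ij.1 ij.2))
        (fun ij => (M * N) ij.1 ij.2)) : MatMul K s P.cost := by
  intro Ω M N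
  refine (Reach.of_slp P fun x => hP (M x) (N x)).mono_left ?_
  rintro _ ⟨y | y, rfl⟩
  · exact Or.inl ⟨y, rfl⟩
  · exact Or.inr ⟨y, rfl⟩

/-- A program for matrix multiplication has at least as many operations as outputs. -/
theorem sq_le_cost_of_matMul {s : ℕ}
    (P : SLP K ((Fin s × Fin s) ⊕ (Fin s × Fin s)) (Fin s × Fin s))
    (hP : ∀ M N : Matrix (Fin s) (Fin s) K,
      P.Outputs (Sum.elim (fun ij => M ij.1 ij.2) (fun ij => N ij.1 ij.2))
        (fun ij => (M * N) ij.1 ij.2)) : s ^ 2 ≤ P.cost := by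
  have hlen : ∀ (x : (Fin s × Fin s) ⊕ (Fin s × Fin s) → K) (code : List _) (h h' : List K),
      runFrom x h code = some h' → h'.length = h.length + code.length := by
    intro x code
    induction code with
    | nil => intro h h' hh; simp only [runFrom, Option.some.injEq] at hh; simp [hh]
    | cons c cs ih =>
      intro h h' hh
      simp only [runFrom, Option.bind_eq_some_iff] at hh
      obtain ⟨r, -, hr⟩ := hh
      have := ih _ _ hr
      simp at this ⊢
      omega
  have hunit : ∀ (i j : Fin s), ∃ M N : Matrix (Fin s) (Fin s) K,
      (∀ k l, (M * N) k l = if k = i ∧ l = j then 1 else 0) ∧ True := fun i j =>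
    ⟨Matrix.single i i 1, Matrix.single i j 1, fun k l => by
      rw [Matrix.single_mul_single_same, Matrix.single_apply]
      simp [eq_comm], trivial⟩
  have hres : ∀ y, ∃ k < P.cost, P.out y = .result k := by
    intro y
    rcases hy : P.out y with i | k
    · exfalso
      -- No output can be an input: an entry of one factor does not change when the other factor is
      -- replaced by `0`, whereas this entry of the product changes from `1` to `0`.
      obtain ⟨h, -, hout⟩ := hP (Matrix.single y.1 y.1 1) (Matrix.single y.1 y.2 1)
      obtain ⟨h', -, hout'⟩ := hP (Matrix.single y.1 y.1 1) 0
      obtain ⟨h'', -, hout''⟩ := hP 0 (Matrix.single y.1 y.2 1)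
      have h1 := hout y
      have h2 := hout' y
      have h3 := hout'' y
      rw [hy] at h1 h2 h3
      rcases i with i | i <;>
        simp_all [Operand.value, Matrix.single_mul_single_same]
    · obtain ⟨h, hrun, hout⟩ := hP 0 0
      have h1 := hout y
      rw [hy] at h1
      refine ⟨k, ?_, rfl⟩
      have h2 := hlen _ _ _ _ hrun
      simp only [Operand.value] at h1
      obtain ⟨hk, -⟩ := List.getElem?_eq_some_iff.1 h1
      simpa [SLP.cost, h2] using hk
  choose k hk hk' using hres
  have hinj : Function.Injective fun y => (⟨k y, hk y⟩ : Fin P.cost) := by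
    intro y y' hyy
    have hkk : k y = k y' := by simpa using hyy
    -- The product is the matrix unit at `y`, so the outputs at `y` and at another position cannot
    -- come from the same instruction.
    obtain ⟨h, -, hout⟩ := hP (Matrix.single y.1 y.1 1) (Matrix.single y.1 y.2 1)
    have h1 := hout y
    have h2 := hout y'
    rw [hk', hkk, ← hk', h2] at h1
    by_contra hne
    have : ¬ (y.1 = y'.1 ∧ y.2 = y'.2) := fun h => hne (Prod.ext h.1 h.2)
    simp [Matrix.single_mul_single_same, this] at h1
  have := Fintype.card_le_of_injective _ hinj
  simpa [sq] using this

/-- As the postprocessing `D` is linear, the sum over the inner index can be moved inside it: one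
product of matrices over `K` for each of the at most `N * Λ` multiplications, and pre- and
postprocessing only once per entry. The latter is covered by `s ^ 2 ≤ W`. -/
theorem Reach.polyMatMul {Z Λ : ℕ} (hF : FastMul K Z Λ) {s W : ℕ} (hM : MatMul K s W)
    (hs : s ^ 2 ≤ W) {N : ℕ} (hN : 1 ≤ N) (hNZ : N ≤ Z)
    {S : Set (Ω → K)} {A B : Ω → Matrix (Fin s) (Fin s) K[X]}
    (hA : ∀ i j, coefs (fun x => A x i j) ⊆ insert 0 S)
    (hB : ∀ i j, coefs (fun x => B x i j) ⊆ insert 0 S)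
    (hAN : ∀ x i j, (A x i j).degree < N) (hBN : ∀ x i j, (B x i j).degree < N) :
    Reach S (4 * (N * Λ * W)) (⋃ y : Fin s × Fin s, coefs fun x => (A x * B x) y.1 y.2) := by
  obtain ⟨ρ, _, E, E', D, hr, hD, hE, hE', hDc⟩ := hF N hN hNZ
  have h1 := (Reach.iUnion fun y : Fin s × Fin s =>
      (hE Ω fun x => A x y.1 y.2).mono_left_insert (hA y.1 y.2)).union
    (Reach.iUnion fun y : Fin s × Fin s =>
      (hE' Ω fun x => B x y.1 y.2).mono_left_insert (hB y.1 y.2))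
  have h2 := Reach.iUnion fun r : ρ =>
    (hM Ω (fun x => Matrix.of fun i j => E (A x i j) r)
      (fun x => Matrix.of fun i j => E' (B x i j) r)).mono_left
      (S' := (⋃ y : Fin s × Fin s, Set.range fun i x => E (A x y.1 y.2) i) ∪
        ⋃ y : Fin s × Fin s, Set.range fun i x => E' (B x y.1 y.2) i) (by
      rintro _ (⟨y, rfl⟩ | ⟨y, rfl⟩)
      · exact Or.inl (Set.mem_iUnion.2 ⟨y, r, rfl⟩)
      · exact Or.inr (Set.mem_iUnion.2 ⟨y, r, rfl⟩))
  have h3 := Reach.iUnion fun y : Fin s × Fin s =>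
    (hDc Ω fun x r => ((Matrix.of fun i j => E (A x i j) r) *
      (Matrix.of fun i j => E' (B x i j) r) : Matrix (Fin s) (Fin s) K) y.1 y.2).mono_left
      (S' := ⋃ r, Set.range fun (y : Fin s × Fin s) x => ((Matrix.of fun i j => E (A x i j) r) *
      (Matrix.of fun i j => E' (B x i j) r) : Matrix (Fin s) (Fin s) K) y.1 y.2) (by
      rintro _ ⟨r, rfl⟩
      exact Set.mem_iUnion.2 ⟨r, y, rfl⟩)
  have hfun : ∀ y : Fin s × Fin s, (fun x => (A x * B x) y.1 y.2) = fun x =>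
      D fun r => ((Matrix.of fun i j => E (A x i j) r) *
      (Matrix.of fun i j => E' (B x i j) r) : Matrix (Fin s) (Fin s) K) y.1 y.2 := fun y => by
    funext x
    rw [Matrix.mul_apply]
    simp only [← hD _ _ (hAN x _ _) (hBN x _ _), ← map_sum]
    congr 1
    funext r
    simp [Matrix.mul_apply, Finset.sum_apply]
  simp only [hfun]
  refine ((h1.comp h2).comp h3).mono_cost ?_
  rw [Fintype.card_prod, Fintype.card_fin, ← sq]
  calc _ ≤ W * (N * Λ) + W * (N * Λ) + N * Λ * W + W * (N * Λ) := by gcongr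
    _ = _ := by ring

/-! ### Kronecker substitution -/

/-- The coefficient functions of a family of bivariate polynomials. -/
def bicoefs (p : Ω → K[X][Y]) : Set (Ω → K) :=
  Set.range fun (y : ℕ × ℕ) x => ((p x).coeff y.2).coeff y.1

theorem coefs_coeff_subset_bicoefs (p : Ω → K[X][Y]) (k : ℕ) :
    coefs (fun x => (p x).coeff k) ⊆ bicoefs p := by
  rintro _ ⟨i, rfl⟩
  exact ⟨(i, k), rfl⟩

theorem bicoefs_subset {p : Ω → K[X][Y]} {S : Set (Ω → K)}
    (h : ∀ k, coefs (fun x => (p x).coeff k) ⊆ S) : bicoefs p ⊆ S := by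
  rintro _ ⟨⟨i, k⟩, rfl⟩
  exact h k ⟨i, rfl⟩

/-- Under `y ↦ x ^ D` the coefficients with respect to `y` occupy disjoint blocks of length `D`, so
the substitution is undone by division with remainder of the exponent. -/
theorem coeff_eval_X_pow {p : K[X][Y]} {D : ℕ} (hp : ∀ k, (p.coeff k).degree < D) (n : ℕ) :
    (p.eval (X ^ D)).coeff n = (p.coeff (n / D)).coeff (n % D) := by
  rcases D.eq_zero_or_pos with rfl | hD
  · have h0 : p = 0 := by ext1 k; simpa using hp k
    simp [h0]
  rw [eval_eq_sum, Polynomial.sum, finsetSum_coeff]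
  simp only [← pow_mul, coeff_mul_X_pow']
  rw [Finset.sum_eq_single (n / D)]
  · rw [if_pos (Nat.mul_div_le n D)]
    congr 1
    have := Nat.div_add_mod n D
    omega
  · intro k _ hk
    split_ifs with h
    · refine (degree_lt_iff_coeff_zero _ _).1 (hp k) _ ?_
      by_contra hlt
      refine hk (Nat.div_eq_of_lt_le ?_ ?_).symm
      · rw [mul_comm]; exact h
      · rw [add_mul, one_mul, mul_comm]; omega
    · rfl
  · intro h
    rw [notMem_support_iff.1 h]
    simp

theorem BidegLT.mono {m m' d d' : ℕ} {p : K[X][Y]} (h : BidegLT m d p) (hm : m ≤ m')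
    (hd : d ≤ d') : BidegLT m' d' p :=
  ⟨h.1.trans_le (by exact_mod_cast hd), fun j => (h.2 j).trans_le (by exact_mod_cast hm)⟩

theorem BidegLT.zero (m d : ℕ) : BidegLT m d (0 : K[X][Y]) := by simp [BidegLT]

theorem BidegLT.add {m d : ℕ} {p q : K[X][Y]} (hp : BidegLT m d p) (hq : BidegLT m d q) :
    BidegLT m d (p + q) :=
  ⟨(degree_add_le _ _).trans_lt (max_lt hp.1 hq.1), fun j => by
    rw [coeff_add]; exact (degree_add_le _ _).trans_lt (max_lt (hp.2 j) (hq.2 j))⟩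

theorem BidegLT.sum {ι : Type*} {m d : ℕ} {p : ι → K[X][Y]} (s : Finset ι)
    (h : ∀ i ∈ s, BidegLT m d (p i)) : BidegLT m d (∑ i ∈ s, p i) := by
  classical
  induction s using Finset.induction_on with
  | empty => exact BidegLT.zero m d
  | insert a s ha ih =>
    rw [Finset.sum_insert ha]
    exact (h a (by simp)).add (ih fun i hi => h i (by simp [hi]))

theorem BidegLT.mul {m d m' d' : ℕ} {p q : K[X][Y]} (hp : BidegLT m d p) (hq : BidegLT m' d' q) :
    BidegLT (m + m') (d + d') (p * q) := by
  constructor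
  · by_cases h0 : p = 0
    · simp [h0]
    by_cases h0' : q = 0
    · simp [h0']
    have h1 := hp.1
    have h2 := hq.1
    rw [degree_mul, degree_eq_natDegree h0, degree_eq_natDegree h0'] at *
    have h1 : p.natDegree < d := by exact_mod_cast h1
    have h2 : q.natDegree < d' := by exact_mod_cast h2
    exact_mod_cast add_lt_add h1 h2
  · intro j
    rw [coeff_mul]
    exact (degree_sum_le _ _).trans_lt ((Finset.sup_lt_iff (WithBot.bot_lt_coe _)).2
      fun y _ => degree_mul_lt (hp.2 _) (hq.2 _))

theorem BidegLT.degree_eval_lt {m d : ℕ} {p : K[X][Y]} (hp : BidegLT m d p) :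
    (p.eval (X ^ m)).degree < (m * d : ℕ) := by
  rw [degree_lt_iff_coeff_zero]
  intro n hn
  rcases m.eq_zero_or_pos with rfl | hm
  · have h0 : p = 0 := by ext1 k; simpa using hp.2 k
    simp [h0]
  · rw [coeff_eval_X_pow hp.2, (degree_lt_iff_coeff_zero _ _).1 hp.1 (n / m), coeff_zero]
    rwa [Nat.le_div_iff_mul_le hm, mul_comm]

theorem coefs_eval_subset {p : Ω → K[X][Y]} {D : ℕ} (hp : ∀ x k, ((p x).coeff k).degree < D) :
    coefs (fun x => (p x).eval (X ^ D)) ⊆ bicoefs p := by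
  rintro _ ⟨n, rfl⟩
  refine ⟨(n % D, n / D), ?_⟩
  funext x
  exact (coeff_eval_X_pow (hp x) n).symm

theorem bicoefs_subset_eval {p : Ω → K[X][Y]} {D : ℕ}
    (hp : ∀ x k, ((p x).coeff k).degree < D) :
    bicoefs p ⊆ insert 0 (coefs fun x => (p x).eval (X ^ D)) := by
  rintro _ ⟨⟨i, k⟩, rfl⟩
  by_cases hi : i < D
  · refine Or.inr ⟨D * k + i, ?_⟩
    funext x
    change ((p x).eval (X ^ D)).coeff (D * k + i) = ((p x).coeff k).coeff i
    rw [coeff_eval_X_pow (hp x), Nat.mul_add_mod, Nat.mod_eq_of_lt hi,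
      Nat.mul_add_div (by omega), Nat.div_eq_of_lt hi, add_zero]
  · refine Or.inl ?_
    funext x
    exact (degree_lt_iff_coeff_zero _ _).1 (hp x k) i (by omega)

end Products

/-! ### Division with remainder -/

section Remainder

open Polynomial

variable {Ω K : Type u} [Field K]

theorem X_pow_dvd_sub_polyOf (L : ℕ) (p : K[X]) : X ^ L ∣ p - polyOf L p.coeff := by
  rw [X_pow_dvd_iff]
  intro i hi
  rw [coeff_sub, coeff_polyOf, if_pos hi, sub_self]

/-- The Newton iteration for the inverse of `F` modulo `X ^ L`. -/
noncomputable def newtonInv (L : ℕ) (F : K[X]) : ℕ → K[X]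
  | 0 => 1
  | k + 1 => newtonInv L F k + (newtonInv L F k -
      polyOf L (F * polyOf L (newtonInv L F k * newtonInv L F k).coeff).coeff)

/-- If `g` is replaced by `2 * g - F * g ^ 2`, the error `1 - F * g` is squared, starting from `1 -
F`; truncation at `X ^ L` does not matter modulo `X ^ L`. -/
theorem X_pow_dvd_newtonInv (L : ℕ) (F : K[X]) (k : ℕ) :
    X ^ L ∣ 1 - F * newtonInv L F k - (1 - F) ^ 2 ^ k := by
  induction k with
  | zero => simp [newtonInv]
  | succ k ih =>
    obtain ⟨a, ha⟩ := ih
    obtain ⟨b, hb⟩ := X_pow_dvd_sub_polyOf L (newtonInv L F k * newtonInv L F k)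
    obtain ⟨c, hc⟩ := X_pow_dvd_sub_polyOf L
      (F * polyOf L (newtonInv L F k * newtonInv L F k).coeff)
    rw [newtonInv, pow_succ, pow_mul]
    set g := newtonInv L F k
    set s := polyOf L (g * g).coeff
    set t := polyOf L (F * s).coeff
    set y := (1 - F) ^ 2 ^ k
    refine ⟨a * (1 - F * g + y) - F * F * b - F * c, ?_⟩
    linear_combination (1 - F * g + y) * ha - F * F * hb - F * hc

theorem X_pow_dvd_one_sub_mul_newtonInv {L : ℕ} {F : K[X]} (hF : F.coeff 0 = 1) {k : ℕ}
    (hk : L ≤ 2 ^ k) : X ^ L ∣ 1 - F * newtonInv L F k := by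
  have h1 : (X : K[X]) ^ L ∣ (1 - F) ^ 2 ^ k :=
    (pow_dvd_pow _ hk).trans (pow_dvd_pow_of_dvd (X_dvd_iff.2 (by simp [hF])) _)
  simpa using dvd_add (X_pow_dvd_newtonInv L F k) h1

theorem degree_newtonInv_lt {L : ℕ} (hL : 1 ≤ L) (F : K[X]) (k : ℕ) :
    (newtonInv L F k).degree < L := by
  induction k with
  | zero =>
    rw [newtonInv, degree_one]
    exact_mod_cast hL
  | succ k ih =>
    rw [newtonInv]
    exact (degree_add_le _ _).trans_lt (max_lt ih
      ((degree_sub_le _ _).trans_lt (max_lt ih (degree_polyOf_lt _ _))))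

theorem coefs_trunc_subset (L : ℕ) (p : Ω → K[X]) :
    coefs (fun x => polyOf L (p x).coeff) ⊆ insert 0 (coefs p) :=
  coefs_polyOf_subset fun i _ => Or.inr (mem_coefs p i)

theorem Reach.newtonInv {Z Λ : ℕ} (hF : FastMul K Z Λ) (hΛ : 1 ≤ Λ) {L : ℕ} (hL : 1 ≤ L)
    (hLZ : L ≤ Z) {F : Ω → K[X]} (hFL : ∀ x, (F x).degree < L) (k : ℕ) :
    Reach (coefs F) (1 + k * (10 * (L * Λ))) (coefs fun x => newtonInv L (F x) k) := by
  induction k with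
  | zero =>
    refine ((Reach.const (1 : K)).mono_cost (by omega)).mono_right ?_
    rw [coefs_subset]
    intro i
    simp only [BivComp.newtonInv, coeff_one]
    split_ifs
    · exact Or.inr (Or.inr rfl)
    · exact Or.inl rfl
  | succ k ih =>
    set g : Ω → K[X] := fun x => BivComp.newtonInv L (F x) k with hg
    set s : Ω → K[X] := fun x => polyOf L (g x * g x).coeff with hs
    set t : Ω → K[X] := fun x => polyOf L (F x * s x).coeff with ht
    have hgL : ∀ x, (g x).degree < L := fun x => degree_newtonInv_lt hL _ _
    have h1 : Reach (coefs F ∪ coefs g) (4 * (L * Λ)) (coefs s) :=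
      (Reach.polyMul hF hL hLZ (p := g) (q := g) (S := coefs F ∪ coefs g)
        (Set.subset_union_right.trans (Set.subset_insert _ _))
        (Set.subset_union_right.trans (Set.subset_insert _ _)) hgL hgL).mono_right
        ((coefs_trunc_subset L _).trans (Set.insert_subset_insert Set.subset_union_right))
    have h2 : Reach (coefs F ∪ coefs g ∪ coefs s) (4 * (L * Λ)) (coefs t) :=
      (Reach.polyMul hF hL hLZ (p := F) (q := s) (S := coefs F ∪ coefs g ∪ coefs s)
        ((Set.subset_union_left.trans Set.subset_union_left).trans (Set.subset_insert _ _))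
        (Set.subset_union_right.trans (Set.subset_insert _ _)) hFL
        fun x => degree_polyOf_lt _ _).mono_right
        ((coefs_trunc_subset L _).trans (Set.insert_subset_insert Set.subset_union_right))
    have h3 : Reach (coefs F ∪ coefs g ∪ coefs s ∪ coefs t) L (coefs fun x => g x - t x) :=
      Reach.polySub (((Set.subset_union_right.trans Set.subset_union_left).trans
        Set.subset_union_left).trans (Set.subset_insert _ _))
        (Set.subset_union_right.trans (Set.subset_insert _ _)) fun x => degree_polyOf_lt _ _
    have h4 : Reach (coefs F ∪ coefs g ∪ coefs s ∪ coefs t ∪ coefs fun x => g x - t x) L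
        (coefs fun x => g x + (g x - t x)) :=
      Reach.polyAdd ((((Set.subset_union_right.trans Set.subset_union_left).trans
        Set.subset_union_left).trans Set.subset_union_left).trans (Set.subset_insert _ _))
        (Set.subset_union_right.trans (Set.subset_insert _ _)) fun x =>
        (degree_sub_le _ _).trans_lt (max_lt (hgL x) (degree_polyOf_lt _ _))
    refine (ih.trans (h1.trans (h2.trans (h3.trans h4)))).mono_cost ?_
    have : L ≤ L * Λ := Nat.le_mul_of_pos_right _ hΛ
    calc _ ≤ 1 + k * (10 * (L * Λ)) + (4 * (L * Λ) + (4 * (L * Λ) + (L * Λ + L * Λ))) := by gcongr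
      _ = _ := by ring

/-- The quotient by a monic polynomial can be read off from a product with the reflection of an
approximate inverse of the reflected divisor. -/
theorem divByMonic_eq_polyOf {n L : ℕ} (hn1 : 1 ≤ n) (hL : 1 ≤ L) {f g p : K[X]} (hf : f.Monic)
    (hn : f.natDegree = n) (hg : g.degree < L) (hfg : X ^ L ∣ 1 - reflect n f * g)
    (hp : p.degree < L) :
    p /ₘ f = polyOf L fun i => (p * reflect (L - 1) g).coeff (i + (n + L - 1)) := by
  set T := reflect (L - 1) g with hT
  have hgdeg : g.natDegree ≤ L - 1 := by
    rcases eq_or_ne g 0 with rfl | h0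
    · simp
    · have := (natDegree_lt_iff_degree_lt h0).2 hg
      omega
  have hrefl : f * T = reflect (n + L - 1) (reflect n f * g) := by
    rw [show n + L - 1 = n + (L - 1) by omega, reflect_mul _ _ _ hgdeg]
    · congr 1
      ext i
      simp
    · rw [natDegree_le_iff_coeff_eq_zero]
      intro i hi
      rw [coeff_reflect, revAt_eq_self_of_lt hi]
      exact coeff_eq_zero_of_natDegree_lt (by omega)
  -- Reflected, the congruence modulo `X ^ L` says that `f * T` agrees with `X ^ (n + L - 1)` in all
  -- degrees from `n` on.
  have hρ : (f * T - X ^ (n + L - 1)).degree < ((n : ℕ) : WithBot ℕ) := by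
    rw [degree_lt_iff_coeff_zero]
    intro i hi
    rw [hrefl, coeff_sub, coeff_reflect, coeff_X_pow]
    rcases Nat.lt_or_ge (n + L - 1) i with h | h
    · rw [revAt_eq_self_of_lt h, if_neg (by omega), sub_zero]
      refine coeff_eq_zero_of_natDegree_lt (lt_of_le_of_lt natDegree_mul_le ?_)
      have : (reflect n f).natDegree ≤ n := by
        rw [natDegree_le_iff_coeff_eq_zero]
        intro i hi
        rw [coeff_reflect, revAt_eq_self_of_lt hi]
        exact coeff_eq_zero_of_natDegree_lt (by omega)
      omega
    · rw [revAt_le h]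
      have h0 := X_pow_dvd_iff.1 hfg (n + L - 1 - i) (by omega)
      rw [coeff_sub, coeff_one, sub_eq_zero] at h0
      rw [← h0]
      split_ifs <;> first | omega | simp
  set Q := p /ₘ f with hQ
  set r := p %ₘ f with hr
  have hpf : r + f * Q = p := modByMonic_add_div p f
  have hrn : r.degree < (n : ℕ) := by
    have := degree_modByMonic_lt p hf
    rwa [degree_eq_natDegree hf.ne_zero, hn] at this
  have hkey : f * (X ^ (n + L - 1) * Q - p * T) =
      -(r * X ^ (n + L - 1) + p * (f * T - X ^ (n + L - 1))) := by
    linear_combination X ^ (n + L - 1) * hpf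
  -- By `hkey`, `f` times this difference has degree less than `n + (n + L - 1)`, and `f` has degree
  -- `n`. Hence the coefficients of `p * T` from `n + L - 1` on are those of the quotient.
  have hΔ : (X ^ (n + L - 1) * Q - p * T).degree < ((n + L - 1 : ℕ) : WithBot ℕ) := by
    by_contra hcon
    rw [not_lt] at hcon
    have hlt : (f * (X ^ (n + L - 1) * Q - p * T)).degree < ((n + (n + L - 1) : ℕ) : WithBot ℕ) := by
      rw [hkey, degree_neg]
      refine (degree_add_le _ _).trans_lt (max_lt ?_ ?_)
      · rw [degree_lt_iff_coeff_zero]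
        intro i hi
        rw [coeff_mul_X_pow', if_pos (by omega)]
        exact (degree_lt_iff_coeff_zero _ _).1 hrn _ (by omega)
      · refine (degree_mul_lt hp hρ).trans_le ?_
        exact_mod_cast (by omega : L + n ≤ n + (n + L - 1))
    rw [degree_mul, degree_eq_natDegree hf.ne_zero, hn] at hlt
    refine absurd hlt (not_lt.2 ?_)
    rw [Nat.cast_add]
    exact add_le_add le_rfl hcon
  ext i
  rw [coeff_polyOf]
  split_ifs with hi
  · have := (degree_lt_iff_coeff_zero _ _).1 hΔ (i + (n + L - 1)) (by omega)
    rw [coeff_sub, coeff_X_pow_mul, sub_eq_zero] at this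
    exact this
  · exact (degree_lt_iff_coeff_zero _ _).1 ((degree_divByMonic_le p f).trans_lt hp) i (by omega)

theorem coefs_reflect_subset (N : ℕ) (p : Ω → K[X]) :
    coefs (fun x => reflect N (p x)) ⊆ coefs p := by
  rintro _ ⟨i, rfl⟩
  exact ⟨revAt N i, by funext x; simp⟩

/-- A bound for the cost of a division with remainder. -/
def modCost (n Λ : ℕ) : ℕ := (40 * Nat.clog 2 (4 * n) + 41) * (n * Λ)

theorem Reach.polyModByMonic {Z Λ : ℕ} (hF : FastMul K Z Λ) (hΛ : 1 ≤ Λ) {n : ℕ} (hn : 1 ≤ n)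
    (hnZ : 4 * n ≤ Z) {S : Set (Ω → K)} {f p : Ω → K[X]} (hf : coefs f ⊆ insert 0 S)
    (hp : coefs p ⊆ insert 0 S) (hfm : ∀ x, (f x).Monic) (hfn : ∀ x, (f x).natDegree = n)
    (hpn : ∀ x, (p x).degree < (4 * n : ℕ)) :
    Reach S (1 + Nat.clog 2 (4 * n) * (10 * (4 * n * Λ)) + 36 * (n * Λ))
      (coefs fun x => p x %ₘ f x) := by
  have hfd : ∀ x, (f x).degree < (4 * n : ℕ) := fun x => by
    rw [degree_eq_natDegree (hfm x).ne_zero, hfn x]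
    exact_mod_cast (by omega)
  have hrevdeg : ∀ x, (reflect n (f x)).degree < (4 * n : ℕ) := fun x => by
    rw [degree_lt_iff_coeff_zero]
    intro i hi
    rw [coeff_reflect, revAt_eq_self_of_lt (by omega)]
    exact coeff_eq_zero_of_natDegree_lt (by rw [hfn x]; omega)
  set g : Ω → K[X] := fun x =>
    BivComp.newtonInv (4 * n) (reflect n (f x)) (Nat.clog 2 (4 * n)) with hg
  have hgd : ∀ x, (g x).degree < (4 * n : ℕ) := fun x => degree_newtonInv_lt (by omega) _ _
  set T : Ω → K[X] := fun x => reflect (4 * n - 1) (g x) with hT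
  have hTd : ∀ x, (T x).degree < (4 * n : ℕ) := fun x => by
    rw [degree_lt_iff_coeff_zero]
    intro i hi
    rw [hT, coeff_reflect, revAt_eq_self_of_lt (by omega)]
    exact (degree_lt_iff_coeff_zero _ _).1 (hgd x) i hi
  have h1 : Reach S (1 + Nat.clog 2 (4 * n) * (10 * (4 * n * Λ))) (coefs T) :=
    (((Reach.newtonInv hF hΛ (by omega) hnZ hrevdeg _).mono_left
      (coefs_reflect_subset n f)).mono_left_insert hf).mono_right' (coefs_reflect_subset _ g)
  have hQ : ∀ x, p x /ₘ f x = polyOf (4 * n) fun i => (p x * T x).coeff (i + (n + 4 * n - 1)) :=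
    fun x => divByMonic_eq_polyOf hn (by omega) (hfm x) (hfn x) (hgd x)
      (X_pow_dvd_one_sub_mul_newtonInv (by
        rw [coeff_reflect, revAt_zero, ← hfn x]
        exact hfm x) (Nat.le_pow_clog (by norm_num) _)) (hpn x)
  have h2 : Reach (S ∪ coefs T) (4 * (4 * n * Λ)) (coefs fun x => p x /ₘ f x) := by
    refine (Reach.polyMul hF (by omega) hnZ (p := p) (q := T)
      (hp.trans (Set.insert_subset_insert Set.subset_union_left))
      (Set.subset_union_right.trans (Set.subset_insert _ _)) hpn hTd).mono_right ?_
    simp only [hQ]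
    exact coefs_polyOf_subset fun i _ => Or.inr (Or.inr (mem_coefs (fun x => p x * T x) _))
  have hQd : ∀ x, (p x /ₘ f x).degree < (4 * n : ℕ) := fun x =>
    (degree_divByMonic_le _ _).trans_lt (hpn x)
  have h3 := Reach.polyMul hF (by omega) hnZ (p := f) (q := fun x => p x /ₘ f x)
    (S := S ∪ coefs T ∪ coefs fun x => p x /ₘ f x)
    (hf.trans (Set.insert_subset_insert (Set.subset_union_left.trans Set.subset_union_left)))
    (Set.subset_union_right.trans (Set.subset_insert _ _)) hfd hQd
  have h4 := Reach.polySub (p := p) (q := fun x => f x * (p x /ₘ f x)) (N := 4 * n)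
    (S := S ∪ coefs T ∪ (coefs fun x => p x /ₘ f x) ∪ coefs fun x => f x * (p x /ₘ f x))
    (hp.trans (Set.insert_subset_insert ((Set.subset_union_left.trans
      Set.subset_union_left).trans Set.subset_union_left)))
    (Set.subset_union_right.trans (Set.subset_insert _ _)) fun x => by
      rw [show f x * (p x /ₘ f x) = p x - p x %ₘ f x by
        linear_combination modByMonic_add_div (p x) (f x)]
      exact (degree_sub_le _ _).trans_lt (max_lt (hpn x)
        ((degree_modByMonic_le_left).trans_lt (hpn x)))
  simp only [← modByMonic_eq_sub_mul_div] at h4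
  refine (h1.trans (h2.trans (h3.trans h4))).mono_cost ?_
  have : n ≤ n * Λ := Nat.le_mul_of_pos_right _ hΛ
  calc _ ≤ 1 + Nat.clog 2 (4 * n) * (10 * (4 * n * Λ)) +
        (4 * (4 * n * Λ) + (4 * (4 * n * Λ) + 4 * (n * Λ))) := by gcongr
    _ = _ := by ring

/-- Reduction to a monic divisor. Dividing `1` by the leading coefficient, nonzero on all inputs, is
the only explicit division in the algorithm. -/
theorem Reach.polyMod {Z Λ : ℕ} (hF : FastMul K Z Λ) (hΛ : 1 ≤ Λ) {n : ℕ} (hn : 1 ≤ n)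
    (hnZ : 4 * n ≤ Z) {S : Set (Ω → K)} {f p : Ω → K[X]} (hf : coefs f ⊆ insert 0 S)
    (hp : coefs p ⊆ insert 0 S) (hfn : ∀ x, (f x).degree = (n : ℕ))
    (hpn : ∀ x, (p x).degree < (4 * n : ℕ)) :
    Reach S (modCost n Λ) (coefs fun x => p x % f x) := by
  have hf0 : ∀ x, f x ≠ 0 := fun x h => by
    have := hfn x
    simp [h] at this
  have hfn' : ∀ x, (f x).natDegree = n := fun x => natDegree_eq_of_degree_eq_some (hfn x)
  have h1 : Reach S 1 {fun _ => (1 : K)} := Reach.const 1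
  have h2 : Reach (S ∪ {fun _ => (1 : K)}) 1
      {(fun _ => (1 : K)) / fun x => (f x).coeff n} :=
    Reach.div (Or.inr (Or.inr rfl))
      (Set.insert_subset_insert Set.subset_union_left (hf (mem_coefs f n))) fun x => by
        have := leadingCoeff_ne_zero.2 (hf0 x)
        rwa [leadingCoeff, hfn' x] at this
  set k : Ω → K := (fun _ => (1 : K)) / fun x => (f x).coeff n with hk
  have h3 := Reach.polySmul (S := S ∪ {fun _ => (1 : K)} ∪ {k}) (k := k) (p := f) (N := n + 1)
    (Or.inr (Or.inr rfl))
    (hf.trans (Set.insert_subset_insert (Set.subset_union_left.trans Set.subset_union_left)))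
    fun x => by rw [hfn x]; exact_mod_cast Nat.lt_succ_self n
  have hmod : ∀ x, p x % f x = p x %ₘ (C (k x) * f x) := fun x => by
    rw [Polynomial.mod_def, mul_comm]
    congr 3
    simp [hk, leadingCoeff, hfn' x]
  have hmonic : ∀ x, (C (k x) * f x).Monic := fun x => by
    have := monic_mul_leadingCoeff_inv (hf0 x)
    rw [mul_comm] at this
    convert this using 3
    simp [hk, leadingCoeff, hfn' x]
  have hk0 : ∀ x, k x ≠ 0 := fun x h => by
    have := (hmonic x).ne_zero
    simp [h] at this
  have h4 := Reach.polyModByMonic hF hΛ hn hnZ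
    (S := S ∪ {fun _ => (1 : K)} ∪ {k} ∪ coefs fun x => C (k x) * f x)
    (f := fun x => C (k x) * f x) (p := p)
    (Set.subset_union_right.trans (Set.subset_insert _ _))
    (hp.trans (Set.insert_subset_insert ((Set.subset_union_left.trans
      Set.subset_union_left).trans Set.subset_union_left)))
    hmonic (fun x => by rw [natDegree_C_mul (hk0 x), hfn' x]) hpn
  simp only [← hmod] at h4
  refine (h1.trans (h2.trans (h3.trans h4))).mono_cost ?_
  have : n ≤ n * Λ := Nat.le_mul_of_pos_right _ hΛ
  rw [modCost]
  calc _ = (40 * Nat.clog 2 (4 * n) + 36) * (n * Λ) + n + 4 := by ring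
    _ ≤ (40 * Nat.clog 2 (4 * n) + 36) * (n * Λ) + 5 * (n * Λ) := by omega
    _ = _ := by ring

/-- Evaluation modulo `f` by Horner's rule. -/
theorem Reach.hornerMod {Z Λ : ℕ} (hF : FastMul K Z Λ) (hΛ : 1 ≤ Λ) {n : ℕ} (hn : 1 ≤ n)
    (hnZ : 4 * n ≤ Z) {S : Set (Ω → K)} {f b : Ω → K[X]} (hf : coefs f ⊆ insert 0 S)
    (hb : coefs b ⊆ insert 0 S) (hfn : ∀ x, (f x).degree = (n : ℕ))
    (hbn : ∀ x, (b x).degree < (n : ℕ)) (T : ℕ) {c : ℕ → Ω → K[X]}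
    (hc : ∀ k < T, coefs (c k) ⊆ insert 0 S) (hcn : ∀ k < T, ∀ x, (c k x).degree < (4 * n : ℕ)) :
    Reach S (T * (modCost n Λ + 6 * (n * Λ)))
      (coefs fun x => (∑ k ∈ Finset.range T, c k x * b x ^ k) % f x) := by
  have hf0 : ∀ x, f x ≠ 0 := fun x h => by
    have := hfn x
    simp [h] at this
  induction T generalizing c with
  | zero =>
    refine (Reach.of_subset ?_).mono_cost (Nat.zero_le _)
    simpa using coefs_zero_subset
  | succ T ih =>
    have h1 := ih (c := fun k => c (k + 1)) (fun k hk => hc _ (by omega))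
      fun k hk => hcn _ (by omega)
    set r : Ω → K[X] := fun x => (∑ k ∈ Finset.range T, c (k + 1) x * b x ^ k) % f x with hr
    have hrn : ∀ x, (r x).degree < (n : ℕ) := fun x => by
      rw [← hfn x]; exact degree_mod_lt _ (hf0 x)
    have h2 := Reach.polyMul hF hn (by omega) (p := b) (q := r) (S := S ∪ coefs r)
      (hb.trans (Set.insert_subset_insert Set.subset_union_left))
      (Set.subset_union_right.trans (Set.subset_insert _ _)) hbn hrn
    have hbr : ∀ x, (b x * r x).degree < (2 * n : ℕ) := fun x => by
      rw [two_mul]; exact degree_mul_lt (hbn x) (hrn x)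
    have h3 := Reach.polyAdd (p := c 0) (q := fun x => b x * r x) (N := 2 * n)
      (S := S ∪ coefs r ∪ coefs fun x => b x * r x)
      ((hc 0 (by omega)).trans (Set.insert_subset_insert
        (Set.subset_union_left.trans Set.subset_union_left)))
      (Set.subset_union_right.trans (Set.subset_insert _ _)) hbr
    have h4 := Reach.polyMod hF hΛ hn hnZ (f := f) (p := fun x => c 0 x + b x * r x)
      (S := S ∪ coefs r ∪ (coefs fun x => b x * r x) ∪ coefs fun x => c 0 x + b x * r x)
      (hf.trans (Set.insert_subset_insert ((Set.subset_union_left.trans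
        Set.subset_union_left).trans Set.subset_union_left)))
      (Set.subset_union_right.trans (Set.subset_insert _ _)) hfn fun x =>
        (degree_add_le _ _).trans_lt (max_lt (hcn 0 (by omega) x)
          ((hbr x).trans_le (by exact_mod_cast (by omega))))
    have hfun : (fun x => (∑ k ∈ Finset.range (T + 1), c k x * b x ^ k) % f x) =
        fun x => (c 0 x + b x * r x) % f x := by
      funext x
      refine mod_eq_of_dvd_sub ?_
      rw [Finset.sum_range_succ']
      have : ∑ k ∈ Finset.range T, c (k + 1) x * b x ^ (k + 1) =
          b x * ∑ k ∈ Finset.range T, c (k + 1) x * b x ^ k := by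
        rw [Finset.mul_sum]
        exact Finset.sum_congr rfl fun k _ => by ring
      rw [this, pow_zero, mul_one, add_comm, add_sub_add_left_eq_sub, ← mul_sub]
      refine Dvd.dvd.mul_left ?_ _
      have := EuclideanDomain.mod_add_div (∑ k ∈ Finset.range T, c (k + 1) x * b x ^ k) (f x)
      exact ⟨_, sub_eq_of_eq_add' this.symm⟩
    rw [hfun]
    refine (h1.trans (h2.trans (h3.trans h4))).mono_cost ?_
    have : n ≤ n * Λ := Nat.le_mul_of_pos_right _ hΛ
    calc _ ≤ T * (modCost n Λ + 6 * (n * Λ)) +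
          (4 * (n * Λ) + (2 * (n * Λ) + modCost n Λ)) := by gcongr
      _ = _ := by ring

end Remainder

/-! ### Modular composition for polynomials of small degree in `x` -/

section Composition

open Polynomial

variable {Ω K : Type u} [Field K]

/-- The polynomial in `y` formed by the `t`-th group of `μ` consecutive coefficients. -/
noncomputable def slice (μ : ℕ) (G : K[X][Y]) (t : ℕ) : K[X][Y] :=
  polyOf μ fun k => G.coeff (μ * t + k)

/-- The polynomial obtained by cutting the `s`-th piece of length `m` out of all coefficients. -/
noncomputable def chunk (m μ : ℕ) (A : K[X][Y]) (s : ℕ) : K[X][Y] :=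
  polyOf μ fun k => polyOf m fun i => (A.coeff k).coeff (m * s + i)

theorem BidegLT.polyOf {m μ : ℕ} {c : ℕ → K[X]} (h : ∀ k, (c k).degree < m) :
    BidegLT m μ (polyOf μ c) :=
  ⟨degree_polyOf_lt _ _, fun k => by
    rw [coeff_polyOf]
    split_ifs
    · exact h k
    · rw [degree_zero]; exact WithBot.bot_lt_coe _⟩

theorem BidegLT.slice {m d : ℕ} {G : K[X][Y]} (hG : BidegLT m d G) (μ t : ℕ) :
    BidegLT m μ (slice μ G t) := BidegLT.polyOf fun _ => hG.2 _

theorem BidegLT.chunk (m μ : ℕ) (A : K[X][Y]) (s : ℕ) : BidegLT m μ (chunk m μ A s) :=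
  BidegLT.polyOf fun _ => degree_polyOf_lt _ _

theorem bicoefs_slice_subset (μ : ℕ) (G : Ω → K[X][Y]) (t : ℕ) :
    bicoefs (fun x => slice μ (G x) t) ⊆ insert 0 (bicoefs G) := by
  refine bicoefs_subset fun k => ?_
  simp only [slice, coeff_polyOf]
  split_ifs
  · exact (coefs_coeff_subset_bicoefs G _).trans (Set.subset_insert _ _)
  · exact coefs_zero_subset

theorem bicoefs_chunk_subset (m μ : ℕ) (A : Ω → K[X][Y]) (s : ℕ) :
    bicoefs (fun x => chunk m μ (A x) s) ⊆ insert 0 (bicoefs A) := by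
  refine bicoefs_subset fun k => ?_
  simp only [chunk, coeff_polyOf]
  split_ifs
  · exact coefs_polyOf_subset fun i _ => Or.inr ⟨(_, _), rfl⟩
  · exact coefs_zero_subset

theorem sum_chunk {m μ T : ℕ} {A : K[X][Y]} (hA : BidegLT (m * T) μ A) :
    ∑ s ∈ Finset.range T, C (X ^ (m * s)) * chunk m μ A s = A := by
  ext1 k
  simp only [finsetSum_coeff, coeff_C_mul, chunk, coeff_polyOf]
  by_cases hk : k < μ
  · simp only [hk, if_true]
    rw [← polyOf_mul_eq_sum, mul_comm T m, polyOf_coeff (hA.2 k)]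
  · simp only [hk, if_false, mul_zero, Finset.sum_const_zero]
    exact ((degree_lt_iff_coeff_zero _ _).1 hA.1 k (by omega)).symm

theorem eval_eq_sum_of_degree_lt {R : Type*} [CommRing R] {N : ℕ} {p : R[X]} (hp : p.degree < N)
    (a : R) : p.eval a = ∑ k ∈ Finset.range N, p.coeff k * a ^ k := by
  conv_lhs => rw [← polyOf_coeff hp]
  simp [polyOf, eval_finsetSum]

theorem eval_eq_sum_slice {μ : ℕ} {G : K[X][Y]} (hG : G.degree < (μ ^ 3 : ℕ)) (a : K[X]) :
    G.eval a = ∑ j ∈ Finset.range μ, a ^ (j * μ ^ 2) * ∑ i ∈ Finset.range μ,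
      a ^ (i * μ) * (slice μ G (μ * j + i)).eval a := by
  conv_lhs => rw [← polyOf_coeff hG, show μ ^ 3 = μ * μ * μ by ring, polyOf_mul_eq_sum,
    sum_range_mul]
  simp only [eval_finsetSum, eval_mul, eval_pow, eval_X, Finset.mul_sum]
  refine Finset.sum_congr rfl fun j _ => Finset.sum_congr rfl fun i _ => ?_
  rw [slice]
  ring

/-- The product of the slices of `G` with the `s`-th pieces of the `A i`. -/
noncomputable def sliceProd (m μ : ℕ) (G : K[X][Y]) (A : ℕ → K[X][Y]) (j s : ℕ) : K[X][Y] :=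
  ∑ i ∈ Finset.range μ, slice μ G (μ * j + i) * chunk m μ (A i) s

theorem BidegLT.sliceProd {m d μ : ℕ} {G : K[X][Y]} (hG : BidegLT m d G) (A : ℕ → K[X][Y])
    (j s : ℕ) : BidegLT (2 * m) (2 * μ) (sliceProd m μ G A j s) := by
  rw [two_mul, two_mul]
  exact BidegLT.sum _ fun i _ => (hG.slice μ _).mul (BidegLT.chunk _ _ _ _)

theorem Reach.sliceProd {Z Λ : ℕ} (hF : FastMul K Z Λ) {m d μ W : ℕ} (hM : MatMul K μ W)
    (hW : μ ^ 2 ≤ W) (hm : 1 ≤ m) (hμ : 1 ≤ μ) (hZ : 2 * m * μ ≤ Z) {S : Set (Ω → K)}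
    {G : Ω → K[X][Y]} {A : Ω → ℕ → K[X][Y]} (hG : ∀ x, BidegLT m d (G x))
    (hGS : bicoefs G ⊆ insert 0 S) (hAS : ∀ i < μ, bicoefs (fun x => A x i) ⊆ insert 0 S)
    (b : ℕ) :
    Reach S (b * (8 * (m * μ * Λ * W)))
      (⋃ y : Fin μ × Fin (b * μ), bicoefs fun x => sliceProd m μ (G x) (A x) y.1 y.2) := by
  have hD : ∀ {p : K[X][Y]}, BidegLT m μ p → BidegLT (2 * m) μ p := fun h =>
    h.mono (by omega) le_rfl
  have hins : ∀ {T : Set (Ω → K)}, T ⊆ insert 0 S → insert 0 T ⊆ insert 0 S := fun h =>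
    Set.insert_subset (Or.inl rfl) h
  have h1 : ∀ r : Fin b, Reach S (8 * (m * μ * Λ * W)) (⋃ y : Fin μ × Fin μ,
      bicoefs fun x => BivComp.sliceProd m μ (G x) (A x) y.1 (μ * r + y.2)) := by
    intro r
    -- Products of entries have `x`-degree less than `2 * m`, so Kronecker substitution with `D = 2
    -- * m` is injective on them; the factors become polynomials of degree less than `2 * m * μ`.
    have h := Reach.polyMatMul hF hM hW (N := 2 * m * μ) (by
        have := Nat.mul_pos (Nat.mul_pos two_pos hm) hμ; omega) hZ (S := S)
      (A := fun x => Matrix.of fun j i : Fin μ => (slice μ (G x) (μ * j + i)).eval (X ^ (2 * m)))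
      (B := fun x => Matrix.of fun i s : Fin μ =>
        (chunk m μ (A x i) (μ * r + s)).eval (X ^ (2 * m)))
      (fun j i => (coefs_eval_subset fun x => (hD ((hG x).slice μ _)).2).trans
        ((bicoefs_slice_subset μ G _).trans (hins hGS)))
      (fun i s => (coefs_eval_subset (p := fun x => chunk m μ (A x i) (μ * r + s))
        fun x => (hD (BidegLT.chunk _ _ _ _)).2).trans
        ((bicoefs_chunk_subset m μ (fun x => A x i) _).trans (hins (hAS i i.2))))
      (fun x j i => (hD ((hG x).slice μ _)).degree_eval_lt)
      (fun x i s => (hD (BidegLT.chunk _ _ _ _)).degree_eval_lt)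
    refine (h.mono_cost (le_of_eq (by ring))).mono_right ?_
    refine Set.iUnion_subset fun y => ?_
    refine (bicoefs_subset_eval (D := 2 * m)
      fun x => ((hG x).sliceProd (A x) y.1 (μ * r + y.2)).2).trans ?_
    refine Set.insert_subset_insert (Set.subset_union_of_subset_right
      (Set.subset_iUnion_of_subset y (le_of_eq ?_)) _)
    congr 1
    funext x
    simp only [Matrix.mul_apply, Matrix.of_apply, BivComp.sliceProd, eval_finsetSum, eval_mul,
      Finset.sum_range]
  refine ((Reach.iUnion h1).mono_cost (by rw [Fintype.card_fin])).mono_right' ?_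
  refine Set.iUnion_subset fun y => ?_
  have hlt : (y.2 : ℕ) / μ < b := Nat.div_lt_of_lt_mul (y.2.2.trans_eq (mul_comm _ _))
  refine Set.subset_iUnion_of_subset ⟨(y.2 : ℕ) / μ, hlt⟩
    (Set.subset_iUnion_of_subset (y.1, ⟨(y.2 : ℕ) % μ, Nat.mod_lt _ hμ⟩) (le_of_eq ?_))
  simp only [Nat.div_add_mod]

/-- The sum of the products of the slices of `G` with the `A i`. -/
noncomputable def innerSum (μ : ℕ) (G : K[X][Y]) (A : ℕ → K[X][Y]) (j : ℕ) : K[X][Y] :=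
  ∑ i ∈ Finset.range μ, slice μ G (μ * j + i) * A i

theorem BidegLT.innerSum {m d μ δ : ℕ} {G : K[X][Y]} (hG : BidegLT m d G) {A : ℕ → K[X][Y]}
    (hA : ∀ i < μ, BidegLT δ μ (A i)) (j : ℕ) :
    BidegLT (m + δ) (μ + μ) (innerSum μ G A j) :=
  BidegLT.sum _ fun i hi => (hG.slice μ _).mul (hA i (Finset.mem_range.1 hi))

/-- Cutting the `A i` into pieces makes the factors equally short in `x`; the products are put
together again with shifts by `m`. -/
theorem innerSum_eq_sum {m μ T : ℕ} {G : K[X][Y]} {A : ℕ → K[X][Y]}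
    (hA : ∀ i < μ, BidegLT (m * T) μ (A i)) (j : ℕ) :
    innerSum μ G A j = ∑ s ∈ Finset.range T, C (X ^ (m * s)) * sliceProd m μ G A j s := by
  simp only [sliceProd, Finset.mul_sum]
  rw [Finset.sum_comm]
  refine Finset.sum_congr rfl fun i hi => ?_
  conv_lhs => rw [← sum_chunk (hA i (Finset.mem_range.1 hi)), Finset.mul_sum]
  refine Finset.sum_congr rfl fun s _ => by ring

theorem Reach.innerSum {Z Λ : ℕ} (hF : FastMul K Z Λ) {m d μ δ W : ℕ} (hM : MatMul K μ W)
    (hW : μ ^ 2 ≤ W) (hm : 1 ≤ m) (hμ : 1 ≤ μ) (hZ : 2 * m * μ ≤ Z) {S : Set (Ω → K)}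
    {G : Ω → K[X][Y]} {A : Ω → ℕ → K[X][Y]} (hG : ∀ x, BidegLT m d (G x))
    (hA : ∀ x, ∀ i < μ, BidegLT δ μ (A x i))
    (hGS : bicoefs G ⊆ insert 0 S) (hAS : ∀ i < μ, bicoefs (fun x => A x i) ⊆ insert 0 S) :
    Reach S ((δ + m * μ) * (8 * (Λ * W) + 4 * W))
      (⋃ j : Fin μ, bicoefs fun x => innerSum μ (G x) (A x) j) := by
  -- With `b * μ` pieces of length `m` the `A i` are covered, and they form `b` square blocks.
  -- Rounding up accounts for the term `m * μ` of the cost even when `δ` is small.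
  obtain ⟨b, hb1, hb2⟩ : ∃ b, m * μ * b ≤ δ + m * μ ∧ δ ≤ m * (b * μ) := by
    have := Nat.div_add_mod δ (m * μ)
    have hlt := Nat.mod_lt δ (Nat.mul_pos hm hμ)
    refine ⟨δ / (m * μ) + 1, by rw [mul_add]; omega, ?_⟩
    calc δ ≤ m * μ * (δ / (m * μ) + 1) := by rw [mul_add]; omega
      _ = _ := by ring
  have h1 := Reach.sliceProd hF hM hW hm hμ hZ hG hGS hAS b
  set T := ⋃ y : Fin μ × Fin (b * μ), bicoefs fun x =>
    BivComp.sliceProd m μ (G x) (A x) y.1 y.2 with hT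
  have hsub : ∀ (j : Fin μ) (s : ℕ) (_ : s < b * μ),
      bicoefs (fun x => BivComp.sliceProd m μ (G x) (A x) j s) ⊆ T := fun j s hs =>
    Set.subset_iUnion_of_subset (j, ⟨s, hs⟩) le_rfl
  have h2 : Reach T (Fintype.card (Fin μ × Fin (2 * μ)) * (b * μ * (2 * m)))
      (⋃ y : Fin μ × Fin (2 * μ), coefs fun x => (BivComp.innerSum μ (G x) (A x) y.1).coeff y.2) := by
    refine Reach.iUnion fun y => ?_
    have := Reach.polySumShift (S := T) (N := 2 * m) (fun s => m * s) (b * μ)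
      (P := fun s x => (BivComp.sliceProd m μ (G x) (A x) y.1 s).coeff y.2)
      (fun s hs => ((coefs_coeff_subset_bicoefs (fun x =>
        BivComp.sliceProd m μ (G x) (A x) y.1 s) y.2).trans (hsub y.1 s hs)).trans
          (Set.subset_insert _ _))
      (fun s _ x => ((hG x).sliceProd (A x) y.1 s).2 _)
    convert this using 2
    funext x
    rw [innerSum_eq_sum (m := m) (T := b * μ) fun i hi => (hA x i hi).mono hb2 le_rfl]
    simp only [finsetSum_coeff, coeff_C_mul]
  refine ((h1.comp h2).mono_cost ?_).mono_right ?_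
  · rw [Fintype.card_prod, Fintype.card_fin, Fintype.card_fin]
    calc _ = m * μ * b * (8 * (Λ * W) + 4 * μ ^ 2) := by ring
      _ ≤ (δ + m * μ) * (8 * (Λ * W) + 4 * W) := by gcongr
  · refine Set.iUnion_subset fun j => bicoefs_subset fun k => ?_
    by_cases hk : k < 2 * μ
    · exact (Set.subset_union_of_subset_right (Set.subset_iUnion
        (fun y : Fin μ × Fin (2 * μ) => coefs fun x =>
          (BivComp.innerSum μ (G x) (A x) y.1).coeff y.2) (j, ⟨k, hk⟩)) _).trans
        (Set.subset_insert _ _)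
    · rintro _ ⟨i, rfl⟩
      refine Or.inl ?_
      funext x
      have := (degree_lt_iff_coeff_zero _ _).1 ((hG x).innerSum (hA x) j).1 k (by omega)
      simp [this]

/-- A polynomial `H` of small degree in `y` such that `H(x, a) = G(x, a)` modulo `f`. -/
noncomputable def outerSum (μ : ℕ) (G : K[X][Y]) (A B : ℕ → K[X][Y]) : K[X][Y] :=
  ∑ j ∈ Finset.range μ, B j * innerSum μ G A j

theorem BidegLT.outerSum {m d μ δ : ℕ} {G : K[X][Y]} (hG : BidegLT m d G) {A B : ℕ → K[X][Y]}
    (hA : ∀ i < μ, BidegLT δ μ (A i)) (hB : ∀ i < μ, BidegLT δ μ (B i)) :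
    BidegLT (2 * δ + m) (3 * μ) (outerSum μ G A B) :=
  BidegLT.sum _ fun j hj => ((hB j (Finset.mem_range.1 hj)).mul (hG.innerSum hA j)).mono
    (by omega) (by omega)

theorem dvd_eval_outerSum_sub {μ : ℕ} {f a : K[X]} {G : K[X][Y]} {A B : ℕ → K[X][Y]}
    (hG : G.degree < (μ ^ 3 : ℕ)) (hA : ∀ i < μ, f ∣ (A i).eval a - a ^ (i * μ))
    (hB : ∀ i < μ, f ∣ (B i).eval a - a ^ (i * μ ^ 2)) :
    f ∣ (outerSum μ G A B).eval a - G.eval a := by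
  rw [eval_eq_sum_slice hG]
  simp only [outerSum, eval_finsetSum, eval_mul, innerSum]
  rw [← Finset.sum_sub_distrib]
  refine Finset.dvd_sum fun j hj => ?_
  have hinner : f ∣ ∑ i ∈ Finset.range μ, (slice μ G (μ * j + i)).eval a * (A i).eval a -
      ∑ i ∈ Finset.range μ, a ^ (i * μ) * (slice μ G (μ * j + i)).eval a := by
    rw [← Finset.sum_sub_distrib]
    refine Finset.dvd_sum fun i hi => ?_
    obtain ⟨c, hc⟩ := hA i (Finset.mem_range.1 hi)
    exact ⟨c * (slice μ G (μ * j + i)).eval a, by linear_combination (slice μ G (μ * j + i)).eval a * hc⟩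
  obtain ⟨c, hc⟩ := hinner
  obtain ⟨e, he⟩ := hB j (Finset.mem_range.1 hj)
  exact ⟨e * (∑ i ∈ Finset.range μ, (slice μ G (μ * j + i)).eval a * (A i).eval a) +
    a ^ (j * μ ^ 2) * c, by
      linear_combination (∑ i ∈ Finset.range μ, (slice μ G (μ * j + i)).eval a * (A i).eval a) * he
        + a ^ (j * μ ^ 2) * hc⟩

/-- After the matrix product, only `μ` products of bidegree `O(δ + m)` by `O(μ)` remain. They cost
about `μ ^ 2 * (δ + m)`, which is absorbed by `μ ^ 2 ≤ W`. -/
theorem Reach.outerSum {Z Λ : ℕ} (hF : FastMul K Z Λ) (hΛ : 1 ≤ Λ) {m d μ δ W : ℕ}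
    (hM : MatMul K μ W) (hW : μ ^ 2 ≤ W) (hm : 1 ≤ m) (hμ : 1 ≤ μ)
    (hZ : 2 * (2 * δ + m) * μ ≤ Z) {S : Set (Ω → K)}
    {G : Ω → K[X][Y]} {A B : Ω → ℕ → K[X][Y]} (hG : ∀ x, BidegLT m d (G x))
    (hA : ∀ x, ∀ i < μ, BidegLT δ μ (A x i)) (hB : ∀ x, ∀ i < μ, BidegLT δ μ (B x i))
    (hGS : bicoefs G ⊆ insert 0 S) (hAS : ∀ i < μ, bicoefs (fun x => A x i) ⊆ insert 0 S)
    (hBS : ∀ i < μ, bicoefs (fun x => B x i) ⊆ insert 0 S) :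
    Reach S (34 * (Λ * W * (δ + m * μ))) (bicoefs fun x => outerSum μ (G x) (A x) (B x)) := by
  set D := 2 * δ + m with hD
  have h1 := Reach.innerSum hF hM hW hm hμ (hZ.trans' (by gcongr; omega)) hG hA hGS hAS
  set T := ⋃ j : Fin μ, bicoefs fun x => BivComp.innerSum μ (G x) (A x) j with hT
  have hB' : ∀ x, ∀ i < μ, BidegLT D μ (B x i) := fun x i hi =>
    (hB x i hi).mono (by omega) le_rfl
  have hI' : ∀ x, ∀ i, BidegLT D (2 * μ) (BivComp.innerSum μ (G x) (A x) i) := fun x i =>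
    ((hG x).innerSum (hA x) i).mono (by omega) (by omega)
  have hBI : ∀ x, ∀ i < μ, BidegLT D (3 * μ) (B x i * BivComp.innerSum μ (G x) (A x) i) :=
    fun x i hi => ((hB x i hi).mul ((hG x).innerSum (hA x) i)).mono (by omega) (by omega)
  have h2 : Reach (S ∪ T) (Fintype.card (Fin μ) * (4 * (2 * D * μ * Λ)))
      (⋃ j : Fin μ, coefs fun x =>
        (B x j * BivComp.innerSum μ (G x) (A x) j).eval (X ^ D)) := by
    refine Reach.iUnion fun j => ?_
    have := Reach.polyMul hF (N := 2 * D * μ) (by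
        have := Nat.mul_pos (Nat.mul_pos two_pos (show 0 < D by omega)) hμ; omega) hZ
      (p := fun x => (B x j).eval (X ^ D))
      (q := fun x => (BivComp.innerSum μ (G x) (A x) j).eval (X ^ D)) (S := S ∪ T)
      ((coefs_eval_subset fun x => (hB' x j j.2).2).trans
        ((hBS j j.2).trans (Set.insert_subset_insert Set.subset_union_left)))
      ((coefs_eval_subset fun x => (hI' x j).2).trans
        ((Set.subset_iUnion (fun j : Fin μ => bicoefs fun x =>
          BivComp.innerSum μ (G x) (A x) j) j).trans
          (Set.subset_union_right.trans (Set.subset_insert _ _))))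
      (fun x => (hB' x j j.2).degree_eval_lt.trans_le (by
        have : D * μ ≤ 2 * D * μ := by gcongr; omega
        exact_mod_cast this))
      (fun x => (hI' x j).degree_eval_lt.trans_le (by
        have : D * (2 * μ) ≤ 2 * D * μ := le_of_eq (by ring)
        exact_mod_cast this))
    simpa only [eval_mul] using this
  set U := ⋃ j : Fin μ, coefs fun x =>
    (B x j * BivComp.innerSum μ (G x) (A x) j).eval (X ^ D) with hU
  have h3 : Reach U (μ * (D * (3 * μ)))
      (coefs fun x => (BivComp.outerSum μ (G x) (A x) (B x)).eval (X ^ D)) := by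
    have := Reach.polySum (S := U) (N := D * (3 * μ)) μ
      (P := fun j x => (B x j * BivComp.innerSum μ (G x) (A x) j).eval (X ^ D))
      (fun j hj => (Set.subset_iUnion_of_subset (s := coefs fun x =>
        (B x j * BivComp.innerSum μ (G x) (A x) j).eval (X ^ D)) ⟨j, hj⟩ le_rfl).trans
          (Set.subset_insert _ _))
      (fun j hj x => (hBI x j hj).degree_eval_lt)
    simpa only [BivComp.outerSum, eval_finsetSum] using this
  refine ((h1.trans (h2.comp h3)).mono_cost ?_).mono_right
    ((bicoefs_subset_eval (D := D) fun x => ((hG x).outerSum (hA x) (hB x)).2).trans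
      (Set.insert_subset_insert Set.subset_union_right))
  have hWΛ : W ≤ Λ * W := Nat.le_mul_of_pos_left _ hΛ
  have hDle : D ≤ 2 * (δ + m * μ) := by
    have : m ≤ m * μ := Nat.le_mul_of_pos_right _ hμ
    omega
  rw [Fintype.card_fin]
  calc _ = (δ + m * μ) * (8 * (Λ * W) + 4 * W) + (8 * D * (Λ * μ ^ 2) + 3 * D * μ ^ 2) := by ring
    _ ≤ (δ + m * μ) * (8 * (Λ * W) + 4 * (Λ * W)) +
        (8 * (2 * (δ + m * μ)) * (Λ * W) + 3 * (2 * (δ + m * μ)) * (Λ * W)) := by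
      gcongr
      exact hW.trans hWΛ
    _ = _ := by ring

/-- The number of operations is at most `compCost` times `W * (δ + m * μ)`. -/
def compCost (n Λ : ℕ) : ℕ := (120 * Nat.clog 2 (4 * n) + 175) * Λ

theorem Reach.composition {Z Λ : ℕ} (hF : FastMul K Z Λ) (hΛ : 1 ≤ Λ) {n m d μ δ W : ℕ}
    (hM : MatMul K μ W) (hW : μ ^ 2 ≤ W) (hm : 1 ≤ m) (hμ : 1 ≤ μ) (hn : 1 ≤ n) (hmn : m ≤ n)
    (hδn : δ ≤ n) (hnδ : n ≤ μ * δ) (hd : d ≤ μ ^ 3)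
    (hZ : 2 * (2 * δ + m) * μ ≤ Z) (hnZ : 4 * n ≤ Z) {S : Set (Ω → K)}
    {f a : Ω → K[X]} {G : Ω → K[X][Y]} {A B : Ω → ℕ → K[X][Y]}
    (hf : ∀ x, (f x).degree = (n : ℕ)) (ha : ∀ x, (a x).degree < (n : ℕ))
    (hG : ∀ x, BidegLT m d (G x))
    (hA : ∀ x, ∀ i < μ, BidegLT δ μ (A x i)) (hB : ∀ x, ∀ i < μ, BidegLT δ μ (B x i))
    (hAf : ∀ x, ∀ i < μ, f x ∣ (A x i).eval (a x) - a x ^ (i * μ))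
    (hBf : ∀ x, ∀ i < μ, f x ∣ (B x i).eval (a x) - a x ^ (i * μ ^ 2))
    (hfS : coefs f ⊆ insert 0 S) (haS : coefs a ⊆ insert 0 S)
    (hGS : bicoefs G ⊆ insert 0 S) (hAS : ∀ i < μ, bicoefs (fun x => A x i) ⊆ insert 0 S)
    (hBS : ∀ i < μ, bicoefs (fun x => B x i) ⊆ insert 0 S) :
    Reach S (compCost n Λ * (W * (δ + m * μ))) (coefs fun x => (G x).eval (a x) % f x) := by
  have h1 := Reach.outerSum hF hΛ hM hW hm hμ hZ hG hA hB hGS hAS hBS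
  set H : Ω → K[X][Y] := fun x => BivComp.outerSum μ (G x) (A x) (B x) with hH
  have hHd : ∀ x, BidegLT (2 * δ + m) (3 * μ) (H x) := fun x => (hG x).outerSum (hA x) (hB x)
  have h2 := Reach.hornerMod hF hΛ hn hnZ (S := S ∪ bicoefs H) (f := f) (b := a)
    (hfS.trans (Set.insert_subset_insert Set.subset_union_left))
    (haS.trans (Set.insert_subset_insert Set.subset_union_left)) hf ha (3 * μ)
    (c := fun k x => (H x).coeff k)
    (fun k _ => (coefs_coeff_subset_bicoefs H k).trans
      (Set.subset_union_right.trans (Set.subset_insert _ _)))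
    fun k _ x => ((hHd x).2 k).trans_le (by exact_mod_cast (by omega : 2 * δ + m ≤ 4 * n))
  have hfun : (fun x => (∑ k ∈ Finset.range (3 * μ), (H x).coeff k * a x ^ k) % f x) =
      fun x => (G x).eval (a x) % f x := by
    funext x
    rw [← eval_eq_sum_of_degree_lt (hHd x).1]
    exact mod_eq_of_dvd_sub (dvd_eval_outerSum_sub
      ((hG x).1.trans_le (by exact_mod_cast hd)) (hAf x) (hBf x))
  rw [hfun] at h2
  refine (h1.trans h2).mono_cost ?_
  -- Horner's rule with `3 * μ` steps modulo `f` fits into the bound because `n ≤ μ * δ`.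
  have hμn : μ * n ≤ W * (δ + m * μ) :=
    calc μ * n ≤ μ * (μ * δ) := by gcongr
      _ = μ ^ 2 * δ := by ring
      _ ≤ W * (δ + m * μ) := by gcongr; omega
  rw [modCost, compCost]
  calc _ = 34 * Λ * (W * (δ + m * μ)) + (120 * Nat.clog 2 (4 * n) + 141) * Λ * (μ * n) := by ring
    _ ≤ 34 * Λ * (W * (δ + m * μ)) +
        (120 * Nat.clog 2 (4 * n) + 141) * Λ * (W * (δ + m * μ)) := by gcongr
    _ = _ := by ring

end Composition

/-! ### The degree of a minimal basis -/

section Degree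

open Polynomial

variable {K : Type u} [Field K]

theorem coeff_colPoly {μ : ℕ} (R : Matrix (Fin μ) (Fin μ) K[X]) (i j : Fin μ) :
    (colPoly R j).coeff i = R i j := by
  simp [colPoly, coeff_monomial, Fin.val_inj]

/-- The triangular basis `f, y - a, y ^ 2 - a ^ 2, …` of the module of relations. -/
noncomputable def triangularBasis (f a : K[X]) (μ : ℕ) : Matrix (Fin μ) (Fin μ) K[X] :=
  Matrix.of fun i j => if (j : ℕ) = 0 then (if (i : ℕ) = 0 then f else 0)
    else if (i : ℕ) = 0 then -a ^ (j : ℕ) else if i = j then 1 else 0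

theorem det_triangularBasis (f a : K[X]) {μ : ℕ} (hμ : 1 ≤ μ) :
    (triangularBasis f a μ).det = f := by
  rw [Matrix.det_of_isUpperTriangular]
  · obtain ⟨k, rfl⟩ : ∃ k, μ = k + 1 := ⟨μ - 1, by omega⟩
    rw [Fin.prod_univ_succ]
    simp [triangularBasis]
  · intro i j hij
    have hij : (j : ℕ) < i := hij
    have h1 : (i : ℕ) ≠ 0 := by omega
    have h2 : i ≠ j := fun h => by simp [h] at hij
    simp [triangularBasis, h1, h2]

theorem sum_fin_of_pos {M : Type*} [AddCommMonoid M] {μ : ℕ} (hμ : 1 ≤ μ) (g : Fin μ → M) :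
    ∑ i, g i = g ⟨0, hμ⟩ + ∑ i : Fin μ, if (i : ℕ) = 0 then 0 else g i := by
  obtain ⟨k, rfl⟩ : ∃ k, μ = k + 1 := ⟨μ - 1, by omega⟩
  simp [Fin.sum_univ_succ]

/-- Relations are combinations of `f` and the `y ^ k - a ^ k`: the coefficient of `f` is `p(x, a) /
f`, the others are those of `p`. So `R` factors through the triangular basis, whose determinant is
`f`. -/
theorem dvd_det_of_relModule {f a : K[X]} {μ : ℕ} (hμ : 1 ≤ μ)
    {R : Matrix (Fin μ) (Fin μ) K[X]} (hR : ∀ j, colPoly R j ∈ relModule f a μ) :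
    f ∣ R.det := by
  choose u hu using fun j => (hR j).2
  have hmul : R = triangularBasis f a μ *
      Matrix.of fun i j : Fin μ => if (i : ℕ) = 0 then u j else R i j := by
    ext1 i j
    have heval : ∑ k, R k j * a ^ (k : ℕ) = f * u j := by
      rw [← hu j]
      simp [colPoly, eval_finsetSum]
    rw [Matrix.mul_apply]
    by_cases hi : (i : ℕ) = 0
    · obtain rfl : i = ⟨0, hμ⟩ := Fin.ext hi
      rw [sum_fin_of_pos hμ] at heval ⊢
      simp only [pow_zero, mul_one] at heval
      have : (∑ k : Fin μ, if (k : ℕ) = 0 then 0 else triangularBasis f a μ ⟨0, hμ⟩ k *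
          (Matrix.of fun i j : Fin μ => if (i : ℕ) = 0 then u j else R i j) k j) =
          -∑ k : Fin μ, if (k : ℕ) = 0 then 0 else R k j * a ^ (k : ℕ) := by
        rw [← Finset.sum_neg_distrib]
        refine Finset.sum_congr rfl fun k _ => ?_
        by_cases hk : (k : ℕ) = 0
        · simp [hk]
        · simp [hk, triangularBasis, mul_comm]
      rw [this]
      simp only [triangularBasis, Matrix.of_apply, if_true]
      linear_combination heval
    · rw [Finset.sum_eq_single i]
      · simp [triangularBasis, hi]
      · intro k _ hk
        simp [triangularBasis, hi, hk.symm]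
      · simp
  rw [hmul, Matrix.det_mul, det_triangularBasis f a hμ]
  exact dvd_mul_right _ _

/-- Conversely, the columns of the triangular basis are relations, hence combinations of the columns
of `R`. -/
theorem det_dvd_of_span {f a : K[X]} {μ : ℕ} (hμ : 1 ≤ μ)
    {R : Matrix (Fin μ) (Fin μ) K[X]}
    (hR : Submodule.span K[X] (Set.range (colPoly R)) = relModule f a μ) : R.det ∣ f := by
  have hmem : ∀ j, colPoly (triangularBasis f a μ) j ∈ relModule f a μ := by
    intro j
    refine ⟨?_, ?_⟩
    · rw [colPoly]
      refine (degree_sum_le _ _).trans_lt ((Finset.sup_lt_iff (WithBot.bot_lt_coe _)).2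
        fun i _ => (degree_monomial_le _ _).trans_lt (by exact_mod_cast i.2))
    · rw [colPoly, eval_finsetSum, sum_fin_of_pos hμ]
      by_cases hj : (j : ℕ) = 0
      · rw [Finset.sum_eq_zero]
        · simp [triangularBasis, hj]
        · intro i _
          by_cases hi : (i : ℕ) = 0 <;> simp [triangularBasis, hi, hj]
      · rw [Finset.sum_eq_single j]
        · simp [triangularBasis, hj]
        · intro i _ hi
          by_cases hi' : (i : ℕ) = 0 <;> simp [triangularBasis, hi, hi', hj]
        · simp
  have hex : ∀ j, ∃ c : Fin μ → K[X], ∑ i, c i • colPoly R i =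
      colPoly (triangularBasis f a μ) j := fun j => by
    have := hmem j
    rw [← hR] at this
    exact (Submodule.mem_span_range_iff_exists_fun K[X]).1 this
  choose c hc using hex
  have hmul : triangularBasis f a μ = R * Matrix.of fun i j => c j i := by
    ext1 i j
    rw [← coeff_colPoly (triangularBasis f a μ) i j, ← hc j, Matrix.mul_apply, finsetSum_coeff]
    refine Finset.sum_congr rfl fun k _ => ?_
    rw [coeff_smul, coeff_colPoly, smul_eq_mul, mul_comm]
    rfl
  have := congrArg Matrix.det hmul
  rw [det_triangularBasis f a hμ, Matrix.det_mul] at this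
  exact ⟨_, this⟩

/-- The determinant of `R` and `f` divide each other, so they have equal degrees; column reducedness
turns the degree of the determinant into the sum of the column degrees. -/
theorem IsMinimalBasis.sum_colDegree {f a : K[X]} {μ n : ℕ} (hμ : 1 ≤ μ) (hf : f.degree = n)
    {R : Matrix (Fin μ) (Fin μ) K[X]} (hR : IsMinimalBasis f a R) : ∑ j, colDegree R j = n := by
  obtain ⟨-, hspan, -, hdet⟩ := hR
  have hf0 : f ≠ 0 := fun h => by simp [h] at hf
  have hR0 : R.det ≠ 0 := fun h => by
    rw [h, degree_zero] at hdet
    exact WithBot.bot_ne_coe hdet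
  have h1 := degree_le_of_dvd (det_dvd_of_span hμ hspan) hf0
  have h2 := degree_le_of_dvd (dvd_det_of_relModule hμ fun j => by
    rw [← hspan]; exact Submodule.subset_span ⟨j, rfl⟩) hR0
  have := le_antisymm h1 h2
  rw [hdet, hf] at this
  exact_mod_cast this

theorem IsMinimalBasis.matDegree_bounds {f a : K[X]} {μ n : ℕ} (hμ : 1 ≤ μ) (hf : f.degree = n)
    {R : Matrix (Fin μ) (Fin μ) K[X]} (hR : IsMinimalBasis f a R) :
    matDegree R ≤ n ∧ n ≤ μ * matDegree R := by
  have h := hR.sum_colDegree hμ hf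
  constructor
  · refine Finset.sup_le fun j _ => ?_
    rw [← h]
    exact Finset.single_le_sum (fun i _ => Nat.zero_le (colDegree R i)) (Finset.mem_univ j)
  · rw [← h]
    have := Finset.sum_le_card_nsmul Finset.univ (fun j => colDegree R j) (matDegree R)
      fun j _ => Finset.le_sup (f := fun j => colDegree R j) (Finset.mem_univ j)
    simpa using this

end Degree

/-! ### Modular composition in general -/

section General

open Polynomial

variable {Ω K : Type u} [Field K]

theorem one_le_compCost {n Λ : ℕ} (hΛ : 1 ≤ Λ) : 1 ≤ compCost n Λ :=
  Nat.mul_pos (by omega) hΛ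

/-- Cut along `x` into `T ≤ 2 * m / n` pieces of length `n`, compose each of them, and combine the
results by Horner's rule in `X ^ n % f`. A piece costs about `W * (δ + n * μ) ≤ 2 * W * n * μ`, so
the total is of order `W * m * μ`. -/
theorem Reach.composition_of_lt {Z Λ : ℕ} (hF : FastMul K Z Λ) (hΛ : 1 ≤ Λ) {n m d μ δ W : ℕ}
    (hM : MatMul K μ W) (hW : μ ^ 2 ≤ W) (hμ : 1 ≤ μ) (hn : 1 ≤ n) (hnm : n < m)
    (hδn : δ ≤ n) (hnδ : n ≤ μ * δ) (hd : d ≤ μ ^ 3)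
    (hZ : 2 * (2 * δ + n) * μ ≤ Z) (hnZ : 4 * n ≤ Z) {S : Set (Ω → K)}
    {f a : Ω → K[X]} {G : Ω → K[X][Y]} {A B : Ω → ℕ → K[X][Y]}
    (hf : ∀ x, (f x).degree = (n : ℕ)) (ha : ∀ x, (a x).degree < (n : ℕ))
    (hG : ∀ x, BidegLT m d (G x))
    (hA : ∀ x, ∀ i < μ, BidegLT δ μ (A x i)) (hB : ∀ x, ∀ i < μ, BidegLT δ μ (B x i))
    (hAf : ∀ x, ∀ i < μ, f x ∣ (A x i).eval (a x) - a x ^ (i * μ))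
    (hBf : ∀ x, ∀ i < μ, f x ∣ (B x i).eval (a x) - a x ^ (i * μ ^ 2))
    (hfS : coefs f ⊆ insert 0 S) (haS : coefs a ⊆ insert 0 S)
    (hGS : bicoefs G ⊆ insert 0 S) (hAS : ∀ i < μ, bicoefs (fun x => A x i) ⊆ insert 0 S)
    (hBS : ∀ i < μ, bicoefs (fun x => B x i) ⊆ insert 0 S) :
    Reach S (5 * compCost n Λ * (W * (δ + m * μ)))
      (coefs fun x => (G x).eval (a x) % f x) := by
  obtain ⟨T, hT1, hT2⟩ : ∃ T, n * T ≤ 2 * m ∧ m ≤ n * T := by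
    have := Nat.div_add_mod m n
    have hlt := Nat.mod_lt m hn
    exact ⟨m / n + 1, by rw [mul_add]; omega, by rw [mul_add]; omega⟩
  have hf0 : ∀ x, f x ≠ 0 := fun x h => by
    have := hf x
    simp [h] at this
  have h1 := Reach.iUnion fun s : Fin T =>
    Reach.composition hF hΛ hM hW hn hμ hn le_rfl hδn hnδ hd hZ hnZ
      (G := fun x => chunk n d (G x) s) hf ha (fun x => BidegLT.chunk _ _ _ _) hA hB hAf hBf hfS haS
      ((bicoefs_chunk_subset n d G s).trans (Set.insert_subset (Or.inl rfl) hGS)) hAS hBS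
  set U := ⋃ s : Fin T, coefs fun x => (chunk n d (G x) s).eval (a x) % f x with hU
  set b : Ω → K[X] := fun x => X ^ n % f x with hb
  have h2 : Reach (S ∪ U) (1 + modCost n Λ) (coefs b) := by
    refine (Reach.const (1 : K)).trans (Reach.polyMod hF hΛ hn hnZ (f := f) (p := fun _ => X ^ n)
      (hfS.trans (Set.insert_subset_insert (Set.subset_union_left.trans Set.subset_union_left)))
      ?_ hf fun x => ?_)
    · rw [coefs_subset]
      intro i
      simp only [coeff_X_pow]
      split_ifs
      · exact Or.inr (Or.inr rfl)
      · exact Or.inl rfl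
    · rw [degree_X_pow]
      exact_mod_cast (by omega : n < 4 * n)
  have h3 := Reach.hornerMod hF hΛ hn hnZ (S := S ∪ U ∪ coefs b) (f := f) (b := b)
    (hfS.trans (Set.insert_subset_insert (Set.subset_union_left.trans Set.subset_union_left)))
    (Set.subset_union_right.trans (Set.subset_insert _ _)) hf
    (fun x => by rw [← hf x]; exact degree_mod_lt _ (hf0 x)) T
    (c := fun s x => (chunk n d (G x) s).eval (a x) % f x)
    (fun s hs => ((Set.subset_iUnion (fun s : Fin T => coefs fun x =>
      (chunk n d (G x) s).eval (a x) % f x) ⟨s, hs⟩).trans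
        (Set.subset_union_right.trans Set.subset_union_left)).trans (Set.subset_insert _ _))
    fun s _ x => by
      refine (degree_mod_lt _ (hf0 x)).trans_le ?_
      rw [hf x]
      exact_mod_cast (by omega : n ≤ 4 * n)
  have hfun : (fun x => (∑ s ∈ Finset.range T, (chunk n d (G x) s).eval (a x) % f x * b x ^ s) %
      f x) = fun x => (G x).eval (a x) % f x := by
    funext x
    refine mod_eq_of_dvd_sub ?_
    have heval := congrArg (eval (a x)) (sum_chunk ((hG x).mono hT2 le_rfl))
    rw [← heval, eval_finsetSum, ← Finset.sum_sub_distrib]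
    refine Finset.dvd_sum fun s _ => ?_
    rw [eval_mul, eval_C, pow_mul]
    have h1 : f x ∣ (chunk n d (G x) s).eval (a x) % f x - (chunk n d (G x) s).eval (a x) :=
      (EuclideanDomain.mod_eq_sub_mul_div ((chunk n d (G x) s).eval (a x)) (f x)) ▸
        ⟨-((chunk n d (G x) s).eval (a x) / f x), by ring⟩
    have h2 : f x ∣ b x ^ s - (X ^ n) ^ s := by
      refine dvd_trans ?_ (sub_dvd_pow_sub_pow (b x) (X ^ n) s)
      change f x ∣ X ^ n % f x - X ^ n
      rw [EuclideanDomain.mod_eq_sub_mul_div]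
      exact ⟨-(X ^ n / f x), by ring⟩
    obtain ⟨c1, hc1⟩ := h1
    obtain ⟨c2, hc2⟩ := h2
    exact ⟨c1 * b x ^ s + (chunk n d (G x) s).eval (a x) * c2, by
      linear_combination b x ^ s * hc1 + (chunk n d (G x) s).eval (a x) * hc2⟩
  rw [hfun] at h3
  refine (h1.trans (h2.trans h3)).mono_cost ?_
  rw [Fintype.card_fin]
  have hW1 : 1 ≤ W := (Nat.one_le_pow 2 μ hμ).trans hW
  have hmW : m ≤ W * (δ + m * μ) :=
    calc m = 1 * (m * 1) := by ring
      _ ≤ W * (δ + m * μ) := by gcongr; exact (Nat.mul_le_mul_left m hμ).trans (Nat.le_add_left _ _)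
  have hc1 : T * (compCost n Λ * (W * (δ + n * μ))) ≤
      4 * (compCost n Λ * (W * (δ + m * μ))) :=
    calc T * (compCost n Λ * (W * (δ + n * μ)))
        ≤ T * (compCost n Λ * (W * (n * μ + n * μ))) := by
          gcongr
          exact hδn.trans (Nat.le_mul_of_pos_right _ hμ)
      _ = 2 * (compCost n Λ * (W * (n * T * μ))) := by ring
      _ ≤ 2 * (compCost n Λ * (W * (2 * m * μ))) := by gcongr
      _ = 4 * (compCost n Λ * (W * (m * μ))) := by ring
      _ ≤ 4 * (compCost n Λ * (W * (δ + m * μ))) := by gcongr; omega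
  have hmΛ : m ≤ m * Λ := Nat.le_mul_of_pos_right _ hΛ
  have hc2 : 1 + modCost n Λ + T * (modCost n Λ + 6 * (n * Λ)) ≤
      compCost n Λ * (W * (δ + m * μ)) :=
    calc _ = 1 + (40 * Nat.clog 2 (4 * n) + 41) * (n * Λ) +
          (40 * Nat.clog 2 (4 * n) + 47) * (n * T * Λ) := by rw [modCost]; ring
      _ ≤ m * Λ + (40 * Nat.clog 2 (4 * n) + 41) * (m * Λ) +
          (40 * Nat.clog 2 (4 * n) + 47) * (2 * m * Λ) := by
          gcongr
          omega
      _ = (120 * Nat.clog 2 (4 * n) + 136) * Λ * m := by ring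
      _ ≤ (120 * Nat.clog 2 (4 * n) + 175) * Λ * (W * (δ + m * μ)) := by gcongr; omega
      _ = _ := rfl
  calc _ ≤ 4 * (compCost n Λ * (W * (δ + m * μ))) + compCost n Λ * (W * (δ + m * μ)) := by
        rw [← add_assoc] at *; rw [add_assoc (T * _)]
        exact add_le_add hc1 hc2
    _ = _ := by ring

end General

/-! ### The straight-line program and its cost -/

section Program

open Polynomial

variable {K : Type u} [Field K]

theorem coefs_subset_of_degree_lt {Ω : Type u} {p : Ω → K[X]} {N : ℕ} {S : Set (Ω → K)}
    (hp : ∀ x, (p x).degree < N) (h : ∀ i < N, (fun x => (p x).coeff i) ∈ S) :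
    coefs p ⊆ insert 0 S := by
  rw [coefs_subset]
  intro i
  by_cases hi : i < N
  · exact Or.inr (h i hi)
  · refine Or.inl (funext fun x => coeff_eq_zero_of_degree_lt ((hp x).trans_le ?_))
    exact_mod_cast not_lt.1 hi

theorem bicoefs_subset_of_bidegLT {Ω : Type u} {p : Ω → K[X][Y]} {M N : ℕ} {S : Set (Ω → K)}
    (hp : ∀ x, BidegLT M N (p x))
    (h : ∀ i < M, ∀ k < N, (fun x => ((p x).coeff k).coeff i) ∈ S) :
    bicoefs p ⊆ insert 0 S := by
  refine bicoefs_subset fun k => ?_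
  by_cases hk : k < N
  · exact coefs_subset_of_degree_lt (fun x => (hp x).2 k) fun i hi => h i hi k hk
  · rw [coefs_subset]
    refine fun i => Or.inl (funext fun x => ?_)
    have : (p x).coeff k = 0 := coeff_eq_zero_of_degree_lt ((hp x).1.trans_le (by
      exact_mod_cast not_lt.1 hk))
    simp [this]

/-- The computation runs over the set `Ω` of admissible inputs, so that the degree of `f` and the
congruences hold on all of it. The bound `6 * n ^ 2` covers the longest Kronecker product, of length
`2 * (2 * δ + m) * μ` with `δ, m, μ ≤ n`; a larger `m` is first cut down to `n`. -/
theorem exists_slp_composition {Λ : ℕ} (hΛ : 1 ≤ Λ) {n m d μ δ W : ℕ}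
    (hF : FastMul K (6 * n ^ 2) Λ) (hM : MatMul K μ W) (hW : μ ^ 2 ≤ W) (hm : 1 ≤ m) (hμ : 1 ≤ μ)
    (hμn : μ ≤ n) (hd : d ≤ μ ^ 3) :
    ∃ P : SLP K (InputIdx n m d μ δ) (Fin n),
      P.cost ≤ 6 * compCost n Λ * (W * (δ + m * μ)) ∧
      ∀ (f a : K[X]) (G : K[X][Y]) (A B : Fin μ → K[X][Y]),
        f.degree = (n : WithBot ℕ) → a.degree < (n : WithBot ℕ) → BidegLT m d G →
        (∃ R : Matrix (Fin μ) (Fin μ) K[X], IsMinimalBasis f a R ∧ matDegree R = δ) →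
        (∀ j, BidegLT δ μ (A j) ∧ f ∣ (A j).eval a - a ^ ((j : ℕ) * μ)) →
        (∀ j, BidegLT δ μ (B j) ∧ f ∣ (B j).eval a - a ^ ((j : ℕ) * μ ^ 2)) →
        P.Outputs (inputCoeff f a G A B) (fun i : Fin n => (G.eval a % f).coeff (i : ℕ)) := by
  let Ω := {t : K[X] × K[X] × K[X][Y] × (Fin μ → K[X][Y]) × (Fin μ → K[X][Y]) //
    t.1.degree = (n : WithBot ℕ) ∧ t.2.1.degree < (n : WithBot ℕ) ∧ BidegLT m d t.2.2.1 ∧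
    (∃ R : Matrix (Fin μ) (Fin μ) K[X], IsMinimalBasis t.1 t.2.1 R ∧ matDegree R = δ) ∧
    (∀ j, BidegLT δ μ (t.2.2.2.1 j) ∧
      t.1 ∣ (t.2.2.2.1 j).eval t.2.1 - t.2.1 ^ ((j : ℕ) * μ)) ∧
    (∀ j, BidegLT δ μ (t.2.2.2.2 j) ∧
      t.1 ∣ (t.2.2.2.2 j).eval t.2.1 - t.2.1 ^ ((j : ℕ) * μ ^ 2))}
  -- If no input is admissible for this `δ`, any program will do. Otherwise one admissible input
  -- gives the bounds on `δ`, which are statements about the size parameters alone.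
  rcases isEmpty_or_nonempty Ω with hΩ | ⟨⟨t₀⟩⟩
  · exact ⟨⟨[], fun _ => .result 0⟩, Nat.zero_le _, fun f a G A B hf ha hG hR hA hB =>
      (hΩ.false ⟨⟨f, a, G, A, B⟩, hf, ha, hG, hR, hA, hB⟩).elim⟩
  obtain ⟨hδn, hnδ⟩ : δ ≤ n ∧ n ≤ μ * δ := by
    obtain ⟨R, hR, rfl⟩ := t₀.2.2.2.2.1
    exact hR.matDegree_bounds hμ t₀.2.1
  have hn : 1 ≤ n := hμ.trans hμn
  let f : Ω → K[X] := fun t => t.1.1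
  let a : Ω → K[X] := fun t => t.1.2.1
  let G : Ω → K[X][Y] := fun t => t.1.2.2.1
  let A : Ω → ℕ → K[X][Y] := fun t i => if h : i < μ then t.1.2.2.2.1 ⟨i, h⟩ else 0
  let B : Ω → ℕ → K[X][Y] := fun t i => if h : i < μ then t.1.2.2.2.2 ⟨i, h⟩ else 0
  let v : Ω → InputIdx n m d μ δ → K := fun t =>
    inputCoeff (f t) (a t) (G t) t.1.2.2.2.1 t.1.2.2.2.2
  have hA : ∀ t i (h : i < μ), A t i = t.1.2.2.2.1 ⟨i, h⟩ := fun t i h => dif_pos h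
  have hB : ∀ t i (h : i < μ), B t i = t.1.2.2.2.2 ⟨i, h⟩ := fun t i h => dif_pos h
  have hAd : ∀ t, ∀ i < μ, BidegLT δ μ (A t i) := fun t i h => by
    rw [hA t i h]; exact (t.2.2.2.2.2.1 ⟨i, h⟩).1
  have hBd : ∀ t, ∀ i < μ, BidegLT δ μ (B t i) := fun t i h => by
    rw [hB t i h]; exact (t.2.2.2.2.2.2 ⟨i, h⟩).1
  have hAf : ∀ t, ∀ i < μ, f t ∣ (A t i).eval (a t) - a t ^ (i * μ) := fun t i h => by
    rw [hA t i h]; exact (t.2.2.2.2.2.1 ⟨i, h⟩).2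
  have hBf : ∀ t, ∀ i < μ, f t ∣ (B t i).eval (a t) - a t ^ (i * μ ^ 2) := fun t i h => by
    rw [hB t i h]; exact (t.2.2.2.2.2.2 ⟨i, h⟩).2
  have hfd : ∀ t, (f t).degree = (n : ℕ) := fun t => t.2.1
  have had : ∀ t, (a t).degree < (n : ℕ) := fun t => t.2.2.1
  have hGd : ∀ t, BidegLT m d (G t) := fun t => t.2.2.2.1
  have hfS : coefs f ⊆ insert 0 (Set.range fun i t => v t i) :=
    coefs_subset_of_degree_lt (N := n + 1)
      (fun t => by rw [hfd t]; exact_mod_cast n.lt_succ_self) fun i hi => ⟨.f ⟨i, hi⟩, rfl⟩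
  have haS : coefs a ⊆ insert 0 (Set.range fun i t => v t i) :=
    coefs_subset_of_degree_lt had fun i hi => ⟨.a ⟨i, hi⟩, rfl⟩
  have hGS : bicoefs G ⊆ insert 0 (Set.range fun i t => v t i) :=
    bicoefs_subset_of_bidegLT hGd fun i hi k hk => ⟨.G ⟨i, hi⟩ ⟨k, hk⟩, rfl⟩
  have hAS : ∀ j < μ, bicoefs (fun t => A t j) ⊆ insert 0 (Set.range fun i t => v t i) :=
    fun j hj => bicoefs_subset_of_bidegLT (fun t => hAd t j hj) fun i hi k hk =>
      ⟨.A ⟨j, hj⟩ ⟨i, hi⟩ ⟨k, hk⟩, funext fun t => by simp only [hA t j hj]; rfl⟩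
  have hBS : ∀ j < μ, bicoefs (fun t => B t j) ⊆ insert 0 (Set.range fun i t => v t i) :=
    fun j hj => bicoefs_subset_of_bidegLT (fun t => hBd t j hj) fun i hi k hk =>
      ⟨.B ⟨j, hj⟩ ⟨i, hi⟩ ⟨k, hk⟩, funext fun t => by simp only [hB t j hj]; rfl⟩
  have hZ : ∀ k ≤ n, 2 * (2 * δ + k) * μ ≤ 6 * n ^ 2 := fun k hk =>
    calc 2 * (2 * δ + k) * μ ≤ 2 * (2 * n + n) * n := by gcongr
      _ = 6 * n ^ 2 := by ring
  have hnZ : 4 * n ≤ 6 * n ^ 2 := by nlinarith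
  have key : Reach (Set.range fun i t => v t i) (5 * compCost n Λ * (W * (δ + m * μ)))
      (coefs fun t => (G t).eval (a t) % f t) := by
    rcases le_or_gt m n with hmn | hmn
    · refine (Reach.composition hF hΛ hM hW hm hμ hn hmn hδn hnδ hd (hZ m hmn) hnZ hfd had hGd
        hAd hBd hAf hBf hfS haS hGS hAS hBS).mono_cost ?_
      gcongr
      omega
    · exact Reach.composition_of_lt hF hΛ hM hW hμ hn hmn hδn hnδ hd (hZ n le_rfl) hnZ hfd had hGd
        hAd hBd hAf hBf hfS haS hGS hAS hBS
  obtain ⟨P, hP, hout⟩ := Reach.exists_slp (u := v)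
    (v := fun t (i : Fin n) => ((G t).eval (a t) % f t).coeff i) (key.mono_right (by
      rintro _ ⟨i, rfl⟩
      exact Or.inr (Or.inr ⟨i, rfl⟩)))
  have hpos : 1 ≤ compCost n Λ * (W * (δ + m * μ)) := by
    have h1 : 1 ≤ W := (Nat.one_le_pow 2 μ hμ).trans hW
    have h2 : 1 ≤ m * μ := Nat.mul_pos hm hμ
    exact Nat.mul_pos (one_le_compCost hΛ) (Nat.mul_pos h1 (by omega))
  refine ⟨P, hP.trans ?_, fun f a G A B hf ha hG hR hA hB =>
    hout ⟨⟨f, a, G, A, B⟩, hf, ha, hG, hR, hA, hB⟩⟩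
  linarith

/-- The factor `2` is a bound for `1 / log 2`. -/
theorem natLog_le_two_mul_log (N : ℕ) : (Nat.log 2 N : ℝ) ≤ 2 * Real.log N := by
  have h := Real.natLog_le_logb N 2
  rw [Real.logb, Nat.cast_ofNat, le_div_iff₀ (Real.log_pos one_lt_two)] at h
  have h2 := Real.log_two_gt_d9
  have h0 : (0 : ℝ) ≤ Nat.log 2 N := Nat.cast_nonneg _
  nlinarith

theorem natLog_six_mul_sq_le {n : ℕ} (hn : 1 ≤ n) :
    (Nat.log 2 (6 * n ^ 2) : ℝ) + 1 ≤ 11 * (1 + Real.log n) := by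
  have hn' : (0 : ℝ) < n := by exact_mod_cast hn
  have h := natLog_le_two_mul_log (6 * n ^ 2)
  rw [Nat.cast_mul, Nat.cast_pow, Real.log_mul (by norm_num) (by positivity), Real.log_pow] at h
  have h6 := Real.log_le_sub_one_of_pos (show (0 : ℝ) < 6 by norm_num)
  have hlog : 0 ≤ Real.log n := Real.log_nonneg (by exact_mod_cast hn)
  push_cast at h
  linarith

theorem natClog_four_mul_le {n : ℕ} (hn : 1 ≤ n) :
    (Nat.clog 2 (4 * n) : ℝ) ≤ 7 * (1 + Real.log n) := by
  have hn' : (0 : ℝ) < n := by exact_mod_cast hn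
  have h := natLog_le_two_mul_log (4 * n)
  have hc : (Nat.clog 2 (4 * n) : ℝ) ≤ Nat.log 2 (4 * n) + 1 := by
    exact_mod_cast Nat.clog_le_of_le_pow (Nat.lt_pow_succ_log_self one_lt_two _).le
  rw [Nat.cast_mul, Real.log_mul (by norm_num) hn'.ne'] at h
  have h4 := Real.log_le_sub_one_of_pos (show (0 : ℝ) < 4 by norm_num)
  have hlog : 0 ≤ Real.log n := Real.log_nonneg (by exact_mod_cast hn)
  push_cast at h
  linarith

theorem compCost_le {n : ℕ} (hn : 1 ≤ n) (C e : ℕ) :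
    (compCost n (C * (Nat.log 2 (6 * n ^ 2) + 1) ^ e + 1) : ℝ) ≤
      1015 * (C * 11 ^ e + 1) * (1 + Real.log n) ^ (e + 1) := by
  have hlog : 0 ≤ Real.log n := Real.log_nonneg (by exact_mod_cast hn)
  have h1 := natLog_six_mul_sq_le hn
  have h2 := natClog_four_mul_le hn
  set L : ℝ := 1 + Real.log n
  have hL : 1 ≤ L := by simp only [L]; linarith
  have hΛ : (C * (Nat.log 2 (6 * n ^ 2) + 1 : ℝ) ^ e + 1 : ℝ) ≤ (C * 11 ^ e + 1) * L ^ e :=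
    calc _ ≤ C * (11 * L) ^ e + L ^ e := by
          gcongr
          exact one_le_pow₀ hL
      _ = _ := by rw [mul_pow]; ring
  rw [compCost]
  push_cast
  calc _ ≤ (120 * (7 * L) + 175 * L) * ((C * 11 ^ e + 1) * L ^ e) := by
        gcongr
        linarith
    _ = _ := by ring

theorem le_pow_three_of_rpow_le {d μ : ℕ} (h : (d : ℝ) ^ ((1 : ℝ) / 3) ≤ μ) : d ≤ μ ^ 3 := by
  have := pow_le_pow_left₀ (by positivity) h 3
  rw [← Real.rpow_natCast, ← Real.rpow_mul (by positivity)] at this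
  norm_num at this
  exact_mod_cast this

end Program

end BivComp

/-! ### The main theorem -/

theorem mainTheorem5 (K : Type*) [Field K] (ω : ℝ) (hω : BivComp.IsMatMulExponent K ω) :
    ∃ (C : ℝ) (e : ℕ), ∀ n m d μ δ : ℕ, 0 < m → 0 < d →
      (d : ℝ) ^ ((1 : ℝ) / 3) ≤ (μ : ℝ) → μ ≤ n →
      ∃ P : BivComp.SLP K (BivComp.InputIdx n m d μ δ) (Fin n),
        (P.cost : ℝ) ≤
          C * (1 + Real.log (n : ℝ)) ^ e * ((μ : ℝ) ^ ω * ((δ : ℝ) + (m : ℝ) * (μ : ℝ))) ∧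
        ∀ (f a : K[X]) (G : K[X][Y]) (A B : Fin μ → K[X][Y]),
          f.degree = (n : WithBot ℕ) → a.degree < (n : WithBot ℕ) → BivComp.BidegLT m d G →
          (∃ R : Matrix (Fin μ) (Fin μ) K[X],
            BivComp.IsMinimalBasis f a R ∧ BivComp.matDegree R = δ) →
          (∀ j, BivComp.BidegLT δ μ (A j) ∧ f ∣ (A j).eval a - a ^ ((j : ℕ) * μ)) →
          (∀ j, BivComp.BidegLT δ μ (B j) ∧ f ∣ (B j).eval a - a ^ ((j : ℕ) * μ ^ 2)) →
          P.Outputs (BivComp.inputCoeff f a G A B)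
            (fun i : Fin n => (G.eval a % f).coeff (i : ℕ)) := by

  obtain ⟨Cω, hω⟩ := hω
  obtain ⟨C, e, hF⟩ := BivComp.exists_fastMul K
  refine ⟨6 * (1015 * (C * 11 ^ e + 1)) * Cω, e + 1, fun n m d μ δ hm hd hdμ hμn => ?_⟩
  obtain ⟨P₀, hcost, hP₀⟩ := hω μ
  -- Since `0 < d ≤ μ ^ 3`.
  have hμ : 1 ≤ μ := by
    refine Nat.one_le_iff_ne_zero.2 fun h => ?_
    have := BivComp.le_pow_three_of_rpow_le hdμ
    simp [h] at this
    omega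
  -- The multiplication overhead is increased by one to make it positive, and `W` is the exact cost
  -- of the matrix multiplication program, so that `μ ^ 2 ≤ W` holds without any assumption on `ω`.
  obtain ⟨P, hP, hout⟩ := BivComp.exists_slp_composition (δ := δ) (Nat.le_add_left 1 _)
    (fun N hN hNZ => (hF (6 * n ^ 2) N hN hNZ).mono le_rfl
      (Nat.mul_le_mul_left N (Nat.le_succ _)) (Nat.mul_le_mul_left N (Nat.le_succ _)))
    (BivComp.MatMul.of_slp P₀ hP₀) (BivComp.sq_le_cost_of_matMul P₀ hP₀) hm hμ hμn
    (BivComp.le_pow_three_of_rpow_le hdμ)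
  refine ⟨P, ?_, hout⟩
  have hn : 1 ≤ n := hμ.trans hμn
  have hlog : 0 ≤ Real.log n := Real.log_nonneg (by exact_mod_cast hn)
  calc (P.cost : ℝ)
      ≤ 6 * BivComp.compCost n (C * (Nat.log 2 (6 * n ^ 2) + 1) ^ e + 1) *
          (P₀.cost * (δ + m * μ)) := by exact_mod_cast hP
    _ ≤ 6 * (1015 * (C * 11 ^ e + 1) * (1 + Real.log n) ^ (e + 1)) *
          (Cω * (μ : ℝ) ^ ω * (δ + m * μ)) := by
        gcongr
        exact BivComp.compCost_le hn C e
    _ = _ := by ring
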